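/- **Setting.** Let $d\in\mathbb N$, $L>0$, $\kappa>0$, let $U=[-\frac L2,\frac L2]^d$ be the $d$-dimensional flat torus of side $L$, and let $D\in W^{2,\infty}(U)$ be a periodic potential. For $i=1,2$ let $(\Omega_i,\mathcal A_i,\mu_i)$ be a probability space and $A_i$ a graphop in $B_{2,2}(\Omega_i)$, i.e. a bounded, self-adjoint, positivity preserving linear operator on the real space $L^2(\Omega_i,\mu_i)$, with numerical radius $$n_{\mu_i}(A_i)=\sup\{(A_if,f)_{L^2(\Omega_i)} : \|f\|_{L^2(\Omega_i)}=1\}.$$ Put $\mu=\mu_1\times\mu_2$, $\rho_\infty=L^{-d}$ and $$\hat H(\rho|\rho_\infty)=\int_{\Omega_1\times\Omega_2}\int_U\rho\,\log\Big(\frac{\rho}{\rho_\infty}\Big)\,dx\,d\mu(\xi_1,\xi_2).$$ Let $\rho_0=\rho_0(x,\xi_1,\xi_2)$ be an admissible initial datum: $\rho_0(\cdot,\xi_1,\xi_2)\in H^{3+d}(U)$ is a probability density on $U$ for $\mu$-a.e. $(\xi_1,\xi_2)$, and $\rho_0(x,\cdot,\cdot)\in L^\infty(\Omega_1\times\Omega_2,\mu)$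 for every $x\in U$. Assume $\hat H(\rho_0|\rho_\infty)<\infty$. Consider $$\partial_t\rho=\kappa\,\mathrm{div}_x\big(\rho\,V[A_1,A_2](\rho)\big)+\Delta_x\rho,\qquad \rho(0)=\rho_0,\qquad V[A_1,A_2](\rho)=\nabla D\star(A_1A_2\rho),$$ where $\star$ is convolution in $x\in U$, and $A_i$ acts on the variable $\xi_i$ only (extended from $L^2(\Omega_i)$ by limits along the truncations $\max(-n,\min(\rho,n))$). A solution is a function $\rho(t,x,\xi_1,\xi_2)$ such that $A_1A_2\rho$ is defined and integrable over $U$, and such that, for $\mu$-a.e. $(\xi_1,\xi_2)$, $\rho(\cdot,\cdot,\xi_1,\xi_2)$ is a classical solution of the equation: periodic in $x$, continuous on $[0,\infty)\times U$, $C^1$ in $t$ and $C^2$ in $x$ on $(0,\infty)\times U$. **Lemma.** If $$\kappa\,L^2\,\|\Delta_xD\|_{L^\infty(U)}\,n_{\mu_1}(A_1)\,n_{\mu_2}(A_2)<2\pi^2,$$ then $$\hat\alpha:=\frac{4\pi^2}{L^2}-2\kappa\,\|\Delta_xD\|_{L^\infty(U)}\,n_{\mu_1}(A_1)\,n_{\mu_2}(A_2)>0,$$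 and every solution $\rho$ satisfies, for all $t\ge0$, $\hat H(\rho(t)|\rho_\infty)<\infty$ and $$\hat H(\rho(t)|\rho_\infty)\le e^{-\hat\alpha t}\,\hat H(\rho_0|\rho_\infty).$$ -/

import Mathlib

open MeasureTheory Filter Topology Set
open scoped ENNReal ContDiff

noncomputable section

namespace GraphopMV

/-! ### The flat torus of side `L`

The torus is the box `[-L/2, L/2]^d` with opposite faces identified. Functions on it are functions
on `ℝ^d` that are `L`-periodic in every coordinate; integrals over it are integrals over the box. -/

/-- The box `U = [-L/2, L/2]^d`. -/
def box (d : ℕ) (L : ℝ) : Set (Fin d → ℝ) :=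
  Set.Icc (fun _ => -(L / 2)) (fun _ => L / 2)

/-- Lebesgue measure on the box `U`. -/
def boxMeasure (d : ℕ) (L : ℝ) : Measure (Fin d → ℝ) :=
  volume.restrict (box d L)

/-- `f` is `L`-periodic in each coordinate. -/
def IsPeriodic {d : ℕ} (L : ℝ) (f : (Fin d → ℝ) → ℝ) : Prop :=
  ∀ (x : Fin d → ℝ) (i : Fin d), f (x + Pi.single i L) = f x

/-- The classical partial derivative `∂_i f`. -/
def partialD {d : ℕ} (i : Fin d) (f : (Fin d → ℝ) → ℝ) (x : Fin d → ℝ) : ℝ :=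
  fderiv ℝ f x (Pi.single i 1)

/-! ### Weak derivatives and periodic Sobolev spaces -/

/-- `g` is a weak `i`-th partial derivative of `f`. -/
def HasWeakPartial {d : ℕ} (i : Fin d) (f g : (Fin d → ℝ) → ℝ) : Prop :=
  LocallyIntegrable f ∧ LocallyIntegrable g ∧
    ∀ φ : (Fin d → ℝ) → ℝ, ContDiff ℝ ∞ φ → HasCompactSupport φ →
      ∫ x, f x * partialD i φ x = -∫ x, g x * φ x

/-- Membership of `f` in the Sobolev space `W^{k,p}` of the torus; `H^k` is the case `p = 2`. -/
def MemSobolev {d : ℕ} (L : ℝ) (p : ℝ≥0∞) : ℕ → ((Fin d → ℝ) → ℝ) → Prop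
  | 0, f => IsPeriodic L f ∧ MemLp f p (boxMeasure d L)
  | k + 1, f => IsPeriodic L f ∧ MemLp f p (boxMeasure d L) ∧
      ∀ i : Fin d, ∃ g, HasWeakPartial i f g ∧ MemSobolev L p k g

open Classical in
/-- The weak `i`-th partial derivative of `f` (unique up to null sets; `0` if there is none). -/
def weakPartial {d : ℕ} (i : Fin d) (f : (Fin d → ℝ) → ℝ) : (Fin d → ℝ) → ℝ :=
  if h : ∃ g, HasWeakPartial i f g then h.choose else 0

/-- The weak Laplacian. -/
def weakLaplacian {d : ℕ} (f : (Fin d → ℝ) → ℝ) (x : Fin d → ℝ) : ℝ :=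
  ∑ i, weakPartial i (weakPartial i f) x

/-- `‖Δ D‖_{L^∞(U)}`. -/
def laplacianNorm {d : ℕ} (L : ℝ) (D : (Fin d → ℝ) → ℝ) : ℝ :=
  (eLpNorm (weakLaplacian D) ∞ (boxMeasure d L)).toReal

/-! ### Graphops in `B_{2,2}(Ω)` -/

section Graphop

variable {Ω : Type*} [MeasurableSpace Ω] {μ : Measure Ω}

/-- A graphop in `B_{2,2}(Ω)`: a bounded operator on the real space `L²(Ω, μ)` that is self-adjoint
and positivity preserving. -/
structure IsGraphop (A : Lp ℝ 2 μ →L[ℝ] Lp ℝ 2 μ) : Prop where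
  selfAdjoint : IsSelfAdjoint A
  nonneg : ∀ f : Lp ℝ 2 μ, 0 ≤ f → 0 ≤ A f

/-- The numerical radius `n(A) = sup {(A f, f) : ‖f‖_{L²} = 1}`. -/
def numericalRadius (A : Lp ℝ 2 μ →L[ℝ] Lp ℝ 2 μ) : ℝ :=
  sSup {r : ℝ | ∃ f : Lp ℝ 2 μ, ‖f‖ = 1 ∧ r = inner ℝ (A f) f}

/-- The truncation of `f` to values in `[-n, n]`. -/
def clip (f : Ω → ℝ) (n : ℕ) (ξ : Ω) : ℝ :=
  max (-(n : ℝ)) (min (f ξ) n)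

theorem memLp_clip [IsFiniteMeasure μ] {f : Ω → ℝ} (hf : AEStronglyMeasurable f μ) (n : ℕ) :
    MemLp (clip f n) 2 μ := by
  refine MemLp.of_bound (C := n) ?_ ?_
  · exact (aestronglyMeasurable_const).sup (hf.inf aestronglyMeasurable_const)
  · refine Eventually.of_forall fun ξ => ?_
    rw [Real.norm_eq_abs, abs_le]
    have hn : (0 : ℝ) ≤ n := Nat.cast_nonneg n
    exact ⟨le_max_left _ _, max_le (by linarith) (min_le_right _ _)⟩

open Classical in
/-- The truncation of `f` as an element of `L²(Ω, μ)`. -/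
def clipLp (μ : Measure Ω) (f : Ω → ℝ) (n : ℕ) : Lp ℝ 2 μ :=
  if h : MemLp (clip f n) 2 μ then h.toLp (clip f n) else 0

/-- `g` is (a version of) `A f`. For `f ∈ L²` this says that `g` is a representative of `A f`. A
positivity preserving `A` extends by monotone limits along the truncations of `f` to functions that
need not be square integrable, and this extension is what the definition describes. -/
def ActsAs (A : Lp ℝ 2 μ →L[ℝ] Lp ℝ 2 μ) (f g : Ω → ℝ) : Prop :=
  AEStronglyMeasurable f μ ∧
    ∀ᵐ ξ ∂μ, Tendsto (fun n : ℕ => (A (clipLp μ f n) : Ω → ℝ) ξ) atTop (𝓝 (g ξ))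

end Graphop

/-! ### Relative entropy and admissible data, network space `(Ω, μ)` -/

section Entropy

variable {Ω : Type*} [MeasurableSpace Ω]

/-- The constant density `ρ_∞ = 1 / L^d`. -/
def rhoInf (d : ℕ) (L : ℝ) : ℝ := 1 / L ^ d

/-- The relative entropy `∫_Ω ∫_U F log (F / ρ_∞) dx dμ(ξ)`. -/
def relEntropy {d : ℕ} (L : ℝ) (μ : Measure Ω) (F : (Fin d → ℝ) → Ω → ℝ) : ℝ :=
  ∫ ξ, (∫ x, F x ξ * Real.log (F x ξ / rhoInf d L) ∂(boxMeasure d L)) ∂μ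

/-- The relative entropy of `F` is finite: its integrand is integrable over `U × Ω`. -/
def FiniteEntropy {d : ℕ} (L : ℝ) (μ : Measure Ω) (F : (Fin d → ℝ) → Ω → ℝ) : Prop :=
  Integrable (fun p : (Fin d → ℝ) × Ω => F p.1 p.2 * Real.log (F p.1 p.2 / rhoInf d L))
    ((boxMeasure d L).prod μ)

/-- `f` is the density of an absolutely continuous probability measure on `U`. -/
def IsProbDensity {d : ℕ} (L : ℝ) (f : (Fin d → ℝ) → ℝ) : Prop :=
  (∀ᵐ x ∂(boxMeasure d L), 0 ≤ f x) ∧ Integrable f (boxMeasure d L) ∧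
    ∫ x, f x ∂(boxMeasure d L) = 1

/-- Admissible initial data: `ρ₀(·, ξ) ∈ H^{3+d}(U) ∩ P_ac(U)` for almost every `ξ`, and
`ρ₀(x, ·) ∈ L^∞(Ω, μ)` for every `x`. -/
structure IsAdmissible {d : ℕ} (L : ℝ) (μ : Measure Ω) (ρ₀ : (Fin d → ℝ) → Ω → ℝ) : Prop where
  measurable : Measurable (fun p : (Fin d → ℝ) × Ω => ρ₀ p.1 p.2)
  sobolev : ∀ᵐ ξ ∂μ, MemSobolev L 2 (3 + d) (fun x => ρ₀ x ξ)
  density : ∀ᵐ ξ ∂μ, IsProbDensity L (fun x => ρ₀ x ξ)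
  bounded : ∀ x, MemLp (ρ₀ x) ∞ μ

end Entropy

/-! ### The combined Vlasov term and classical solutions -/

section Solution

variable {Ω₁ Ω₂ : Type*} [MeasurableSpace Ω₁] [MeasurableSpace Ω₂]
  {μ₁ : Measure Ω₁} {μ₂ : Measure Ω₂} {d : ℕ}

/-- `G` is (a jointly measurable version of) `A₁ A₂ F`, where `A₂` acts on the variable `ξ₂` of
`F(x, ξ₁, ξ₂)` for fixed `(x, ξ₁)`, and then `A₁` acts on the variable `ξ₁` for fixed
`(x, ξ₂)`. -/
def CombinedActsAs (L : ℝ) (A₁ : Lp ℝ 2 μ₁ →L[ℝ] Lp ℝ 2 μ₁) (A₂ : Lp ℝ 2 μ₂ →L[ℝ] Lp ℝ 2 μ₂)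
    (F G : (Fin d → ℝ) → Ω₁ × Ω₂ → ℝ) : Prop :=
  ∃ H : (Fin d → ℝ) → Ω₁ × Ω₂ → ℝ,
    Measurable (fun p : (Fin d → ℝ) × Ω₁ × Ω₂ => H p.1 p.2) ∧
    Measurable (fun p : (Fin d → ℝ) × Ω₁ × Ω₂ => G p.1 p.2) ∧
    (∀ᵐ p ∂((boxMeasure d L).prod μ₁),
      ActsAs A₂ (fun ξ₂ => F p.1 (p.2, ξ₂)) (fun ξ₂ => H p.1 (p.2, ξ₂))) ∧
    (∀ᵐ p ∂((boxMeasure d L).prod μ₂),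
      ActsAs A₁ (fun ξ₁ => H p.1 (ξ₁, p.2)) (fun ξ₁ => G p.1 (ξ₁, p.2)))

/-- The `i`-th component of the convolution `∇D ⋆ g` on the torus. -/
def gradConv (L : ℝ) (D : (Fin d → ℝ) → ℝ) (g : (Fin d → ℝ) → ℝ) (i : Fin d)
    (x : Fin d → ℝ) : ℝ :=
  ∫ y, weakPartial i D (x - y) * g y ∂(boxMeasure d L)

/-- The regularity of a classical solution of a parabolic initial value problem on the torus:
continuous on `[0, ∞) × U`, and of class `C¹` in `t` and `C²` in `x` on `(0, ∞) × U`. -/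
structure IsClassical (L : ℝ) (u : ℝ → (Fin d → ℝ) → ℝ) : Prop where
  periodic : ∀ t, 0 ≤ t → IsPeriodic L (u t)
  continuousOn : ContinuousOn (fun p : ℝ × (Fin d → ℝ) => u p.1 p.2) (Ici 0 ×ˢ univ)
  differentiable_time : ∀ t, 0 < t → ∀ x, DifferentiableAt ℝ (fun s => u s x) t
  contDiff_space : ∀ t, 0 < t → ContDiff ℝ 2 (u t)
  continuousOn_time : ContinuousOn
    (fun p : ℝ × (Fin d → ℝ) => deriv (fun s => u s p.2) p.1) (Ioi 0 ×ˢ univ)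
  continuousOn_first : ∀ i, ContinuousOn
    (fun p : ℝ × (Fin d → ℝ) => partialD i (u p.1) p.2) (Ioi 0 ×ˢ univ)
  continuousOn_second : ∀ i j, ContinuousOn
    (fun p : ℝ × (Fin d → ℝ) => partialD i (partialD j (u p.1)) p.2) (Ioi 0 ×ˢ univ)

/-- `ρ(t, x, ξ)`, `ξ = (ξ₁, ξ₂)`, is a classical solution of
`∂_t ρ = κ div_x (ρ (∇D ⋆ A₁ A₂ ρ)) + Δ_x ρ`, `ρ(0) = ρ₀`: for almost every `ξ`, `ρ(·, ·, ξ)` is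
a classical solution of the equation with this `ξ`. The function `g` is `A₁ A₂ ρ`. -/
def IsSolution (L κ : ℝ) (D : (Fin d → ℝ) → ℝ)
    (A₁ : Lp ℝ 2 μ₁ →L[ℝ] Lp ℝ 2 μ₁) (A₂ : Lp ℝ 2 μ₂ →L[ℝ] Lp ℝ 2 μ₂)
    (ρ₀ : (Fin d → ℝ) → Ω₁ × Ω₂ → ℝ) (ρ : ℝ → (Fin d → ℝ) → Ω₁ × Ω₂ → ℝ) : Prop :=
  Measurable (fun p : ℝ × (Fin d → ℝ) × Ω₁ × Ω₂ => ρ p.1 p.2.1 p.2.2) ∧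
  (∀ᵐ ξ ∂(μ₁.prod μ₂), IsClassical L (fun t x => ρ t x ξ)) ∧
  (∀ᵐ ξ ∂(μ₁.prod μ₂), ∀ᵐ x ∂(boxMeasure d L), ρ 0 x ξ = ρ₀ x ξ) ∧
  ∃ g : ℝ → (Fin d → ℝ) → Ω₁ × Ω₂ → ℝ,
    Measurable (fun p : ℝ × (Fin d → ℝ) × Ω₁ × Ω₂ => g p.1 p.2.1 p.2.2) ∧
    (∀ t, 0 < t → CombinedActsAs L A₁ A₂ (ρ t) (g t)) ∧
    (∀ᵐ ξ ∂(μ₁.prod μ₂), ∀ t, 0 < t → Integrable (fun x => g t x ξ) (boxMeasure d L)) ∧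
    (∀ᵐ ξ ∂(μ₁.prod μ₂), ∀ t, 0 < t → ∀ x,
      deriv (fun s => ρ s x ξ) t
        = κ * ∑ i, partialD i (fun y => ρ t y ξ * gradConv L D (fun z => g t z ξ) i y) x
          + ∑ i, partialD i (partialD i (fun y => ρ t y ξ)) x)

end Solution

/-- The decay rate `4π²/L² - 2 κ ‖ΔD‖_{L^∞(U)} n`. -/
def decayRate {d : ℕ} (L κ : ℝ) (D : (Fin d → ℝ) → ℝ) (n : ℝ) : ℝ :=
  4 * Real.pi ^ 2 / L ^ 2 - 2 * κ * laplacianNorm L D * n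

end GraphopMV

end

open GraphopMV

/-! Fix the network variable ξ, put g = A₁A₂ρ and H = ∫ ρ log(ρ/ρ_∞) dx. Testing the equation with
log ρ + 1 and integrating by parts gives, formally, H' = -∫ |∇ρ|²/ρ dx + κ ∫ ρ (ΔD ⋆ g) dx. The
first term is at most -(4π²/L²) H by a logarithmic Sobolev inequality (`log_sobolev_torus`). In the
second, ΔD has mean zero over a period, so ρ may be replaced by ρ - ρ_∞ and g by g - c for any c
constant in x; the term is thus at most κ ‖ΔD‖_∞ ‖ρ - ρ_∞‖₁ ‖g - c‖₁, with L¹ norms in x.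

Choose c = ρ_∞ A₁1(ξ₁) A₂1(ξ₂), so that g - c is A₁A₂(ρ - ρ_∞). Because the operators preserve
positivity, the L¹ norm in x passes through them, and the mean square over ξ of ‖g - c‖₁ is at most
(‖A₁‖ ‖A₂‖)² times that of ‖ρ - ρ_∞‖₁ (`CombinedActsAs.lintegral_sq_le`). The norm of a graphop is
at most its numerical radius (`IsGraphop.norm_le_numericalRadius`), and Pinsker's inequality bounds
‖ρ - ρ_∞‖₁² by 2H (`sq_integral_abs_sub_rhoInf_le`). After averaging over ξ the coupling costs at
most 2κ ‖ΔD‖_∞ n(A₁) n(A₂) times the averaged entropy, and what is left of 4π²/L² is the decay rate.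

Three points need care. The logarithm is singular where ρ vanishes: nonnegativity and unit mass are
first derived from the equation (`IsDensitySolution.nonneg`, `IsDensitySolution.integral_eq`), the
entropy is computed for ρ + ε, and ε → 0 is taken only after integration in time
(`IsDensitySolution.entropy_inequality`). The action of A is a limit along truncations, so bounds on
it come from duality and Fatou's lemma. Finally, no time derivative is exchanged with the integral
over ξ: the time-integrated inequalities are averaged with values in [0, ∞], finiteness is
established before the coupling is absorbed, and exponential decay follows by iterating over short
time steps (`lintegral_toReal_le_exp_mul`). -/

namespace GraphopMV

/-! ### Cauchy–Schwarz -/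

theorem sq_integral_mul_le {α : Type*} [MeasurableSpace α] {μ : Measure α} {f g : α → ℝ}
    (hf : Integrable (fun x => f x ^ 2) μ) (hg : Integrable (fun x => g x ^ 2) μ)
    (hfg : Integrable (fun x => f x * g x) μ) :
    (∫ x, f x * g x ∂μ) ^ 2 ≤ (∫ x, f x ^ 2 ∂μ) * ∫ x, g x ^ 2 ∂μ := by
  have key : ∀ t : ℝ, 0 ≤ (∫ x, f x ^ 2 ∂μ) * (t * t) + (2 * ∫ x, f x * g x ∂μ) * t
      + ∫ x, g x ^ 2 ∂μ := by
    intro t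
    have h1 : ∫ x, (t * f x + g x) ^ 2 ∂μ = (∫ x, f x ^ 2 ∂μ) * (t * t)
        + (2 * ∫ x, f x * g x ∂μ) * t + ∫ x, g x ^ 2 ∂μ := by
      have : (fun x => (t * f x + g x) ^ 2)
          = fun x => (t * t) * f x ^ 2 + (2 * t) * (f x * g x) + g x ^ 2 := by
        ext x; ring
      have h2 : Integrable (fun x => t * t * f x ^ 2 + 2 * t * (f x * g x)) μ :=
        (hf.const_mul _).add (hfg.const_mul _)
      rw [this, integral_add h2 hg, integral_add (hf.const_mul _) (hfg.const_mul _),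
        integral_const_mul, integral_const_mul]
      ring
    rw [← h1]
    exact integral_nonneg fun x => sq_nonneg _
  have := discrim_le_zero key
  unfold discrim at this
  nlinarith

/-! ### The logarithmic Sobolev inequality on the circle -/

/-- Parseval for g and for g': the n-th Fourier coefficient of g' is 2πin/T times that of g, and the
zeroth coefficient of g vanishes, so |n| ≥ 1 in every term that matters. -/
theorem wirtinger_inequality {T : ℝ} (hT : 0 < T) (a : ℝ) {g : ℝ → ℝ} (hg : ContDiff ℝ 1 g)
    (hper : Function.Periodic g T) (hmean : ∫ x in a..a + T, g x = 0) :
    4 * Real.pi ^ 2 * ∫ x in a..a + T, g x ^ 2 ≤ T ^ 2 * ∫ x in a..a + T, deriv g x ^ 2 := by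
  have hab : a < a + T := by linarith
  have hgc : Continuous g := hg.continuous
  have hg'c : Continuous (deriv g) := hg.continuous_deriv le_rfl
  have mem : ∀ f : ℝ → ℝ, Continuous f →
      MemLp (fun x => (f x : ℂ)) 2 (volume.restrict (Ioc a (a + T))) := by
    intro f hf
    have hc : Continuous fun x => (f x : ℂ) := Complex.continuous_ofReal.comp hf
    obtain ⟨C, hC⟩ := (isCompact_Icc (a := a) (b := a + T)).exists_bound_of_continuousOn
      hc.continuousOn
    refine MemLp.of_bound hc.aestronglyMeasurable C ?_
    filter_upwards [ae_restrict_mem measurableSet_Ioc] with x hx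
    exact hC x (Ioc_subset_Icc_self hx)
  have hs1 := hasSum_sq_fourierCoeffOn hab (mem g hgc)
  have hs2 := hasSum_sq_fourierCoeffOn hab (mem (deriv g) hg'c)
  simp only [Complex.norm_real, Real.norm_eq_abs, sq_abs, add_sub_cancel_left, smul_eq_mul]
    at hs1 hs2
  have hle := hasSum_le ?_ (hs1.mul_left (4 * Real.pi ^ 2)) (hs2.mul_left (T ^ 2))
  · have := mul_le_mul_of_nonneg_left hle hT.le
    calc _ = T * (4 * Real.pi ^ 2 * (T⁻¹ * ∫ x in a..a + T, g x ^ 2)) := by field_simp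
      _ ≤ _ := this
      _ = _ := by field_simp
  · intro n
    rcases eq_or_ne n 0 with rfl | hn
    · have : fourierCoeffOn hab (fun x => (g x : ℂ)) 0 = 0 := by
        rw [fourierCoeffOn_eq_integral]
        simp [intervalIntegral.integral_ofReal, hmean]
      rw [this, norm_zero, zero_pow two_ne_zero, mul_zero]
      positivity
    · have h := fourierCoeffOn_of_hasDerivAt hab (f := fun x => (g x : ℂ))
        (f' := fun x => ((deriv g x : ℝ) : ℂ)) hn
        (fun x _ => ((hg.differentiable one_ne_zero x).hasDerivAt).ofReal_comp)
        ((Complex.continuous_ofReal.comp hg'c).intervalIntegrable _ _)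
      rw [hper a, sub_self, mul_zero, zero_sub] at h
      have hnorm : ‖fourierCoeffOn hab (fun x => (g x : ℂ)) n‖
          = 1 / (2 * Real.pi * |(n : ℝ)|) *
            (T * ‖fourierCoeffOn hab (fun x => ((deriv g x : ℝ) : ℂ)) n‖) := by
        rw [h]
        simp only [norm_mul, norm_div, norm_neg, norm_one, Complex.norm_real, Complex.norm_I,
          Complex.norm_intCast, Real.norm_eq_abs, abs_of_pos Real.pi_pos, mul_one]
        rw [show ((a + T : ℝ) : ℂ) - (a : ℂ) = ((T : ℝ) : ℂ) by push_cast; ring,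
          Complex.norm_real, Real.norm_eq_abs, abs_of_pos hT]
        norm_num
      have hn1 : (1 : ℝ) ≤ |(n : ℝ)| := by
        rw [← Int.cast_abs]
        exact_mod_cast Int.one_le_abs hn
      rw [hnorm]
      set c := ‖fourierCoeffOn hab (fun x => ((deriv g x : ℝ) : ℂ)) n‖
      have hpi := Real.pi_pos
      have : 4 * Real.pi ^ 2 * (1 / (2 * Real.pi * |(n : ℝ)|) * (T * c)) ^ 2
          = T ^ 2 * c ^ 2 * (1 / |(n : ℝ)|) ^ 2 := by
        field_simp
        ring
      rw [this]
      have h1 : (1 / |(n : ℝ)|) ^ 2 ≤ 1 := by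
        apply pow_le_one₀ (by positivity)
        rw [div_le_one (by linarith)]
        exact hn1
      nlinarith [mul_nonneg (sq_nonneg T) (sq_nonneg c)]

/-- Integration by parts against the sawtooth y - x - T/2 over one period starting at x gives T
g(x), since g has mean zero. Cauchy–Schwarz concludes, the square integral of the sawtooth being
T³/12. -/
theorem sq_le_integral_sq_deriv_of_mean_zero {T : ℝ} (hT : 0 < T) (a : ℝ) {g : ℝ → ℝ}
    (hg : ContDiff ℝ 1 g) (hper : Function.Periodic g T) (hmean : ∫ x in a..a + T, g x = 0)
    (x : ℝ) : 12 * g x ^ 2 ≤ T * ∫ y in a..a + T, deriv g y ^ 2 := by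
  have hgc : Continuous g := hg.continuous
  have hg'c : Continuous (deriv g) := hg.continuous_deriv le_rfl
  have hper' : Function.Periodic (fun y => deriv g y ^ 2) T := by
    intro y
    have : deriv (fun z => g (z + T)) y = deriv g (y + T) := deriv_comp_add_const _ _ _
    rw [show (fun z => g (z + T)) = g from funext hper] at this
    simp only [this]
  have hparts := intervalIntegral.integral_mul_deriv_eq_deriv_mul (a := x) (b := x + T)
    (u := fun y => y - x - T / 2) (u' := fun _ => 1) (v := g) (v' := deriv g)
    (fun y _ => ((hasDerivAt_id y).sub_const x).sub_const _)
    (fun y _ => (hg.differentiable one_ne_zero y).hasDerivAt)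
    (continuous_const.intervalIntegrable _ _) (hg'c.intervalIntegrable _ _)
  have h0 : ∫ y in x..x + T, 1 * g y = 0 := by
    simp only [one_mul]
    rw [hper.intervalIntegral_add_eq x a, hmean]
  rw [h0, hper x] at hparts
  have hk : ∫ y in x..x + T, (y - x - T / 2) ^ 2 = T ^ 3 / 12 := by
    have h := intervalIntegral.integral_comp_sub_right (a := x) (b := x + T)
      (fun y : ℝ => y ^ 2) (x + T / 2)
    simp only [← sub_sub] at h
    rw [h, integral_pow]
    push_cast
    ring
  have hcs := sq_integral_mul_le (μ := volume.restrict (Ioc x (x + T)))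
    (f := fun y => y - x - T / 2) (g := deriv g)
    ((by fun_prop : Continuous fun y : ℝ => (y - x - T / 2) ^ 2).integrableOn_Ioc)
    ((by fun_prop : Continuous fun y : ℝ => deriv g y ^ 2).integrableOn_Ioc)
    ((by fun_prop : Continuous fun y : ℝ => (y - x - T / 2) * deriv g y).integrableOn_Ioc)
  rw [← intervalIntegral.integral_of_le (by linarith),
    ← intervalIntegral.integral_of_le (by linarith),
    ← intervalIntegral.integral_of_le (by linarith), hparts, hk,
    hper'.intervalIntegral_add_eq x a] at hcs
  have hT2 : 0 < T ^ 2 := by positivity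
  have : T ^ 2 * (12 * g x ^ 2) ≤ T ^ 2 * (T * ∫ y in a..a + T, deriv g y ^ 2) := by
    nlinarith
  exact le_of_mul_le_mul_left this hT2

/-- The right-hand side is the quadratic Taylor polynomial of exp at 2q. From m² = 1 - v one has m ≤
1 - v/2, hence m³ + 3mv = m(1 + 2v) ≤ 1 + 3v/2; the remaining term satisfies 2rv ≤ 2rq ≤ q/2 + 2q²
by the arithmetic–geometric mean inequality. -/
theorem cubic_moment_bound {m v q r b : ℝ} (hv0 : 0 ≤ v) (hr0 : 0 ≤ r)
    (hmv : m ^ 2 + v = 1) (hvq : v ≤ q) (hrq : r ^ 2 = q)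
    (h2 : b ≤ m ^ 3 + (3 * m + 2 * r) * v) : b ≤ 1 + 2 * q + 2 * q ^ 2 := by
  have hq0 : 0 ≤ q := hv0.trans hvq
  have hm1 : m ≤ 1 - v / 2 := by
    have hv1 : v ≤ 1 := by linarith [sq_nonneg m]
    apply le_of_sq_le_sq _ (by linarith)
    linarith [sq_nonneg v, show (1 - v / 2) ^ 2 = 1 - v + v ^ 2 / 4 by ring]
  have h3 : m ^ 3 + 3 * m * v ≤ 1 + 3 / 2 * v := by
    have : m ^ 3 + 3 * m * v = m * (1 + 2 * v) := by
      have : m ^ 2 = 1 - v := by linarith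
      calc m ^ 3 + 3 * m * v = m * (m ^ 2 + 3 * v) := by ring
        _ = _ := by rw [this]; ring
    rw [this]
    have := mul_le_mul_of_nonneg_right hm1 (by linarith : (0 : ℝ) ≤ 1 + 2 * v)
    linarith [sq_nonneg v, show (1 - v / 2) * (1 + 2 * v) = 1 + 3 / 2 * v - v ^ 2 by ring]
  have h4 : r * v ≤ r * q := mul_le_mul_of_nonneg_left hvq hr0
  have h5 : 2 * (r * q) ≤ q / 2 + 2 * q ^ 2 := by
    have h6 : 0 ≤ q * (2 * (r - 1 / 2) ^ 2) := by positivity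
    have h7 : q * (2 * (r - 1 / 2) ^ 2) = 2 * q * r ^ 2 - 2 * (r * q) + q / 2 := by ring
    rw [h7, hrq] at h6
    linarith [show 2 * q * q = 2 * q ^ 2 by ring]
  linarith [show m ^ 3 + (3 * m + 2 * r) * v = m ^ 3 + 3 * m * v + 2 * (r * v) by ring]

set_option maxHeartbeats 800000 in
-- The constant is half the sharp one, which leaves room for an elementary proof. Jensen's
-- inequality for log under the probability density f²/T bounds the entropy by 2T log b, with b the
-- mean of f³. Writing f = m + g with m the mean, the cube is controlled by the variance of f
-- (Wirtinger) and the supremum of g, and the outcome is log b ≤ 2q, where q is the rescaled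
-- Dirichlet energy.
theorem log_sobolev_circle_normalized {T : ℝ} (hT : 0 < T) (a : ℝ) {f : ℝ → ℝ}
    (hf : ContDiff ℝ 1 f) (hper : Function.Periodic f T) (hpos : ∀ x, 0 < f x)
    (hnorm : ∫ x in a..a + T, f x ^ 2 = T) :
    Real.pi ^ 2 * ∫ x in a..a + T, f x ^ 2 * Real.log (f x ^ 2)
      ≤ T ^ 2 * ∫ x in a..a + T, deriv f x ^ 2 := by
  have hab : a ≤ a + T := by linarith
  have hfc : Continuous f := hf.continuous
  have hf'c : Continuous (deriv f) := hf.continuous_deriv le_rfl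
  have ii : ∀ h : ℝ → ℝ, Continuous h → IntervalIntegrable h volume a (a + T) :=
    fun h hh => hh.intervalIntegrable _ _
  set F := ∫ x in a..a + T, deriv f x ^ 2 with hF
  have hF0 : 0 ≤ F := intervalIntegral.integral_nonneg hab fun _ _ => sq_nonneg _
  obtain ⟨m, hm⟩ : ∃ m, m = T⁻¹ * ∫ x in a..a + T, f x := ⟨_, rfl⟩
  have hfi : ∫ x in a..a + T, f x = T * m := by rw [hm]; field_simp
  have hm0 : 0 ≤ m := by
    rw [hm]
    exact mul_nonneg (by positivity) (intervalIntegral.integral_nonneg hab fun x _ => (hpos x).le)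
  set g := fun x => f x - m with hg
  have hgd : ContDiff ℝ 1 g := hf.sub contDiff_const
  have hgc : Continuous g := hgd.continuous
  have hgper : Function.Periodic g T := fun x => by simp only [hg, hper x]
  have hg' : deriv g = deriv f := by ext x; simp [hg]
  have hgm : ∫ x in a..a + T, g x = 0 := by
    simp only [hg]
    rw [intervalIntegral.integral_sub (ii _ hfc) (ii _ continuous_const), hfi]
    simp
  obtain ⟨v, hv⟩ : ∃ v, v = T⁻¹ * ∫ x in a..a + T, g x ^ 2 := ⟨_, rfl⟩
  have hgi : ∫ x in a..a + T, g x ^ 2 = T * v := by rw [hv]; field_simp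
  have hv0 : 0 ≤ v := by
    rw [hv]
    exact mul_nonneg (by positivity) (intervalIntegral.integral_nonneg hab fun x _ => sq_nonneg _)
  have hmv : m ^ 2 + v = 1 := by
    have : ∫ x in a..a + T, f x ^ 2 = T * v + 2 * m * 0 + T * m ^ 2 := by
      rw [← hgi, ← hgm, ← intervalIntegral.integral_const_mul]
      have hc : T * m ^ 2 = ∫ x in a..a + T, m ^ 2 := by simp
      rw [hc, ← intervalIntegral.integral_add (ii _ (by fun_prop)) (ii _ (by fun_prop)),
        ← intervalIntegral.integral_add (ii _ (by fun_prop)) (ii _ (by fun_prop))]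
      congr 1
      ext x
      simp only [hg]
      ring
    rw [hnorm] at this
    have : T * 1 = T * (m ^ 2 + v) := by linarith
    exact (mul_left_cancel₀ hT.ne' this).symm
  set q := T * F / (4 * Real.pi ^ 2) with hq
  have hpi : 0 < Real.pi := Real.pi_pos
  have hq0 : 0 ≤ q := by positivity
  have hvq : v ≤ q := by
    have := wirtinger_inequality hT a hgd hgper hgm
    rw [hg', hgi] at this
    rw [hq, le_div_iff₀ (by positivity)]
    have h2 : T * (v * (4 * Real.pi ^ 2)) ≤ T * (T * F) := by linarith
    exact le_of_mul_le_mul_left h2 hT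
  set r := Real.sqrt q with hr
  have hrq : r ^ 2 = q := Real.sq_sqrt hq0
  have hr0 : 0 ≤ r := Real.sqrt_nonneg _
  have hgM : ∀ x, g x ≤ 2 * r := by
    intro x
    have := sq_le_integral_sq_deriv_of_mean_zero hT a hgd hgper hgm x
    rw [hg'] at this
    have hTF : T * F = 4 * Real.pi ^ 2 * q := by rw [hq]; field_simp
    -- The supremum bound reads g² ≤ TF/12 = π²q/3, and π² ≤ 12 turns this into g² ≤ 4q = (2r)².
    have hpi2 : Real.pi ^ 2 ≤ 12 := by nlinarith [Real.pi_lt_d2]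
    have h3 : g x ^ 2 ≤ (2 * r) ^ 2 := by
      have : Real.pi ^ 2 * q ≤ 12 * q := mul_le_mul_of_nonneg_right hpi2 hq0
      linarith [show (2 * r) ^ 2 = 4 * r ^ 2 by ring]
    exact le_of_sq_le_sq h3 (by positivity)
  obtain ⟨b, hb⟩ : ∃ b, b = T⁻¹ * ∫ x in a..a + T, f x ^ 3 := ⟨_, rfl⟩
  have hfi3 : ∫ x in a..a + T, f x ^ 3 = T * b := by rw [hb]; field_simp
  have hb0 : 0 < b := by
    rw [hb]
    refine mul_pos (by positivity) (intervalIntegral.intervalIntegral_pos_of_pos_on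
      (ii _ (by fun_prop)) (fun x _ => pow_pos (hpos x) 3) (by linarith))
  have hbq : b ≤ 1 + 2 * q + 2 * q ^ 2 := by
    have h1 : T * b ≤ T * m ^ 3 + 3 * m ^ 2 * 0 + (3 * m + 2 * r) * (T * v) := by
      have hc : T * m ^ 3 = ∫ x in a..a + T, m ^ 3 := by simp
      rw [← hgi, ← hgm, ← hfi3, ← intervalIntegral.integral_const_mul,
        ← intervalIntegral.integral_const_mul, hc,
        ← intervalIntegral.integral_add (ii _ (by fun_prop)) (ii _ (by fun_prop)),
        ← intervalIntegral.integral_add (ii _ (by fun_prop)) (ii _ (by fun_prop))]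
      refine intervalIntegral.integral_mono_on hab (ii _ (by fun_prop)) (ii _ (by fun_prop)) ?_
      intro x _
      have hfx : f x = g x + m := by simp [hg]
      rw [hfx]
      have := mul_le_mul_of_nonneg_right (hgM x) (sq_nonneg (g x))
      -- The cube of g + m has quadratic and cubic terms (3m + g) g², and g ≤ 2r is used only in the
      -- latter.
      nlinarith
    have h2 : b ≤ m ^ 3 + (3 * m + 2 * r) * v := by
      have : T * b ≤ T * (m ^ 3 + (3 * m + 2 * r) * v) := by linarith
      exact le_of_mul_le_mul_left this hT
    exact cubic_moment_bound hv0 hr0 hmv hvq hrq h2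
  have hlogb : Real.log b ≤ 2 * q := by
    rw [Real.log_le_iff_le_exp hb0]
    have := Real.quadratic_le_exp_of_nonneg (by positivity : 0 ≤ 2 * q)
    nlinarith
  have hflog : Continuous fun x => f x ^ 2 * Real.log (f x ^ 2) := by
    have : Continuous fun x => Real.log (f x ^ 2) :=
      (by fun_prop : Continuous fun x => f x ^ 2).log fun x => (pow_pos (hpos x) 2).ne'
    fun_prop
  -- Jensen's inequality in tangent-line form: log f ≤ log b + f/b - 1, with b the mean of f under
  -- the density f²/T.
  have hE : ∫ x in a..a + T, f x ^ 2 * Real.log (f x ^ 2) ≤ 2 * T * Real.log b := by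
    calc ∫ x in a..a + T, f x ^ 2 * Real.log (f x ^ 2)
        ≤ ∫ x in a..a + T, ((2 / b) * f x ^ 3 + (2 * (Real.log b - 1)) * f x ^ 2) := by
          refine intervalIntegral.integral_mono_on hab (ii _ hflog) (ii _ (by fun_prop)) ?_
          intro x _
          have h1 : Real.log (f x / b) ≤ f x / b - 1 :=
            Real.log_le_sub_one_of_pos (div_pos (hpos x) hb0)
          rw [Real.log_div (hpos x).ne' hb0.ne'] at h1
          rw [Real.log_pow]
          have h2 := mul_le_mul_of_nonneg_left h1 (sq_nonneg (f x))
          have h3 : f x ^ 2 * (f x / b) = f x ^ 3 / b := by ring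
          have h4 : 2 / b * f x ^ 3 = 2 * (f x ^ 3 / b) := by ring
          rw [h4]
          push_cast
          nlinarith
      _ = 2 * T * Real.log b := by
          rw [intervalIntegral.integral_add (ii _ (by fun_prop)) (ii _ (by fun_prop)),
            intervalIntegral.integral_const_mul, intervalIntegral.integral_const_mul, hfi3, hnorm]
          field_simp
          ring
  calc Real.pi ^ 2 * ∫ x in a..a + T, f x ^ 2 * Real.log (f x ^ 2)
      ≤ Real.pi ^ 2 * (2 * T * (2 * q)) := by
        refine mul_le_mul_of_nonneg_left (hE.trans ?_) (by positivity)
        exact mul_le_mul_of_nonneg_left hlogb (by positivity)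
    _ = T ^ 2 * F := by rw [hq]; field_simp; ring

theorem log_sobolev_circle {T : ℝ} (hT : 0 < T) (a : ℝ) {v : ℝ → ℝ}
    (hv : ContDiff ℝ 1 v) (hper : Function.Periodic v T) (hpos : ∀ x, 0 < v x) :
    4 * Real.pi ^ 2 / T ^ 2 * ∫ x in a..a + T,
        v x * Real.log (v x / (T⁻¹ * ∫ y in a..a + T, v y))
      ≤ ∫ x in a..a + T, deriv v x ^ 2 / v x := by
  have hab : a < a + T := by linarith
  set M := T⁻¹ * ∫ y in a..a + T, v y with hM
  have hI : 0 < ∫ y in a..a + T, v y :=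
    intervalIntegral.intervalIntegral_pos_of_pos_on (hv.continuous.intervalIntegrable _ _)
      (fun x _ => hpos x) hab
  have hM0 : 0 < M := mul_pos (by positivity) hI
  have hvM : ∀ x, 0 < v x / M := fun x => div_pos (hpos x) hM0
  set f := fun x => Real.sqrt (v x / M) with hf
  have hf2 : ∀ x, f x ^ 2 = v x / M := fun x => Real.sq_sqrt (hvM x).le
  have hfd : ContDiff ℝ 1 f := (hv.div_const M).sqrt fun x => (hvM x).ne'
  have hfp : ∀ x, 0 < f x := fun x => Real.sqrt_pos.2 (hvM x)
  have hd : ∀ x, deriv f x ^ 2 = (4 * M)⁻¹ * (deriv v x ^ 2 / v x) := by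
    intro x
    have h1 : HasDerivAt f (deriv v x / M / (2 * f x)) x :=
      (((hv.differentiable one_ne_zero x).hasDerivAt).div_const M).sqrt (hvM x).ne'
    rw [h1.deriv, div_pow, mul_pow, hf2]
    have := (hpos x).ne'
    field_simp
    ring
  have h := log_sobolev_circle_normalized hT a hfd (fun x => by simp only [hf, hper x]) hfp (by
    simp only [hf2]
    rw [intervalIntegral.integral_div, hM]
    field_simp)
  simp only [hd, hf2, intervalIntegral.integral_const_mul] at h
  have h2 : ∫ x in a..a + T, v x / M * Real.log (v x / M)
      = M⁻¹ * ∫ x in a..a + T, v x * Real.log (v x / M) := by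
    rw [← intervalIntegral.integral_const_mul]
    congr 1
    ext x
    ring
  rw [h2] at h
  set A := ∫ x in a..a + T, v x * Real.log (v x / M)
  set B := ∫ x in a..a + T, deriv v x ^ 2 / v x
  have h3 : 4 * M * (Real.pi ^ 2 * (M⁻¹ * A)) ≤ 4 * M * (T ^ 2 * ((4 * M)⁻¹ * B)) :=
    mul_le_mul_of_nonneg_left h (by positivity)
  have h4 : 4 * M * (Real.pi ^ 2 * (M⁻¹ * A)) = 4 * Real.pi ^ 2 * A := by field_simp
  have h5 : 4 * M * (T ^ 2 * ((4 * M)⁻¹ * B)) = T ^ 2 * B := by field_simp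
  rw [h4, h5] at h3
  rw [div_mul_eq_mul_div, div_le_iff₀ (by positivity)]
  linarith

/-! ### Integrals over the box -/

theorem isCompact_box (d : ℕ) (L : ℝ) : IsCompact (box d L) := isCompact_Icc

theorem measurableSet_box (d : ℕ) (L : ℝ) : MeasurableSet (box d L) :=
  (isCompact_box d L).measurableSet

instance isFiniteMeasure_boxMeasure (d : ℕ) (L : ℝ) : IsFiniteMeasure (boxMeasure d L) :=
  ⟨by rw [boxMeasure, Measure.restrict_apply_univ]; exact (isCompact_box d L).measure_lt_top⟩

theorem boxMeasure_real_univ (d : ℕ) {L : ℝ} (hL : 0 < L) : (boxMeasure d L).real univ = L ^ d := by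
  rw [boxMeasure, measureReal_restrict_apply_univ, box, measureReal_def,
    Real.volume_Icc_pi_toReal (fun i => by linarith)]
  simp

theorem integral_const_boxMeasure (d : ℕ) {L : ℝ} (hL : 0 < L) (c : ℝ) :
    ∫ _, c ∂(boxMeasure d L) = L ^ d * c := by
  rw [integral_const, boxMeasure_real_univ d hL, smul_eq_mul]

theorem integrable_boxMeasure {d : ℕ} {L : ℝ} {f : (Fin d → ℝ) → ℝ} (hf : Continuous f) :
    Integrable f (boxMeasure d L) :=
  hf.continuousOn.integrableOn_compact (isCompact_box d L)

/-- Lebesgue measure on the interval `[-L/2, L/2]`. -/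
noncomputable abbrev sideMeasure (L : ℝ) : Measure ℝ := volume.restrict (Icc (-(L / 2)) (L / 2))

theorem integrable_side_prod_box {d : ℕ} {L : ℝ} {f : ℝ × (Fin d → ℝ) → ℝ} (hf : Continuous f) :
    Integrable f ((sideMeasure L).prod (boxMeasure d L)) := by
  rw [sideMeasure, boxMeasure, Measure.prod_restrict]
  exact hf.continuousOn.integrableOn_compact (isCompact_Icc.prod (isCompact_box d L))

theorem integral_box_succ_prod {d : ℕ} {L : ℝ} (f : (Fin (d + 1) → ℝ) → ℝ) :
    ∫ x, f x ∂(boxMeasure (d + 1) L)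
      = ∫ p, f (Fin.cons p.1 p.2) ∂((sideMeasure L).prod (boxMeasure d L)) := by
  have hm := volume_preserving_piFinSuccAbove (fun _ : Fin (d + 1) => ℝ) 0
  have h := hm.setIntegral_preimage_emb (MeasurableEquiv.measurableEmbedding _)
    (fun p : ℝ × (Fin d → ℝ) => f (Fin.cons p.1 p.2)) (Icc (-(L / 2)) (L / 2) ×ˢ box d L)
  rw [sideMeasure, boxMeasure, boxMeasure, Measure.prod_restrict]
  rw [← Measure.volume_eq_prod, ← h]
  have hset : (MeasurableEquiv.piFinSuccAbove (fun _ : Fin (d + 1) => ℝ) 0) ⁻¹'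
      (Icc (-(L / 2)) (L / 2) ×ˢ box d L) = box (d + 1) L := by
    ext x
    simp only [box, mem_preimage, mem_prod, mem_Icc, Pi.le_def, Fin.forall_fin_succ,
      MeasurableEquiv.piFinSuccAbove, MeasurableEquiv.coe_mk, Fin.insertNthEquiv]
    simp
    tauto
  rw [hset]
  refine integral_congr_ae (Eventually.of_forall fun x => ?_)
  show f x = f _
  congr 1
  exact (Fin.cons_self_tail x).symm

theorem continuous_cons (d : ℕ) :
    Continuous fun p : ℝ × (Fin d → ℝ) => (Fin.cons p.1 p.2 : Fin (d + 1) → ℝ) :=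
  Continuous.finCons continuous_fst continuous_snd

theorem integral_box_succ {d : ℕ} {L : ℝ} {f : (Fin (d + 1) → ℝ) → ℝ} (hf : Continuous f) :
    ∫ x, f x ∂(boxMeasure (d + 1) L)
      = ∫ s, ∫ y, f (Fin.cons s y) ∂(boxMeasure d L) ∂(sideMeasure L) := by
  rw [integral_box_succ_prod, integral_prod]
  exact integrable_side_prod_box (hf.comp (continuous_cons d))

theorem integral_box_succ_symm {d : ℕ} {L : ℝ} {f : (Fin (d + 1) → ℝ) → ℝ} (hf : Continuous f) :
    ∫ x, f x ∂(boxMeasure (d + 1) L)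
      = ∫ y, ∫ s, f (Fin.cons s y) ∂(sideMeasure L) ∂(boxMeasure d L) := by
  rw [integral_box_succ_prod, integral_prod_symm]
  exact integrable_side_prod_box (hf.comp (continuous_cons d))

theorem integral_sideMeasure {L : ℝ} (hL : 0 < L) (f : ℝ → ℝ) :
    ∫ s, f s ∂(sideMeasure L) = ∫ s in (-(L / 2))..(-(L / 2) + L), f s := by
  rw [sideMeasure, intervalIntegral.integral_of_le (by linarith), integral_Icc_eq_integral_Ioc]
  congr 3
  ring

theorem integrable_sideMeasure {L : ℝ} {f : ℝ → ℝ} (hf : Continuous f) :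
    Integrable f (sideMeasure L) :=
  hf.continuousOn.integrableOn_compact isCompact_Icc

theorem continuous_integral_box {X : Type*} [TopologicalSpace X] [FirstCountableTopology X]
    [LocallyCompactSpace X] {d : ℕ} {L : ℝ} {f : X → (Fin d → ℝ) → ℝ}
    (hf : Continuous (Function.uncurry f)) : Continuous fun x => ∫ y, f x y ∂(boxMeasure d L) :=
  continuous_parametric_integral_of_continuous hf (isCompact_box d L)

theorem continuous_integral_side {X : Type*} [TopologicalSpace X] [FirstCountableTopology X]
    [LocallyCompactSpace X] {L : ℝ} {f : X → ℝ → ℝ}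
    (hf : Continuous (Function.uncurry f)) : Continuous fun x => ∫ y, f x y ∂(sideMeasure L) :=
  continuous_parametric_integral_of_continuous hf isCompact_Icc

theorem integral_boxMeasure_pos {d : ℕ} {L : ℝ} (hL : 0 < L) {f : (Fin d → ℝ) → ℝ}
    (hf : Continuous f) (hpos : ∀ x, 0 < f x) : 0 < ∫ x, f x ∂(boxMeasure d L) := by
  rw [integral_pos_iff_support_of_nonneg (fun x => (hpos x).le) (integrable_boxMeasure hf)]
  have : Function.support f = univ := by
    ext x; simpa using (hpos x).ne'
  rw [this]
  have h := boxMeasure_real_univ d hL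
  rw [measureReal_def] at h
  have hp : 0 < L ^ d := by positivity
  by_contra h0
  rw [not_lt, nonpos_iff_eq_zero] at h0
  rw [h0] at h
  simp at h
  exact hp.ne h

/-! ### Partial derivatives and periodicity -/

theorem continuous_partialD {d : ℕ} {f : (Fin d → ℝ) → ℝ} (hf : ContDiff ℝ 1 f) (i : Fin d) :
    Continuous (partialD i f) :=
  (hf.continuous_fderiv one_ne_zero).clm_apply continuous_const

/-- The divergence theorem on the box for the field whose only nonzero component is the i-th, equal
to f; the two opposite faces cancel by periodicity. -/
theorem integral_partialD_eq_zero {d : ℕ} {L : ℝ} (hL : 0 < L) {f : (Fin d → ℝ) → ℝ}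
    (hf : ContDiff ℝ 1 f) (hper : IsPeriodic L f) (i : Fin d) :
    ∫ x, partialD i f x ∂(boxMeasure d L) = 0 := by
  obtain ⟨n, rfl⟩ : ∃ n, d = n + 1 := ⟨d - 1, by have := i.pos; omega⟩
  have h := integral_divergence_of_hasFDerivAt_off_countable'
    (fun _ : Fin (n + 1) => -(L / 2)) (fun _ => L / 2) (fun _ => by simp only; linarith)
    (fun j => if j = i then f else 0) (fun j => if j = i then fderiv ℝ f else 0) ∅ countable_empty
    (fun j => by
      split_ifs
      · exact hf.continuous.continuousOn
      · exact continuousOn_const)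
    (fun x _ j => by
      split_ifs
      · exact (hf.differentiable one_ne_zero x).hasFDerivAt
      · exact hasFDerivAt_const 0 x)
    (by
      have : (fun x => ∑ j, (if j = i then fderiv ℝ f else 0) x (Pi.single j 1))
          = partialD i f := by
        ext x
        rw [Finset.sum_eq_single i (fun j _ hj => by simp [hj]) (by simp)]
        simp [partialD]
      rw [this]
      exact (continuous_partialD hf i).continuousOn.integrableOn_compact isCompact_Icc)
  have h1 : (fun x => ∑ j, (if j = i then fderiv ℝ f else 0) x (Pi.single j 1))
      = partialD i f := by
    ext x
    rw [Finset.sum_eq_single i (fun j _ hj => by simp [hj]) (by simp)]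
    simp [partialD]
  rw [h1] at h
  rw [boxMeasure, box, h]
  refine Finset.sum_eq_zero fun j _ => ?_
  rw [sub_eq_zero]
  split_ifs with hj
  · subst hj
    refine integral_congr_ae (Eventually.of_forall fun x => ?_)
    show f (Fin.insertNth j (L / 2) x) = f (Fin.insertNth j (-(L / 2)) x)
    rw [← hper (Fin.insertNth j (-(L / 2)) x) j]
    congr 1
    ext k
    rcases Fin.eq_self_or_eq_succAbove j k with rfl | ⟨k, rfl⟩
    · simp
      ring
    · simp [Fin.succAbove_ne]
  · simp

/-! ### The logarithmic Sobolev inequality on the torus -/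

theorem hasDerivAt_comp_cons {d : ℕ} {v : (Fin (d + 1) → ℝ) → ℝ} (hv : ContDiff ℝ 1 v)
    (s : ℝ) (y : Fin d → ℝ) :
    HasDerivAt (fun s => v (Fin.cons s y)) (partialD 0 v (Fin.cons s y)) s := by
  have h1 : HasDerivAt (fun s : ℝ => (Fin.cons s y : Fin (d + 1) → ℝ)) (Pi.single 0 1) s := by
    rw [hasDerivAt_pi]
    intro i
    refine Fin.cases ?_ (fun j => ?_) i
    · simpa using hasDerivAt_id' s
    · simpa using hasDerivAt_const s (y j)
  exact ((hv.differentiable one_ne_zero _).hasFDerivAt).comp_hasDerivAt s h1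

theorem contDiff_cons_right {d : ℕ} (s : ℝ) :
    ContDiff ℝ 1 fun y : Fin d → ℝ => (Fin.cons s y : Fin (d + 1) → ℝ) := by
  rw [contDiff_pi]
  intro i
  refine Fin.cases ?_ (fun j => ?_) i
  · simpa using contDiff_const
  · simpa using contDiff_apply ℝ ℝ j

theorem contDiff_cons_left {d : ℕ} (y : Fin d → ℝ) :
    ContDiff ℝ 1 fun s : ℝ => (Fin.cons s y : Fin (d + 1) → ℝ) := by
  rw [contDiff_pi]
  intro i
  refine Fin.cases ?_ (fun j => ?_) i
  · simpa using contDiff_fun_id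
  · simpa using contDiff_const

theorem partialD_comp_cons {d : ℕ} {v : (Fin (d + 1) → ℝ) → ℝ} (hv : ContDiff ℝ 1 v)
    (s : ℝ) (y : Fin d → ℝ) (i : Fin d) :
    partialD i (fun y => v (Fin.cons s y)) y = partialD i.succ v (Fin.cons s y) := by
  have h1 : HasFDerivAt (fun y : Fin d → ℝ => (Fin.cons s y : Fin (d + 1) → ℝ))
      (fderiv ℝ (fun y : Fin d → ℝ => (Fin.cons s y : Fin (d + 1) → ℝ)) y) y :=
    ((contDiff_cons_right s).differentiable one_ne_zero y).hasFDerivAt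
  have h2 := ((hv.differentiable one_ne_zero (Fin.cons s y)).hasFDerivAt).comp y h1
  have h3 : fderiv ℝ (fun y : Fin d → ℝ => (Fin.cons s y : Fin (d + 1) → ℝ)) y (Pi.single i 1)
      = Pi.single i.succ 1 := by
    have h4 : HasFDerivAt (fun y : Fin d → ℝ => (Fin.cons s y : Fin (d + 1) → ℝ))
        (ContinuousLinearMap.pi (fun k => Fin.cases (motive := fun _ => (Fin d → ℝ) →L[ℝ] ℝ) 0
          (fun j => ContinuousLinearMap.proj j) k)) y := by
      rw [hasFDerivAt_pi]
      intro k
      refine Fin.cases ?_ (fun j => ?_) k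
      · simpa using hasFDerivAt_const s y
      · simpa using hasFDerivAt_apply j y
    rw [h4.fderiv]
    ext k
    refine Fin.cases ?_ (fun j => ?_) k
    · simp
    · simp [Pi.single_apply]
  show fderiv ℝ (fun y => v (Fin.cons s y)) y _ = _
  have h5 : fderiv ℝ (fun y => v (Fin.cons s y)) y = _ := h2.fderiv
  rw [h5, ContinuousLinearMap.comp_apply, h3]
  rfl

theorem isPeriodic_comp_cons {d : ℕ} {L : ℝ} {v : (Fin (d + 1) → ℝ) → ℝ} (hv : IsPeriodic L v)
    (s : ℝ) : IsPeriodic L fun y : Fin d → ℝ => v (Fin.cons s y) := by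
  intro y i
  show v _ = v _
  rw [← hv (Fin.cons s y) i.succ]
  congr 1
  ext k
  refine Fin.cases ?_ (fun j => ?_) k
  · simp
  · simp [Pi.single_apply]

theorem periodic_comp_cons {d : ℕ} {L : ℝ} {v : (Fin (d + 1) → ℝ) → ℝ} (hv : IsPeriodic L v)
    (y : Fin d → ℝ) : Function.Periodic (fun s : ℝ => v (Fin.cons s y)) L := by
  intro s
  show v _ = v _
  rw [← hv (Fin.cons s y) 0]
  congr 1
  ext k
  refine Fin.cases ?_ (fun j => ?_) k
  · simp
  · simp

/-- Pointwise form of the subadditivity of entropy. With m and n the partial means and M the total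
mean, v and nm/M have equal integrals, so after integration this says that the entropy of v relative
to the product nm/M is nonnegative. It is 1 - 1/x ≤ log x at x = vM/(nm). -/
theorem entropy_log_term_bound {v n m M : ℝ} (hv : 0 < v) (hn : 0 < n) (hm : 0 < m) (hM : 0 < M) :
    v * Real.log (v / M) ≤ v * Real.log (v / m) + v * Real.log (v / n) - v + n * m / M := by
  have h := Real.one_sub_inv_le_log_of_pos (show 0 < v * M / (n * m) by positivity)
  rw [Real.log_div (by positivity) (by positivity), Real.log_mul hv.ne' hM.ne',
    Real.log_mul hn.ne' hm.ne'] at h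
  have h2 := mul_le_mul_of_nonneg_left h hv.le
  rw [Real.log_div hv.ne' hM.ne', Real.log_div hv.ne' hm.ne', Real.log_div hv.ne' hn.ne']
  have h3 : v * (1 - (v * M / (n * m))⁻¹) = v - n * m / M := by field_simp
  rw [h3] at h2
  linarith

/-- Tensorization: induction on the dimension, splitting off the first coordinate. The total entropy
is at most the sum of the averaged entropies along the circle and along the remaining torus, and the
corresponding Fisher informations add up exactly, so the constant does not depend on d. In dimension
0, v equals its mean. -/
theorem log_sobolev_torus {L : ℝ} (hL : 0 < L) : ∀ (d : ℕ) {v : (Fin d → ℝ) → ℝ},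
    ContDiff ℝ 1 v → IsPeriodic L v → (∀ x, 0 < v x) →
    4 * Real.pi ^ 2 / L ^ 2 * ∫ x, v x * Real.log (v x / ((∫ y, v y ∂(boxMeasure d L)) / L ^ d))
        ∂(boxMeasure d L)
      ≤ ∫ x, ∑ i, partialD i v x ^ 2 / v x ∂(boxMeasure d L) := by
  intro d
  induction d with
  | zero =>
    intro v hv _ hpos
    have hc : ∀ x, v x = v 0 := fun x => by rw [Subsingleton.elim x 0]
    have : ∀ x, v x * Real.log (v x / ((∫ y, v y ∂(boxMeasure 0 L)) / L ^ 0)) = 0 := by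
      intro x
      have h1 : ∫ y, v y ∂(boxMeasure 0 L) = v 0 := by
        simp_rw [hc]
        rw [integral_const_boxMeasure 0 hL]
        simp
      rw [h1, hc x, pow_zero, div_one, div_self (hpos 0).ne', Real.log_one, mul_zero]
    simp_rw [this]
    simp
  | succ d ih =>
    intro v hv hper hpos
    set lam := 4 * Real.pi ^ 2 / L ^ 2
    have hlam : 0 ≤ lam := by positivity
    have hvc : Continuous v := hv.continuous
    have hcons : Continuous fun p : ℝ × (Fin d → ℝ) => v (Fin.cons p.1 p.2) :=
      hvc.comp (continuous_cons d)
    set P := (sideMeasure L).prod (boxMeasure d L) with hP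
    set M := (∫ y, v y ∂(boxMeasure (d + 1) L)) / L ^ (d + 1) with hM
    set m : ℝ → ℝ := fun s => (∫ y, v (Fin.cons s y) ∂(boxMeasure d L)) / L ^ d with hm
    set n : (Fin d → ℝ) → ℝ := fun y => L⁻¹ * ∫ s, v (Fin.cons s y) ∂(sideMeasure L) with hn
    have hM0 : 0 < M := div_pos (integral_boxMeasure_pos hL hvc hpos) (by positivity)
    have hm0 : ∀ s, 0 < m s := fun s => div_pos (integral_boxMeasure_pos hL
      (hcons.comp (by fun_prop : Continuous fun y : Fin d → ℝ => (s, y))) fun _ => hpos _)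
      (by positivity)
    have hn0 : ∀ y, 0 < n y := fun y => by
      refine mul_pos (by positivity) ?_
      rw [integral_sideMeasure hL]
      exact intervalIntegral.intervalIntegral_pos_of_pos_on
        ((hcons.comp (by fun_prop : Continuous fun s : ℝ => (s, y))).intervalIntegrable _ _)
        (fun x _ => hpos _) (by linarith)
    have hmc : Continuous m := (continuous_integral_box hcons).div_const _
    have hnc : Continuous n := continuous_const.mul (continuous_integral_side
      (hcons.comp continuous_swap))
    have int : ∀ {f : ℝ × (Fin d → ℝ) → ℝ}, Continuous f → Integrable f P :=
      fun hf => integrable_side_prod_box hf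
    have hc1 : Continuous fun p : ℝ × (Fin d → ℝ) =>
        v (Fin.cons p.1 p.2) * Real.log (v (Fin.cons p.1 p.2) / m p.1) :=
      hcons.mul ((hcons.div (hmc.comp continuous_fst) fun p => (hm0 _).ne').log
        fun p => (div_pos (hpos _) (hm0 _)).ne')
    have hc2 : Continuous fun p : ℝ × (Fin d → ℝ) =>
        v (Fin.cons p.1 p.2) * Real.log (v (Fin.cons p.1 p.2) / n p.2) :=
      hcons.mul ((hcons.div (hnc.comp continuous_snd) fun p => (hn0 _).ne').log
        fun p => (div_pos (hpos _) (hn0 _)).ne')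
    have hc0 : Continuous fun p : ℝ × (Fin d → ℝ) =>
        v (Fin.cons p.1 p.2) * Real.log (v (Fin.cons p.1 p.2) / M) :=
      hcons.mul ((hcons.div_const M).log fun p => (div_pos (hpos _) hM0).ne')
    have hc3 : Continuous fun p : ℝ × (Fin d → ℝ) => n p.2 * m p.1 / M :=
      ((hnc.comp continuous_snd).mul (hmc.comp continuous_fst)).div_const _
    have hpd : ∀ i, Continuous fun p : ℝ × (Fin d → ℝ) =>
        partialD i v (Fin.cons p.1 p.2) ^ 2 / v (Fin.cons p.1 p.2) := fun i =>
      (((continuous_partialD hv i).comp (continuous_cons d)).pow 2).div hcons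
        fun p => (hpos _).ne'
    have hvI : ∫ p, v (Fin.cons p.1 p.2) ∂P = M * L ^ (d + 1) := by
      rw [← integral_box_succ_prod, hM]
      field_simp
    have hnmI : ∫ p : ℝ × (Fin d → ℝ), n p.2 * m p.1 / M ∂P = M * L ^ (d + 1) := by
      rw [integral_div]
      have h1 : ∫ p : ℝ × (Fin d → ℝ), n p.2 * m p.1 ∂P
          = (∫ s, m s ∂(sideMeasure L)) * ∫ y, n y ∂(boxMeasure d L) := by
        rw [hP, ← integral_prod_mul]
        simp_rw [mul_comm]
      have h2 : ∫ s, m s ∂(sideMeasure L) = M * L := by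
        simp only [hm]
        rw [integral_div, ← integral_box_succ hvc, hM, pow_succ]
        field_simp
      have h3 : ∫ y, n y ∂(boxMeasure d L) = M * L ^ d := by
        simp only [hn]
        rw [integral_const_mul, ← integral_box_succ_symm hvc, hM, pow_succ]
        field_simp
      rw [h1, h2, h3, pow_succ]
      field_simp
    have hE1 : lam * ∫ p : ℝ × (Fin d → ℝ),
          v (Fin.cons p.1 p.2) * Real.log (v (Fin.cons p.1 p.2) / m p.1) ∂P
        ≤ ∫ p : ℝ × (Fin d → ℝ), ∑ i : Fin d,
          partialD i.succ v (Fin.cons p.1 p.2) ^ 2 / v (Fin.cons p.1 p.2) ∂P := by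
      have hcs := continuous_finsetSum Finset.univ fun (i : Fin d) _ => hpd i.succ
      rw [hP, integral_prod _ (int hc1), integral_prod _ (int hcs), ← integral_const_mul]
      refine integral_mono
        ((integrable_sideMeasure (continuous_integral_box hc1)).const_mul lam)
        (integrable_sideMeasure (continuous_integral_box hcs)) fun s => ?_
      have h := ih (v := fun y => v (Fin.cons s y)) (hv.comp (contDiff_cons_right s))
        (isPeriodic_comp_cons hper s) (fun _ => hpos _)
      simp only [partialD_comp_cons hv] at h
      exact h
    have hE2 : lam * ∫ p : ℝ × (Fin d → ℝ),
          v (Fin.cons p.1 p.2) * Real.log (v (Fin.cons p.1 p.2) / n p.2) ∂P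
        ≤ ∫ p : ℝ × (Fin d → ℝ),
          partialD 0 v (Fin.cons p.1 p.2) ^ 2 / v (Fin.cons p.1 p.2) ∂P := by
      rw [hP, integral_prod_symm _ (int hc2), integral_prod_symm _ (int (hpd 0)),
        ← integral_const_mul]
      refine integral_mono
        ((integrable_boxMeasure (continuous_integral_side
          (f := fun (y : Fin d → ℝ) s => v (Fin.cons s y) * Real.log (v (Fin.cons s y) / n y))
          (hc2.comp continuous_swap))).const_mul lam)
        (integrable_boxMeasure (continuous_integral_side
          (f := fun (y : Fin d → ℝ) s => partialD 0 v (Fin.cons s y) ^ 2 / v (Fin.cons s y))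
          ((hpd 0).comp continuous_swap)))
        fun y => ?_
      have h := log_sobolev_circle hL (-(L / 2)) (v := fun s => v (Fin.cons s y))
        (hv.comp (contDiff_cons_left y)) (periodic_comp_cons hper y) (fun _ => hpos _)
      simp only [(hasDerivAt_comp_cons hv _ y).deriv, ← integral_sideMeasure hL] at h
      exact h
    have hE : ∫ p : ℝ × (Fin d → ℝ),
          v (Fin.cons p.1 p.2) * Real.log (v (Fin.cons p.1 p.2) / M) ∂P
        ≤ (∫ p : ℝ × (Fin d → ℝ),
            v (Fin.cons p.1 p.2) * Real.log (v (Fin.cons p.1 p.2) / m p.1) ∂P)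
          + ∫ p : ℝ × (Fin d → ℝ),
            v (Fin.cons p.1 p.2) * Real.log (v (Fin.cons p.1 p.2) / n p.2) ∂P := by
      have h : ∫ p : ℝ × (Fin d → ℝ),
          v (Fin.cons p.1 p.2) * Real.log (v (Fin.cons p.1 p.2) / M) ∂P ≤ _ :=
        integral_mono (int hc0) (int (((hc1.add hc2).sub hcons).add hc3))
          fun p => entropy_log_term_bound (hpos (Fin.cons p.1 p.2)) (hn0 p.2) (hm0 p.1) hM0
      rw [integral_add' (int ((hc1.add hc2).sub hcons)) (int hc3),
        integral_sub' (int (hc1.add hc2)) (int hcons),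
        integral_add' (int hc1) (int hc2), hvI, hnmI] at h
      linarith
    rw [integral_box_succ_prod, integral_box_succ_prod]
    simp only [Fin.sum_univ_succ]
    rw [integral_add (int (hpd 0)) (int (continuous_finsetSum Finset.univ
      fun (i : Fin d) _ => hpd i.succ))]
    have := mul_le_mul_of_nonneg_left hE hlam
    linarith

/-! ### Convolution of essentially bounded functions with integrable functions -/

/-- `f` is measurable up to null sets and bounded almost everywhere by `C`. -/
structure EssBounded {d : ℕ} (C : ℝ) (f : (Fin d → ℝ) → ℝ) : Prop where
  aesm : AEStronglyMeasurable f volume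
  bound : ∀ᵐ x, ‖f x‖ ≤ C

theorem EssBounded.integrable_comp_sub_mul {d : ℕ} {C : ℝ} {f g : (Fin d → ℝ) → ℝ}
    {μ : Measure (Fin d → ℝ)} (hμ : μ ≪ volume)
    (hf : EssBounded C f) (hg : Integrable g μ) (x : Fin d → ℝ) :
    Integrable (fun z => f (x - z) * g z) μ := by
  have hq := quasiMeasurePreserving_sub_left (volume : Measure (Fin d → ℝ)) x
  exact hg.bdd_mul ((hf.aesm.comp_quasiMeasurePreserving hq).mono_ac hμ)
    (hμ.ae_le (hq.ae hf.bound))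

theorem EssBounded.abs_integral_comp_sub_mul_le {d : ℕ} {C : ℝ} {f g : (Fin d → ℝ) → ℝ}
    {μ : Measure (Fin d → ℝ)} (hμ : μ ≪ volume)
    (hf : EssBounded C f) (hg : Integrable g μ) (x : Fin d → ℝ) :
    |∫ z, f (x - z) * g z ∂μ| ≤ C * ∫ z, |g z| ∂μ := by
  have hq := quasiMeasurePreserving_sub_left (volume : Measure (Fin d → ℝ)) x
  rw [← integral_const_mul]
  refine (norm_integral_le_integral_norm _).trans
    (integral_mono_ae (hf.integrable_comp_sub_mul hμ hg x).norm (hg.abs.const_mul C) ?_)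
  filter_upwards [hμ.ae_le (hq.ae hf.bound)] with z hz
  rw [norm_mul, Real.norm_eq_abs (g z)]
  exact mul_le_mul_of_nonneg_right hz (abs_nonneg _)

theorem partialD_comp_const_sub {d : ℕ} {g : (Fin d → ℝ) → ℝ} (hg : ContDiff ℝ 1 g)
    (x t : Fin d → ℝ) (j : Fin d) :
    partialD j (fun t => g (x - t)) t = -partialD j g (x - t) := by
  have h := ((hg.differentiable one_ne_zero (x - t)).hasFDerivAt).comp t
    ((hasFDerivAt_id t).const_sub x)
  have h' : fderiv ℝ (fun t => g (x - t)) t = _ := h.fderiv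
  rw [partialD, h']
  simp [partialD]

/-- The derivative first falls on the smooth factor g; the definition of the weak derivative then
moves it to f. -/
theorem hasFDerivAt_convolution_of_smooth {d : ℕ} {f g : (Fin d → ℝ) → ℝ}
    {f' : Fin d → (Fin d → ℝ) → ℝ} (hf' : ∀ j, HasWeakPartial j f (f' j))
    (hfl : LocallyIntegrable f)
    (hg : ContDiff ℝ ∞ g) (hgc : HasCompactSupport g) (x : Fin d → ℝ) :
    HasFDerivAt (fun x => ∫ z, f (x - z) * g z)
      (∑ j, (∫ z, f' j (x - z) * g z) • ContinuousLinearMap.proj (R := ℝ)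
        (φ := fun _ : Fin d => ℝ) j) x := by
  have hg1 : ContDiff ℝ 1 g := hg.of_le (by exact_mod_cast le_top)
  have h := hgc.hasFDerivAt_convolution_right (ContinuousLinearMap.mul ℝ ℝ) hfl hg1 x
  have hfun : convolution f g (ContinuousLinearMap.mul ℝ ℝ) volume
      = fun x => ∫ z, f (x - z) * g z := funext fun x => convolution_mul_swap
  rw [hfun] at h
  suffices key : (∑ j, (∫ z, f' j (x - z) * g z) • ContinuousLinearMap.proj (R := ℝ)
      (φ := fun _ : Fin d => ℝ) j) = (convolution f (fderiv ℝ g)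
        (ContinuousLinearMap.precompR (Fin d → ℝ) (ContinuousLinearMap.mul ℝ ℝ)) volume x) by
    rw [key]
    exact h
  refine ContinuousLinearMap.ext fun v : Fin d → ℝ => ?_
  have hv : v = ∑ j, v j • Pi.single j (1 : ℝ) := by
    ext k; simp [Finset.sum_apply, Pi.single_apply]
  set A : (Fin d → ℝ) →L[ℝ] ℝ := (convolution f (fderiv ℝ g) (ContinuousLinearMap.precompR (Fin d → ℝ)
    (ContinuousLinearMap.mul ℝ ℝ)) volume x)
  have hA : A v = ∑ j, v j * A (Pi.single j 1) := by
    conv_lhs => rw [hv]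
    simp
  rw [hA]
  simp only [sum_apply, smul_apply, ContinuousLinearMap.proj_apply, smul_eq_mul]
  refine Finset.sum_congr rfl fun j _ => ?_
  rw [mul_comm]
  congr 1
  rw [convolution_precompR_apply _ hfl (hgc.fderiv ℝ) (hg1.continuous_fderiv one_ne_zero),
    convolution_mul]
  -- The test function is t ↦ g(x - t); its partial derivative carries a minus sign that cancels the
  -- one in the definition.
  have hw := (hf' j).2.2 (fun t => g (x - t)) (hg.comp (contDiff_const.sub contDiff_id))
    (hgc.comp_homeomorph (Homeomorph.subLeft x))
  simp only [partialD_comp_const_sub hg1 x, mul_neg, integral_neg, neg_inj] at hw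
  have h2 : ∫ t, f t * (fderiv ℝ g (x - t)) (Pi.single j 1) = ∫ t, f' j t * g (x - t) := hw
  rw [h2, ← convolution_mul (𝕜 := ℝ), convolution_mul_swap]

theorem integrable_approx_smooth {d : ℕ} {g : (Fin d → ℝ) → ℝ} (hg : Integrable g) (n : ℕ) :
    ∃ h : (Fin d → ℝ) → ℝ, HasCompactSupport h ∧ ContDiff ℝ ∞ h ∧
      ∫ z, |h z - g z| ≤ 1 / ((n : ℝ) + 1) := by
  obtain ⟨h, hc, hd, hle⟩ := MemLp.exist_eLpNorm_sub_le (p := 1) ENNReal.one_ne_top le_rfl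
    (memLp_one_iff_integrable.2 hg) (show (0 : ℝ) < 1 / ((n : ℝ) + 1) by positivity)
  refine ⟨h, hc, hd, ?_⟩
  have hi : Integrable (g - h) := hg.sub (hd.continuous.integrable_of_hasCompactSupport hc)
  rw [eLpNorm_one_eq_lintegral_enorm, ← ofReal_integral_norm_eq_lintegral_enorm hi] at hle
  have := (ENNReal.ofReal_le_ofReal_iff (by positivity)).1 hle
  simpa [Real.norm_eq_abs, abs_sub_comm] using this

theorem EssBounded.locallyIntegrable {d : ℕ} {C : ℝ} {f : (Fin d → ℝ) → ℝ}
    (hf : EssBounded C f) : LocallyIntegrable f :=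
  (memLp_top_of_bound hf.aesm C hf.bound).locallyIntegrable (by simp)

/-- Convolution with an essentially bounded f maps L¹ convergence to uniform convergence. This is
what carries continuity and differentiability from smooth g to merely integrable g. -/
theorem tendstoUniformly_convolution {d : ℕ} {C : ℝ} {f g : (Fin d → ℝ) → ℝ}
    (hf : EssBounded C f) (hg : Integrable g) {h : ℕ → (Fin d → ℝ) → ℝ}
    (hh : ∀ n, Integrable (h n)) (hle : ∀ n : ℕ, ∫ z, |h n z - g z| ≤ 1 / ((n : ℝ) + 1)) :
    TendstoUniformly (fun n x => ∫ z, f (x - z) * h n z) (fun x => ∫ z, f (x - z) * g z) atTop := by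
  have hlim : Tendsto (fun n : ℕ => |C| * (1 / ((n : ℝ) + 1))) atTop (𝓝 0) := by
    simpa using tendsto_one_div_add_atTop_nhds_zero_nat.const_mul |C|
  rw [Metric.tendstoUniformly_iff]
  intro ε hε
  filter_upwards [hlim.eventually (gt_mem_nhds hε)] with n hn x
  rw [dist_comm, Real.dist_eq]
  have hsub : (∫ z, f (x - z) * h n z) - ∫ z, f (x - z) * g z
      = ∫ z, f (x - z) * (h n z - g z) := by
    rw [← integral_sub (hf.integrable_comp_sub_mul .rfl (hh n) x)
      (hf.integrable_comp_sub_mul .rfl hg x)]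
    simp_rw [mul_sub]
  rw [hsub]
  refine lt_of_le_of_lt ?_ hn
  refine (hf.abs_integral_comp_sub_mul_le .rfl ((hh n).sub hg) x).trans ?_
  have h0 : 0 ≤ ∫ z, |(h n - g) z| := integral_nonneg fun _ => abs_nonneg _
  calc C * ∫ z, |(h n - g) z| ≤ |C| * ∫ z, |(h n - g) z| :=
        mul_le_mul_of_nonneg_right (le_abs_self C) h0
    _ ≤ _ := mul_le_mul_of_nonneg_left (hle n) (abs_nonneg C)

theorem continuous_convolution_essBounded {d : ℕ} {C : ℝ} {f g : (Fin d → ℝ) → ℝ}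
    (hf : EssBounded C f) (hg : Integrable g) : Continuous fun x => ∫ z, f (x - z) * g z := by
  choose h hc hd hle using integrable_approx_smooth hg
  have hh : ∀ n, Integrable (h n) := fun n =>
    (hd n).continuous.integrable_of_hasCompactSupport (hc n)
  refine (tendstoUniformly_convolution hf hg hh hle).continuous (Eventually.of_forall ?_).frequently
  intro n
  have := (hc n).continuous_convolution_right (ContinuousLinearMap.mul ℝ ℝ)
    hf.locallyIntegrable (hd n).continuous
  rwa [show convolution f (h n) (ContinuousLinearMap.mul ℝ ℝ) volume
      = fun x => ∫ z, f (x - z) * h n z from funext fun x => convolution_mul_swap] at this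

theorem hasFDerivAt_convolution_essBounded {d : ℕ} {C : ℝ} {C' : Fin d → ℝ}
    {f g : (Fin d → ℝ) → ℝ} {f' : Fin d → (Fin d → ℝ) → ℝ}
    (hf : EssBounded C f) (hfb : ∀ j, EssBounded (C' j) (f' j))
    (hf' : ∀ j, HasWeakPartial j f (f' j)) (hg : Integrable g) (x : Fin d → ℝ) :
    HasFDerivAt (fun x => ∫ z, f (x - z) * g z)
      (∑ j, (∫ z, f' j (x - z) * g z) • ContinuousLinearMap.proj (R := ℝ)
        (φ := fun _ : Fin d => ℝ) j) x := by
  choose h hc hd hle using integrable_approx_smooth hg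
  have hh : ∀ n, Integrable (h n) := fun n =>
    (hd n).continuous.integrable_of_hasCompactSupport (hc n)
  refine hasFDerivAt_of_tendstoUniformly (l := atTop)
    (f' := fun n x => ∑ j, (∫ z, f' j (x - z) * h n z) • ContinuousLinearMap.proj (R := ℝ)
        (φ := fun _ : Fin d => ℝ) j)
    (g' := fun x => ∑ j, (∫ z, f' j (x - z) * g z) • ContinuousLinearMap.proj (R := ℝ)
        (φ := fun _ : Fin d => ℝ) j) ?_
    (fun n x => hasFDerivAt_convolution_of_smooth hf' hf.locallyIntegrable (hd n) (hc n) x)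
    (fun x => (tendstoUniformly_convolution hf hg hh hle).tendsto_at x) x
  -- The linear map sending a gradient vector to the functional it represents; being uniformly
  -- continuous, it transfers uniform convergence from the components to the derivatives.
  let Φ : (Fin d → ℝ) →L[ℝ] ((Fin d → ℝ) →L[ℝ] ℝ) :=
    ∑ j, (ContinuousLinearMap.proj (R := ℝ) (φ := fun _ : Fin d => ℝ) j).smulRight
      (ContinuousLinearMap.proj (R := ℝ) (φ := fun _ : Fin d => ℝ) j)
  have hΦ : ∀ y, Φ y = ∑ j, y j • ContinuousLinearMap.proj (R := ℝ)
      (φ := fun _ : Fin d => ℝ) j := fun y => by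
    simp [Φ]
  have hu : TendstoUniformly (fun n x => fun j => ∫ z, f' j (x - z) * h n z)
      (fun x => fun j => ∫ z, f' j (x - z) * g z) atTop := by
    rw [Metric.tendstoUniformly_iff]
    intro ε hε
    have := fun j => (Metric.tendstoUniformly_iff.1
      (tendstoUniformly_convolution (hfb j) hg hh hle)) ε hε
    filter_upwards [eventually_all.2 this] with n hn x
    exact (dist_pi_lt_iff hε).2 fun j => hn j x
  have := Φ.uniformContinuous.comp_tendstoUniformly hu
  simpa only [Function.comp_def, hΦ] using this

theorem contDiff_convolution_essBounded {d : ℕ} {C : ℝ} {C' : Fin d → ℝ}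
    {f g : (Fin d → ℝ) → ℝ} {f' : Fin d → (Fin d → ℝ) → ℝ}
    (hf : EssBounded C f) (hfb : ∀ j, EssBounded (C' j) (f' j))
    (hf' : ∀ j, HasWeakPartial j f (f' j)) (hg : Integrable g) :
    ContDiff ℝ 1 fun x => ∫ z, f (x - z) * g z := by
  rw [contDiff_one_iff_hasFDerivAt]
  refine ⟨_, ?_, hasFDerivAt_convolution_essBounded hf hfb hf' hg⟩
  exact continuous_finsetSum _ fun j _ =>
    (continuous_convolution_essBounded (hfb j) hg).smul continuous_const

theorem partialD_convolution_essBounded {d : ℕ} {C : ℝ} {C' : Fin d → ℝ}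
    {f g : (Fin d → ℝ) → ℝ} {f' : Fin d → (Fin d → ℝ) → ℝ}
    (hf : EssBounded C f) (hfb : ∀ j, EssBounded (C' j) (f' j))
    (hf' : ∀ j, HasWeakPartial j f (f' j)) (hg : Integrable g) (i : Fin d) (x : Fin d → ℝ) :
    partialD i (fun x => ∫ z, f (x - z) * g z) x = ∫ z, f' i (x - z) * g z := by
  rw [partialD, (hasFDerivAt_convolution_essBounded hf hfb hf' hg x).fderiv]
  simp [Pi.single_apply]

/-! ### Periodic functions modulo null sets -/

section Lattice

open scoped Pointwise

/-- The basis `(L e_i)` of the period lattice. -/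
noncomputable def latticeBasis (d : ℕ) {L : ℝ} (hL : 0 < L) : Module.Basis (Fin d) ℝ (Fin d → ℝ) :=
  (Pi.basisFun ℝ (Fin d)).isUnitSMul (w := fun _ => L) fun _ => hL.ne'.isUnit

theorem latticeBasis_apply {d : ℕ} {L : ℝ} (hL : 0 < L) (i : Fin d) :
    latticeBasis d hL i = Pi.single i L := by
  rw [latticeBasis, Module.Basis.isUnitSMul_apply]
  ext k
  simp [Pi.single_apply]

theorem isPeriodic_add_lattice {d : ℕ} {L : ℝ} (hL : 0 < L) {f : (Fin d → ℝ) → ℝ}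
    (hf : IsPeriodic L f) {z : Fin d → ℝ}
    (hz : z ∈ Submodule.span ℤ (range (latticeBasis d hL))) : ∀ x, f (z + x) = f x := by
  induction hz using Submodule.span_induction with
  | mem y hy =>
    obtain ⟨i, rfl⟩ := hy
    intro x
    rw [latticeBasis_apply, add_comm, hf]
  | zero => simp
  | add y w _ _ hy hw =>
    intro x
    rw [add_assoc, hy, hw]
  | smul n y _ hy =>
    have h1 : ∀ (k : ℕ) x, f (k • y + x) = f x := by
      intro k
      induction k with
      | zero => simp
      | succ k ih =>
        intro x
        rw [add_smul, one_smul, add_assoc, ih, hy]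
    intro x
    obtain ⟨k, rfl | rfl⟩ := n.eq_nat_or_neg
    · simpa using h1 k x
    · rw [← h1 k (-(k : ℤ) • y + x)]
      congr 1
      simp

theorem vadd_fundamentalDomain_ae_eq {d : ℕ} {L : ℝ} (hL : 0 < L) (a : Fin d → ℝ) :
    (a +ᵥ ZSpan.fundamentalDomain (latticeBasis d hL) : Set (Fin d → ℝ))
      =ᵐ[volume] Icc a (fun i => a i + L) := by
  have h : (a +ᵥ ZSpan.fundamentalDomain (latticeBasis d hL) : Set (Fin d → ℝ))
      = pi univ fun i => Ico (a i) (a i + L) := by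
    ext x
    rw [mem_vadd_set_iff_neg_vadd_mem]
    simp only [ZSpan.mem_fundamentalDomain, Set.mem_pi, mem_univ, true_implies]
    refine forall_congr' fun i => ?_
    have : (latticeBasis d hL).repr (-a +ᵥ x) i = (x i - a i) / L := by
      simp [latticeBasis, Module.Basis.isUnitSMul, Module.Basis.repr_unitsSMul, Units.smul_def]
      field_simp
      ring
    rw [this, mem_Ico, mem_Ico, div_lt_one hL, le_div_iff₀ hL]
    constructor <;> rintro ⟨h1, h2⟩ <;> constructor <;> linarith
  rw [h]
  exact Measure.univ_pi_Ico_ae_eq_Icc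

theorem isAddFundamentalDomain_vadd {d : ℕ} {L : ℝ} (hL : 0 < L) (a : Fin d → ℝ) :
    IsAddFundamentalDomain (Submodule.span ℤ (range (latticeBasis d hL))).toAddSubgroup
      (a +ᵥ ZSpan.fundamentalDomain (latticeBasis d hL) : Set (Fin d → ℝ)) volume :=
  (ZSpan.isAddFundamentalDomain' (latticeBasis d hL) volume).vadd_of_comm a

theorem integral_Icc_eq_of_isPeriodic {d : ℕ} {L : ℝ} (hL : 0 < L) {f : (Fin d → ℝ) → ℝ}
    (hf : IsPeriodic L f) (a b : Fin d → ℝ) :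
    ∫ x in Icc a (fun i => a i + L), f x = ∫ x in Icc b (fun i => b i + L), f x := by
  have : Countable (Submodule.span ℤ (range (latticeBasis d hL))).toAddSubgroup :=
    inferInstanceAs (Countable (Submodule.span ℤ (range (latticeBasis d hL))))
  rw [← setIntegral_congr_set (vadd_fundamentalDomain_ae_eq hL a),
    ← setIntegral_congr_set (vadd_fundamentalDomain_ae_eq hL b)]
  exact (isAddFundamentalDomain_vadd hL a).setIntegral_eq (isAddFundamentalDomain_vadd hL b)
    fun g x => isPeriodic_add_lattice hL hf g.2 x

theorem box_eq_Icc_add (d : ℕ) (L : ℝ) :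
    box d L = Icc (fun _ => -(L / 2)) (fun _ => -(L / 2) + L) := by
  rw [box]
  congr 1
  ext
  ring

theorem integral_box_sub_of_isPeriodic {d : ℕ} {L : ℝ} (hL : 0 < L) {f : (Fin d → ℝ) → ℝ}
    (hf : IsPeriodic L f) (x : Fin d → ℝ) :
    ∫ y, f (x - y) ∂(boxMeasure d L) = ∫ y, f y ∂(boxMeasure d L) := by
  have hpre : (fun y => x - y) ⁻¹' (Icc (fun i => x i - L / 2) fun i => (x i - L / 2) + L)
      = box d L := by
    ext y
    simp only [mem_preimage, mem_Icc, Pi.le_def, Pi.sub_apply, box, ← forall_and]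
    refine forall_congr' fun i => ?_
    constructor <;> rintro ⟨h1, h2⟩ <;> constructor <;> linarith
  have hmp : MeasurePreserving (fun y : Fin d → ℝ => x - y) volume volume :=
    volume.measurePreserving_sub_left x
  have h := hmp.setIntegral_preimage_emb (Homeomorph.subLeft x).measurableEmbedding f
    (Icc (fun i => x i - L / 2) fun i => (x i - L / 2) + L)
  rw [hpre] at h
  rw [boxMeasure, h, box_eq_Icc_add]
  exact integral_Icc_eq_of_isPeriodic hL hf _ _

/-- The exceptional set is invariant under the period lattice and null on a fundamental domain,
which agrees with the box up to a null set. -/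
theorem ae_of_ae_box {d : ℕ} {L : ℝ} (hL : 0 < L) {f : (Fin d → ℝ) → ℝ} (hf : IsPeriodic L f)
    {p : ℝ → Prop} (h : ∀ᵐ x ∂(boxMeasure d L), p (f x)) : ∀ᵐ x, p (f x) := by
  have : Countable (Submodule.span ℤ (range (latticeBasis d hL))).toAddSubgroup :=
    inferInstanceAs (Countable (Submodule.span ℤ (range (latticeBasis d hL))))
  rw [ae_iff]
  refine (isAddFundamentalDomain_vadd hL (fun _ : Fin d => -(L / 2))).measure_zero_of_invariant
    {x | ¬ p (f x)} (fun g => ?_) ?_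
  · ext x
    rw [mem_vadd_set_iff_neg_vadd_mem]
    show ¬ p (f (-(g : Fin d → ℝ) + x)) ↔ ¬ p (f x)
    rw [isPeriodic_add_lattice hL hf (neg_mem g.2)]
  · have h1 := vadd_fundamentalDomain_ae_eq hL (fun _ : Fin d => -(L / 2))
    rw [← box_eq_Icc_add] at h1
    rw [measure_congr ((ae_eq_refl _).inter h1)]
    rw [ae_iff, boxMeasure, Measure.restrict_apply₀' (measurableSet_box d L).nullMeasurableSet] at h
    exact h

end Lattice

/-! ### Weak derivatives and the convolution `∇D ⋆ g` -/

theorem HasWeakPartial.ae_eq {d : ℕ} {i : Fin d} {f g g' : (Fin d → ℝ) → ℝ}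
    (h : HasWeakPartial i f g) (h' : HasWeakPartial i f g') : g =ᵐ[volume] g' := by
  refine ae_eq_of_integral_contDiff_smul_eq h.2.1 h'.2.1 fun φ hφ hc => ?_
  have h1 := h.2.2 φ hφ hc
  rw [h'.2.2 φ hφ hc] at h1
  simp only [smul_eq_mul, mul_comm (φ _)]
  linarith

theorem HasWeakPartial.congr_left {d : ℕ} {i : Fin d} {f f' g : (Fin d → ℝ) → ℝ}
    (h : HasWeakPartial i f g) (hff : f =ᵐ[volume] f') : HasWeakPartial i f' g := by
  refine ⟨h.1.congr hff, h.2.1, fun φ hφ hc => ?_⟩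
  rw [← h.2.2 φ hφ hc]
  refine integral_congr_ae ?_
  filter_upwards [hff] with x hx
  rw [hx]

theorem hasWeakPartial_weakPartial {d : ℕ} {i : Fin d} {f : (Fin d → ℝ) → ℝ}
    (h : ∃ g, HasWeakPartial i f g) : HasWeakPartial i f (weakPartial i f) := by
  rw [weakPartial, dif_pos h]
  exact h.choose_spec

/-- `f` agrees almost everywhere with an essentially bounded periodic function. -/
def IsPeriodicBounded {d : ℕ} (L : ℝ) (f : (Fin d → ℝ) → ℝ) : Prop :=
  ∃ f', f =ᵐ[volume] f' ∧ IsPeriodic L f' ∧ ∃ C, EssBounded C f'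

theorem essBounded_of_memLp_top {d : ℕ} {L : ℝ} (hL : 0 < L) {f : (Fin d → ℝ) → ℝ}
    (hf : AEStronglyMeasurable f volume) (hper : IsPeriodic L f)
    (hm : MemLp f ∞ (boxMeasure d L)) :
    EssBounded (eLpNorm f ∞ (boxMeasure d L)).toReal f := by
  refine ⟨hf, ae_of_ae_box hL hper
    (p := fun y => ‖y‖ ≤ (eLpNorm f ∞ (boxMeasure d L)).toReal) ?_⟩
  filter_upwards [ae_le_eLpNormEssSup (f := f) (μ := boxMeasure d L)] with x hx
  rw [← eLpNorm_exponent_top] at hx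
  have := ENNReal.toReal_mono hm.2.ne hx
  simpa using this

theorem IsPeriodicBounded.essBounded {d : ℕ} {L : ℝ} {f : (Fin d → ℝ) → ℝ}
    (h : IsPeriodicBounded L f) : ∃ C, EssBounded C f := by
  obtain ⟨f', hff, _, C, hC⟩ := h
  refine ⟨C, hC.aesm.congr hff.symm, ?_⟩
  filter_upwards [hff, hC.bound] with x hx hb
  rwa [hx]

/-- `weakPartial` is an arbitrary choice, hence periodic and bounded only up to a null set; the
derivatives supplied by `MemSobolev` are periodic and agree with it almost everywhere. -/
theorem weakPartial_of_memSobolev {d : ℕ} {L : ℝ} (hL : 0 < L) {D : (Fin d → ℝ) → ℝ}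
    (hD : MemSobolev L ∞ 2 D) (i : Fin d) :
    IsPeriodicBounded L (weakPartial i D) ∧
    ∀ j, HasWeakPartial j (weakPartial i D) (weakPartial j (weakPartial i D)) ∧
      IsPeriodicBounded L (weakPartial j (weakPartial i D)) := by
  obtain ⟨g, hg, hper, hmem, hg2⟩ := hD.2.2 i
  have hw := hasWeakPartial_weakPartial ⟨g, hg⟩
  have hwg : weakPartial i D =ᵐ[volume] g := hw.ae_eq hg
  refine ⟨⟨g, hwg, hper, _, essBounded_of_memLp_top hL hg.2.1.aestronglyMeasurable hper hmem⟩,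
    fun j => ?_⟩
  obtain ⟨g', hg', hper', hmem'⟩ := hg2 j
  have hw' : HasWeakPartial j (weakPartial i D) g' := hg'.congr_left hwg.symm
  have hspec := hasWeakPartial_weakPartial ⟨g', hw'⟩
  exact ⟨hspec, g', hspec.ae_eq hw', hper', _,
    essBounded_of_memLp_top hL hg'.2.1.aestronglyMeasurable hper' hmem'⟩

theorem IsPeriodicBounded.finset_sum {d : ℕ} {L : ℝ} {ι : Type*} (s : Finset ι)
    {f : ι → (Fin d → ℝ) → ℝ} (h : ∀ i, IsPeriodicBounded L (f i)) :
    IsPeriodicBounded L (fun x => ∑ i ∈ s, f i x) := by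
  choose f' hff hper C hC using h
  refine ⟨fun x => ∑ i ∈ s, f' i x, ?_, fun x j => ?_, ∑ i ∈ s, C i, ?_, ?_⟩
  · have : ∀ᵐ x, ∀ i ∈ s, f i x = f' i x := (Finset.eventually_all s).2 fun i _ => hff i
    filter_upwards [this] with x hx
    exact Finset.sum_congr rfl hx
  · exact Finset.sum_congr rfl fun i _ => hper i x j
  · exact Finset.aestronglyMeasurable_fun_sum s fun i _ => (hC i).aesm
  · have : ∀ᵐ x, ∀ i ∈ s, ‖f' i x‖ ≤ C i := (Finset.eventually_all s).2 fun i _ => (hC i).bound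
    filter_upwards [this] with x hx
    exact (norm_sum_le _ _).trans (Finset.sum_le_sum hx)

theorem isPeriodicBounded_weakLaplacian {d : ℕ} {L : ℝ} (hL : 0 < L) {D : (Fin d → ℝ) → ℝ}
    (hD : MemSobolev L ∞ 2 D) : IsPeriodicBounded L (weakLaplacian D) :=
  IsPeriodicBounded.finset_sum Finset.univ fun i => ((weakPartial_of_memSobolev hL hD i).2 i).2

theorem boxMeasure_absolutelyContinuous (d : ℕ) (L : ℝ) : boxMeasure d L ≪ volume :=
  Measure.absolutelyContinuous_of_le Measure.restrict_le_self

theorem essBounded_weakLaplacian {d : ℕ} {L : ℝ} (hL : 0 < L) {D : (Fin d → ℝ) → ℝ}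
    (hD : MemSobolev L ∞ 2 D) : EssBounded (laplacianNorm L D) (weakLaplacian D) := by
  obtain ⟨K, hK, hper, C, hC⟩ := isPeriodicBounded_weakLaplacian hL hD
  have hbox : weakLaplacian D =ᵐ[boxMeasure d L] K :=
    (boxMeasure_absolutelyContinuous d L).ae_eq hK
  have hmem : MemLp K ∞ (boxMeasure d L) :=
    memLp_top_of_bound (hC.aesm.mono_ac (boxMeasure_absolutelyContinuous d L)) C
      ((boxMeasure_absolutelyContinuous d L).ae_le hC.bound)
  have h := essBounded_of_memLp_top hL hC.aesm hper hmem
  rw [← eLpNorm_congr_ae hbox] at h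
  refine ⟨h.aesm.congr hK.symm, ?_⟩
  filter_upwards [hK, h.bound] with x hx hb
  rw [hx]
  exact hb

theorem laplacianNorm_nonneg {d : ℕ} (L : ℝ) (D : (Fin d → ℝ) → ℝ) : 0 ≤ laplacianNorm L D :=
  ENNReal.toReal_nonneg

theorem integral_boxMeasure_mul_eq_indicator {d : ℕ} {L : ℝ} (f g : (Fin d → ℝ) → ℝ)
    (x : Fin d → ℝ) :
    ∫ y, f (x - y) * g y ∂(boxMeasure d L) = ∫ y, f (x - y) * (box d L).indicator g y := by
  rw [boxMeasure, ← integral_indicator (measurableSet_box d L)]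
  refine integral_congr_ae (Eventually.of_forall fun y => ?_)
  by_cases hy : y ∈ box d L <;> simp [hy]

theorem integrable_indicator_box {d : ℕ} {L : ℝ} {g : (Fin d → ℝ) → ℝ}
    (hg : Integrable g (boxMeasure d L)) : Integrable ((box d L).indicator g) :=
  (integrable_indicator_iff (measurableSet_box d L)).2 hg

theorem gradConv_eq_indicator {d : ℕ} (L : ℝ) (D g : (Fin d → ℝ) → ℝ) (i : Fin d) :
    gradConv L D g i = fun x => ∫ y, weakPartial i D (x - y) * (box d L).indicator g y :=
  funext fun x => integral_boxMeasure_mul_eq_indicator _ _ x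

section GradConv

variable {d : ℕ} {L : ℝ} {D g : (Fin d → ℝ) → ℝ}

theorem contDiff_gradConv (hL : 0 < L) (hD : MemSobolev L ∞ 2 D)
    (hg : Integrable g (boxMeasure d L)) (i : Fin d) : ContDiff ℝ 1 (gradConv L D g i) := by
  obtain ⟨hw, hw'⟩ := weakPartial_of_memSobolev hL hD i
  obtain ⟨C, hC⟩ := hw.essBounded
  choose C' hC' using fun j => (hw' j).2.essBounded
  rw [gradConv_eq_indicator]
  exact contDiff_convolution_essBounded hC hC' (fun j => (hw' j).1) (integrable_indicator_box hg)

theorem partialD_gradConv (hL : 0 < L) (hD : MemSobolev L ∞ 2 D)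
    (hg : Integrable g (boxMeasure d L)) (i j : Fin d) (x : Fin d → ℝ) :
    partialD j (gradConv L D g i) x
      = ∫ y, weakPartial j (weakPartial i D) (x - y) * g y ∂(boxMeasure d L) := by
  obtain ⟨hw, hw'⟩ := weakPartial_of_memSobolev hL hD i
  obtain ⟨C, hC⟩ := hw.essBounded
  choose C' hC' using fun j => (hw' j).2.essBounded
  rw [gradConv_eq_indicator, partialD_convolution_essBounded hC hC' (fun j => (hw' j).1)
    (integrable_indicator_box hg), integral_boxMeasure_mul_eq_indicator]

theorem sum_partialD_gradConv (hL : 0 < L) (hD : MemSobolev L ∞ 2 D)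
    (hg : Integrable g (boxMeasure d L)) (x : Fin d → ℝ) :
    ∑ i, partialD i (gradConv L D g i) x
      = ∫ y, weakLaplacian D (x - y) * g y ∂(boxMeasure d L) := by
  simp_rw [partialD_gradConv hL hD hg, weakLaplacian, Finset.sum_mul]
  rw [integral_finsetSum]
  intro i _
  obtain ⟨C, hC⟩ := ((weakPartial_of_memSobolev hL hD i).2 i).2.essBounded
  exact hC.integrable_comp_sub_mul (boxMeasure_absolutelyContinuous d L) hg x

theorem ae_eq_comp_sub {f f' : (Fin d → ℝ) → ℝ} (h : f =ᵐ[volume] f') (x : Fin d → ℝ) :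
    (fun y => f (x - y)) =ᵐ[boxMeasure d L] fun y => f' (x - y) :=
  (boxMeasure_absolutelyContinuous d L).ae_eq
    ((quasiMeasurePreserving_sub_left (volume : Measure (Fin d → ℝ)) x).ae_eq_comp h)

theorem isPeriodic_gradConv (hL : 0 < L) (hD : MemSobolev L ∞ 2 D) (i : Fin d) :
    IsPeriodic L (gradConv L D g i) := by
  obtain ⟨⟨w, hw, hper, _⟩, _⟩ := weakPartial_of_memSobolev hL hD i
  intro x j
  refine integral_congr_ae ?_
  filter_upwards [ae_eq_comp_sub hw x, ae_eq_comp_sub hw (x + Pi.single j L)] with y h1 h2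
  rw [h1, h2, add_sub_right_comm, hper]

theorem IsPeriodicBounded.integral_comp_sub {f : (Fin d → ℝ) → ℝ} (hL : 0 < L)
    (hf : IsPeriodicBounded L f) (x : Fin d → ℝ) :
    ∫ y, f (x - y) ∂(boxMeasure d L) = ∫ y, f y ∂(boxMeasure d L) := by
  obtain ⟨f', hff, hper, _⟩ := hf
  rw [integral_congr_ae (ae_eq_comp_sub hff x), integral_box_sub_of_isPeriodic hL hper,
    integral_congr_ae ((boxMeasure_absolutelyContinuous d L).ae_eq hff)]

/-- The integral is the divergence of ∇D ⋆ 1, and convolving a periodic function with 1 over a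
period gives a constant. -/
theorem integral_weakLaplacian_comp_sub (hL : 0 < L) (hD : MemSobolev L ∞ 2 D)
    (x : Fin d → ℝ) : ∫ y, weakLaplacian D (x - y) ∂(boxMeasure d L) = 0 := by
  have h1 : Integrable (fun _ : Fin d → ℝ => (1 : ℝ)) (boxMeasure d L) := integrable_const 1
  have h := sum_partialD_gradConv hL hD h1 x
  simp only [mul_one] at h
  rw [← h]
  refine Finset.sum_eq_zero fun i _ => ?_
  have hc : gradConv L D (fun _ => 1) i
      = fun _ => ∫ y, weakPartial i D y ∂(boxMeasure d L) := by
    ext x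
    simp only [gradConv, mul_one]
    exact (weakPartial_of_memSobolev hL hD i).1.integral_comp_sub hL x
  rw [hc]
  simp [partialD]

/-- The divergence is ΔD ⋆ g, and ΔD has mean zero, so g may be shifted by any constant before
taking absolute values. -/
theorem abs_sum_partialD_gradConv_le (hL : 0 < L) (hD : MemSobolev L ∞ 2 D)
    (hg : Integrable g (boxMeasure d L)) (c : ℝ) (x : Fin d → ℝ) :
    |∑ i, partialD i (gradConv L D g i) x|
      ≤ laplacianNorm L D * ∫ y, |g y - c| ∂(boxMeasure d L) := by
  have hK := essBounded_weakLaplacian hL hD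
  have hac := boxMeasure_absolutelyContinuous d L
  have hc : Integrable (fun _ : Fin d → ℝ => c) (boxMeasure d L) := integrable_const c
  have h : ∑ i, partialD i (gradConv L D g i) x
      = ∫ y, weakLaplacian D (x - y) * (g y - c) ∂(boxMeasure d L) := by
    simp_rw [mul_sub]
    rw [sum_partialD_gradConv hL hD hg, integral_sub (hK.integrable_comp_sub_mul hac hg x)
      (hK.integrable_comp_sub_mul hac hc x), integral_mul_const,
      integral_weakLaplacian_comp_sub hL hD, zero_mul, sub_zero]
  rw [h]
  exact hK.abs_integral_comp_sub_mul_le hac (hg.sub hc) x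

theorem continuous_sum_partialD_gradConv (hL : 0 < L) (hD : MemSobolev L ∞ 2 D)
    (hg : Integrable g (boxMeasure d L)) :
    Continuous fun x => ∑ i, partialD i (gradConv L D g i) x :=
  continuous_finsetSum _ fun i _ => continuous_partialD (contDiff_gradConv hL hD hg i) i

/-- Both factors may be recentred: g because ΔD has mean zero, ψ because the divergence of a
periodic field integrates to zero. This double recentring makes the drift quadratic in the distance
to equilibrium. -/
theorem integral_mul_sum_partialD_gradConv_le (hL : 0 < L) (hD : MemSobolev L ∞ 2 D)
    (hg : Integrable g (boxMeasure d L)) {ψ : (Fin d → ℝ) → ℝ} (hψ : Continuous ψ) (c c' : ℝ) :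
    |∫ x, ψ x * ∑ i, partialD i (gradConv L D g i) x ∂(boxMeasure d L)|
      ≤ laplacianNorm L D * ((∫ x, |ψ x - c'| ∂(boxMeasure d L))
        * ∫ y, |g y - c| ∂(boxMeasure d L)) := by
  have hdiv := continuous_sum_partialD_gradConv hL hD hg
  have hz : ∫ x, ∑ i, partialD i (gradConv L D g i) x ∂(boxMeasure d L) = 0 := by
    rw [integral_finsetSum _ fun i _ => integrable_boxMeasure
      (continuous_partialD (contDiff_gradConv hL hD hg i) i)]
    exact Finset.sum_eq_zero fun i _ => integral_partialD_eq_zero hL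
      (contDiff_gradConv hL hD hg i) (isPeriodic_gradConv hL hD i) i
  have h : ∫ x, ψ x * ∑ i, partialD i (gradConv L D g i) x ∂(boxMeasure d L)
      = ∫ x, (ψ x - c') * ∑ i, partialD i (gradConv L D g i) x ∂(boxMeasure d L) := by
    have h1 : Integrable (fun x => ψ x * ∑ i, partialD i (gradConv L D g i) x)
        (boxMeasure d L) := integrable_boxMeasure (hψ.mul hdiv)
    have h2 : Integrable (fun x => c' * ∑ i, partialD i (gradConv L D g i) x)
        (boxMeasure d L) := integrable_boxMeasure (continuous_const.mul hdiv)
    simp_rw [sub_mul]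
    rw [integral_sub h1 h2, integral_const_mul, hz, mul_zero, sub_zero]
  rw [h]
  set W := ∫ y, |g y - c| ∂(boxMeasure d L)
  calc |∫ x, (ψ x - c') * ∑ i, partialD i (gradConv L D g i) x ∂(boxMeasure d L)|
      ≤ ∫ x, |(ψ x - c') * ∑ i, partialD i (gradConv L D g i) x| ∂(boxMeasure d L) :=
        abs_integral_le_integral_abs
    _ ≤ ∫ x, |ψ x - c'| * (laplacianNorm L D * W) ∂(boxMeasure d L) := by
        refine integral_mono (integrable_boxMeasure (by fun_prop))
          (integrable_boxMeasure (by fun_prop)) fun x => ?_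
        simp only [abs_mul]
        exact mul_le_mul_of_nonneg_left (abs_sum_partialD_gradConv_le hL hD hg c x) (abs_nonneg _)
    _ = _ := by rw [integral_mul_const]; ring

end GradConv

/-! ### Calculus with partial derivatives -/

section Partial

variable {d : ℕ} {L : ℝ}

theorem partialD_mul {f g : (Fin d → ℝ) → ℝ} {x : Fin d → ℝ} (hf : DifferentiableAt ℝ f x)
    (hg : DifferentiableAt ℝ g x) (i : Fin d) :
    partialD i (fun y => f y * g y) x = f x * partialD i g x + partialD i f x * g x := by
  rw [partialD, fderiv_fun_mul hf hg]
  simp [partialD]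
  ring

theorem partialD_sub {f g : (Fin d → ℝ) → ℝ} {x : Fin d → ℝ} (hf : DifferentiableAt ℝ f x)
    (hg : DifferentiableAt ℝ g x) (i : Fin d) :
    partialD i (fun y => f y - g y) x = partialD i f x - partialD i g x := by
  rw [partialD, fderiv_fun_sub hf hg]
  simp [partialD]

theorem partialD_comp {u : (Fin d → ℝ) → ℝ} {β : ℝ → ℝ} {b : ℝ} {x : Fin d → ℝ}
    (hβ : HasDerivAt β b (u x)) (hu : DifferentiableAt ℝ u x) (i : Fin d) :
    partialD i (fun y => β (u y)) x = b * partialD i u x := by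
  have h := hβ.comp_hasFDerivAt x hu.hasFDerivAt
  have h' : fderiv ℝ (fun y => β (u y)) x = _ := h.fderiv
  rw [partialD, h']
  simp [partialD]

theorem contDiff_partialD {u : (Fin d → ℝ) → ℝ} (hu : ContDiff ℝ 2 u) (i : Fin d) :
    ContDiff ℝ 1 (partialD i u) :=
  (hu.fderiv_right (m := 1) (by norm_num)).clm_apply contDiff_const

theorem isPeriodic_partialD {u : (Fin d → ℝ) → ℝ} (hper : IsPeriodic L u) (i : Fin d) :
    IsPeriodic L (partialD i u) := by
  intro x j
  have h : fderiv ℝ (fun y => u (y + Pi.single j L)) x = fderiv ℝ u (x + Pi.single j L) :=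
    fderiv_comp_add_right _
  rw [show (fun y => u (y + Pi.single j L)) = u from funext fun y => hper y j] at h
  rw [partialD, partialD, h]

/-- The difference of the two integrands is the divergence of the periodic field (β(u)u - B(u))V:
since B'(s) = sβ'(s), the gradient of u appears only through β(u) div(uV). -/
theorem integral_comp_mul_div_eq (hL : 0 < L) {u : (Fin d → ℝ) → ℝ} {V : Fin d → (Fin d → ℝ) → ℝ}
    {β β' B : ℝ → ℝ} (hu : ContDiff ℝ 1 u) (hper : IsPeriodic L u)
    (hV : ∀ i, ContDiff ℝ 1 (V i)) (hVper : ∀ i, IsPeriodic L (V i))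
    (hβ : ∀ x, HasDerivAt β (β' (u x)) (u x)) (hB : ∀ x, HasDerivAt B (u x * β' (u x)) (u x))
    (hβc : ContDiff ℝ 1 fun x => β (u x)) (hBc : ContDiff ℝ 1 fun x => B (u x)) :
    ∫ x, β (u x) * ∑ i, partialD i (fun y => u y * V i y) x ∂(boxMeasure d L)
      = ∫ x, B (u x) * ∑ i, partialD i (V i) x ∂(boxMeasure d L) := by
  have hF : ∀ i, ContDiff ℝ 1 fun x => (β (u x) * u x - B (u x)) * V i x := fun i =>
    ((hβc.mul hu).sub hBc).mul (hV i)
  have hd : ∀ {f : (Fin d → ℝ) → ℝ}, ContDiff ℝ 1 f → ∀ x, DifferentiableAt ℝ f x :=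
    fun hf x => hf.differentiable one_ne_zero x
  have key : ∀ i x, partialD i (fun x => (β (u x) * u x - B (u x)) * V i x) x
      = β (u x) * partialD i (fun y => u y * V i y) x - B (u x) * partialD i (V i) x := by
    intro i x
    rw [partialD_mul (hd ((hβc.mul hu).sub hBc) x) (hd (hV i) x),
      partialD_sub (hd (hβc.mul hu) x) (hd hBc x), partialD_mul (hd hβc x) (hd hu x),
      partialD_mul (hd hu x) (hd (hV i) x), partialD_comp (hβ x) (hd hu x),
      partialD_comp (hB x) (hd hu x)]
    ring
  have hz : ∫ x, ∑ i, partialD i (fun x => (β (u x) * u x - B (u x)) * V i x) x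
      ∂(boxMeasure d L) = 0 := by
    rw [integral_finsetSum _ fun i _ => integrable_boxMeasure (continuous_partialD (hF i) i)]
    refine Finset.sum_eq_zero fun i _ => integral_partialD_eq_zero hL (hF i) (fun x j => ?_) i
    simp only [hper x j, hVper i x j]
  simp only [key, Finset.sum_sub_distrib, ← Finset.mul_sum] at hz
  have h1 : Continuous fun x => β (u x) * ∑ i, partialD i (fun y => u y * V i y) x :=
    hβc.continuous.mul (continuous_finsetSum _ fun i _ => continuous_partialD (hu.mul (hV i)) i)
  have h2 : Continuous fun x => B (u x) * ∑ i, partialD i (V i) x :=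
    hBc.continuous.mul (continuous_finsetSum _ fun i _ => continuous_partialD (hV i) i)
  rw [integral_sub (integrable_boxMeasure h1) (integrable_boxMeasure h2)] at hz
  linarith

theorem integral_comp_mul_laplacian_eq (hL : 0 < L) {u : (Fin d → ℝ) → ℝ}
    {β β' : ℝ → ℝ} (hu : ContDiff ℝ 2 u) (hper : IsPeriodic L u)
    (hβ : ∀ x, HasDerivAt β (β' (u x)) (u x)) (hβc : ContDiff ℝ 1 fun x => β (u x))
    (hβ'c : Continuous fun x => β' (u x)) :
    ∫ x, β (u x) * ∑ i, partialD i (partialD i u) x ∂(boxMeasure d L)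
      = -∫ x, β' (u x) * ∑ i, partialD i u x ^ 2 ∂(boxMeasure d L) := by
  have hu1 : ContDiff ℝ 1 u := hu.of_le (by norm_num)
  have hF : ∀ i, ContDiff ℝ 1 fun x => β (u x) * partialD i u x := fun i =>
    hβc.mul (contDiff_partialD hu i)
  have hd : ∀ {f : (Fin d → ℝ) → ℝ}, ContDiff ℝ 1 f → ∀ x, DifferentiableAt ℝ f x :=
    fun hf x => hf.differentiable one_ne_zero x
  have key : ∀ i x, partialD i (fun x => β (u x) * partialD i u x) x
      = β (u x) * partialD i (partialD i u) x + β' (u x) * partialD i u x ^ 2 := by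
    intro i x
    rw [partialD_mul (hd hβc x) (hd (contDiff_partialD hu i) x),
      partialD_comp (hβ x) (hd hu1 x)]
    ring
  have hz : ∫ x, ∑ i, partialD i (fun x => β (u x) * partialD i u x) x
      ∂(boxMeasure d L) = 0 := by
    rw [integral_finsetSum _ fun i _ => integrable_boxMeasure (continuous_partialD (hF i) i)]
    refine Finset.sum_eq_zero fun i _ => integral_partialD_eq_zero hL (hF i) (fun x j => ?_) i
    simp only [hper x j, isPeriodic_partialD hper i x j]
  simp only [key, Finset.sum_add_distrib, ← Finset.mul_sum] at hz
  have h1 : Continuous fun x => β (u x) * ∑ i, partialD i (partialD i u) x :=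
    hβc.continuous.mul (continuous_finsetSum _ fun i _ =>
      continuous_partialD (contDiff_partialD hu i) i)
  have h2 : Continuous fun x => β' (u x) * ∑ i, partialD i u x ^ 2 :=
    hβ'c.mul (continuous_finsetSum _ fun i _ => (continuous_partialD hu1 i).pow 2)
  rw [integral_add (integrable_boxMeasure h1) (integrable_boxMeasure h2)] at hz
  linarith

end Partial

/-! ### Time-dependent integrals over the box -/

section Time

variable {d : ℕ} {L : ℝ}

/-- Freezing time below a turns continuity on the open half-line into continuity everywhere, as
integrals with parameters require. -/
theorem continuous_comp_max {f : ℝ × (Fin d → ℝ) → ℝ}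
    (hf : ContinuousOn f (Ioi 0 ×ˢ univ)) {a : ℝ} (ha : 0 < a) :
    Continuous fun p : ℝ × (Fin d → ℝ) => f (max p.1 a, p.2) :=
  hf.comp_continuous (by fun_prop) fun p => ⟨lt_of_lt_of_le ha (le_max_right _ _), mem_univ _⟩

theorem continuousOn_integral_box {f : ℝ → (Fin d → ℝ) → ℝ}
    (hf : ContinuousOn (fun p : ℝ × (Fin d → ℝ) => f p.1 p.2) (Ioi 0 ×ˢ univ)) :
    ContinuousOn (fun t => ∫ x, f t x ∂(boxMeasure d L)) (Ioi 0) := by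
  intro t (ht : 0 < t)
  have hc := continuous_integral_box (L := L) (f := fun s x => f (max s (t / 2)) x)
    (continuous_comp_max hf (half_pos ht))
  refine ContinuousAt.continuousWithinAt (hc.continuousAt.congr ?_)
  filter_upwards [lt_mem_nhds (half_lt_self ht)] with s hs
  simp only [max_eq_left hs.le]

theorem hasDerivAt_integral_box {f f' : ℝ → (Fin d → ℝ) → ℝ}
    (hf : ContinuousOn (fun p : ℝ × (Fin d → ℝ) => f p.1 p.2) (Ioi 0 ×ˢ univ))
    (hf' : ContinuousOn (fun p : ℝ × (Fin d → ℝ) => f' p.1 p.2) (Ioi 0 ×ˢ univ))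
    (hd : ∀ t, 0 < t → ∀ x, HasDerivAt (fun s => f s x) (f' t x) t) {t : ℝ} (ht : 0 < t) :
    HasDerivAt (fun s => ∫ x, f s x ∂(boxMeasure d L)) (∫ x, f' t x ∂(boxMeasure d L)) t := by
  have slice : ∀ {h : ℝ → (Fin d → ℝ) → ℝ},
      ContinuousOn (fun p : ℝ × (Fin d → ℝ) => h p.1 p.2) (Ioi 0 ×ˢ univ) →
      ∀ s, 0 < s → Continuous (h s) := fun hh s hs =>
    hh.comp_continuous (f := fun x => (s, x)) (by fun_prop) fun x => ⟨hs, mem_univ _⟩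
  have hK : IsCompact (Icc (t / 2) (2 * t) ×ˢ box d L) := isCompact_Icc.prod (isCompact_box d L)
  obtain ⟨C, hC⟩ := hK.exists_bound_of_continuousOn (hf'.mono
    (prod_mono (fun s hs => lt_of_lt_of_le (half_pos ht) hs.1) (subset_univ _)))
  refine (hasDerivAt_integral_of_dominated_loc_of_deriv_le (s := Icc (t / 2) (2 * t))
    (bound := fun _ => C) (Icc_mem_nhds (half_lt_self ht) (by linarith)) ?_
    (integrable_boxMeasure (slice hf t ht))
    (slice hf' t ht).aestronglyMeasurable ?_ (integrable_const C) ?_).2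
  · filter_upwards [lt_mem_nhds ht] with s hs
    exact (slice hf s hs).aestronglyMeasurable
  · filter_upwards [ae_restrict_mem (measurableSet_box d L)] with x hx s hs
    exact hC (s, x) ⟨hs, hx⟩
  · exact Eventually.of_forall fun x s hs => hd s (lt_of_lt_of_le (half_pos ht) hs.1) x

end Time

/-! ### Classical solutions for a single density -/

/-- `u` is a classical solution of `∂_t u = κ div (u (∇D ⋆ g)) + Δ u` for a given `g`. -/
structure IsDensitySolution {d : ℕ} (L κ : ℝ) (D : (Fin d → ℝ) → ℝ)
    (g u : ℝ → (Fin d → ℝ) → ℝ) : Prop where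
  classical : IsClassical L u
  integrable : ∀ t, 0 < t → Integrable (g t) (boxMeasure d L)
  equation : ∀ t, 0 < t → ∀ x, deriv (fun s => u s x) t
    = κ * ∑ i, partialD i (fun y => u t y * gradConv L D (g t) i y) x
      + ∑ i, partialD i (partialD i (u t)) x

section Density

variable {d : ℕ} {L κ : ℝ} {D : (Fin d → ℝ) → ℝ} {g u : ℝ → (Fin d → ℝ) → ℝ}

theorem IsClassical.continuous_extend (hu : IsClassical L u) :
    Continuous fun p : ℝ × (Fin d → ℝ) => u (max p.1 0) p.2 :=
  hu.continuousOn.comp_continuous (f := fun p : ℝ × (Fin d → ℝ) => (max p.1 0, p.2))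
    (by fun_prop) fun p => ⟨le_max_right p.1 0, mem_univ _⟩

theorem IsClassical.continuous_slice (hu : IsClassical L u) {t : ℝ} (ht : 0 ≤ t) :
    Continuous (u t) := by
  have := hu.continuous_extend.comp (by fun_prop : Continuous fun x : Fin d → ℝ => (t, x))
  simpa [Function.comp_def, max_eq_left ht] using this

theorem IsClassical.continuousOn_pos (hu : IsClassical L u) :
    ContinuousOn (fun p : ℝ × (Fin d → ℝ) => u p.1 p.2) (Ioi 0 ×ˢ univ) :=
  hu.continuousOn.mono (prod_mono Ioi_subset_Ici_self Subset.rfl)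

theorem IsDensitySolution.integral_comp_mul_drift (h : IsDensitySolution L κ D g u) (hL : 0 < L)
    (hD : MemSobolev L ∞ 2 D) {t : ℝ} (ht : 0 < t) {β β' B : ℝ → ℝ}
    (hβ : ∀ x, HasDerivAt β (β' (u t x)) (u t x))
    (hB : ∀ x, HasDerivAt B (u t x * β' (u t x)) (u t x))
    (hβc : ContDiff ℝ 1 fun x => β (u t x)) (hBc : ContDiff ℝ 1 fun x => B (u t x)) :
    ∫ x, β (u t x) * (deriv (fun s => u s x) t - ∑ i, partialD i (partialD i (u t)) x)
        ∂(boxMeasure d L)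
      = κ * ∫ x, B (u t x) * ∑ i, partialD i (gradConv L D (g t) i) x ∂(boxMeasure d L) := by
  have hu1 : ContDiff ℝ 1 (u t) := (h.classical.contDiff_space t ht).of_le (by norm_num)
  rw [← integral_comp_mul_div_eq hL hu1 (h.classical.periodic t ht.le)
    (fun i => contDiff_gradConv hL hD (h.integrable t ht) i)
    (fun i => isPeriodic_gradConv hL hD i) hβ hB hβc hBc, ← integral_const_mul]
  refine integral_congr_ae (Eventually.of_forall fun x => ?_)
  simp only [h.equation t ht x]
  ring

/-- No regularity of g in time is assumed. The drift term κ div(u(∇D ⋆ g)) is nevertheless jointly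
continuous, because the equation identifies it with ∂_t u - Δu; the drift is therefore kept in this
form under time integrals. -/
theorem IsDensitySolution.continuousOn_drift (h : IsDensitySolution L κ D g u) :
    ContinuousOn (fun p : ℝ × (Fin d → ℝ) => deriv (fun s => u s p.2) p.1
      - ∑ i, partialD i (partialD i (u p.1)) p.2) (Ioi 0 ×ˢ univ) :=
  h.classical.continuousOn_time.sub (continuousOn_finsetSum _ fun i _ =>
    h.classical.continuousOn_second i i)

theorem IsDensitySolution.hasDerivAt_integral_comp (h : IsDensitySolution L κ D g u)
    {η β : ℝ → ℝ} (hη : ∀ t, 0 < t → ∀ x, HasDerivAt η (β (u t x)) (u t x))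
    (hηc : ContinuousOn (fun p : ℝ × (Fin d → ℝ) => η (u p.1 p.2)) (Ioi 0 ×ˢ univ))
    (hβc : ContinuousOn (fun p : ℝ × (Fin d → ℝ) => β (u p.1 p.2)) (Ioi 0 ×ˢ univ))
    {t : ℝ} (ht : 0 < t) :
    HasDerivAt (fun s => ∫ x, η (u s x) ∂(boxMeasure d L))
      (∫ x, β (u t x) * deriv (fun s => u s x) t ∂(boxMeasure d L)) t :=
  hasDerivAt_integral_box (f := fun s x => η (u s x))
    (f' := fun t x => β (u t x) * deriv (fun s => u s x) t) hηc
    (hβc.mul h.classical.continuousOn_time)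
    (fun t ht x => (hη t ht x).comp t (h.classical.differentiable_time t ht x).hasDerivAt) ht

/-- The dissipation identity for `∫ η(u)`, where `η' = β` and `B' (s) = s β' (s)`. -/
theorem IsDensitySolution.integral_comp_mul_deriv (h : IsDensitySolution L κ D g u) (hL : 0 < L)
    (hD : MemSobolev L ∞ 2 D) {t : ℝ} (ht : 0 < t) {β β' B : ℝ → ℝ}
    (hβ : ∀ x, HasDerivAt β (β' (u t x)) (u t x))
    (hB : ∀ x, HasDerivAt B (u t x * β' (u t x)) (u t x))
    (hβc : ContDiff ℝ 1 fun x => β (u t x)) (hBc : ContDiff ℝ 1 fun x => B (u t x))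
    (hβ'c : Continuous fun x => β' (u t x)) :
    ∫ x, β (u t x) * deriv (fun s => u s x) t ∂(boxMeasure d L)
      = κ * (∫ x, B (u t x) * ∑ i, partialD i (gradConv L D (g t) i) x ∂(boxMeasure d L))
        - ∫ x, β' (u t x) * ∑ i, partialD i (u t) x ^ 2 ∂(boxMeasure d L) := by
  have hu := h.classical.contDiff_space t ht
  rw [← h.integral_comp_mul_drift hL hD ht hβ hB hβc hBc, sub_eq_add_neg,
    ← integral_comp_mul_laplacian_eq hL hu (h.classical.periodic t ht.le) hβ hβc hβ'c]
  have hS : Continuous fun x => deriv (fun s => u s x) t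
      - ∑ i, partialD i (partialD i (u t)) x :=
    h.continuousOn_drift.comp_continuous (f := fun x => (t, x)) (by fun_prop)
      fun x => ⟨ht, mem_univ _⟩
  have hLap : Continuous fun x => ∑ i, partialD i (partialD i (u t)) x :=
    continuous_finsetSum _ fun i _ => continuous_partialD (contDiff_partialD hu i) i
  have h1 : Integrable (fun x => β (u t x) * (deriv (fun s => u s x) t
      - ∑ i, partialD i (partialD i (u t)) x)) (boxMeasure d L) :=
    integrable_boxMeasure (hβc.continuous.mul hS)
  have h2 : Integrable (fun x => β (u t x) * ∑ i, partialD i (partialD i (u t)) x)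
      (boxMeasure d L) := integrable_boxMeasure (hβc.continuous.mul hLap)
  rw [← integral_add h1 h2]
  refine integral_congr_ae (Eventually.of_forall fun x => ?_)
  simp only
  ring

/-- The dissipation identity with β = 1 and B = 0 has zero right-hand side. -/
theorem IsDensitySolution.integral_eq (h : IsDensitySolution L κ D g u) (hL : 0 < L)
    (hD : MemSobolev L ∞ 2 D) {t : ℝ} (ht : 0 ≤ t) :
    ∫ x, u t x ∂(boxMeasure d L) = ∫ x, u 0 x ∂(boxMeasure d L) := by
  set m := fun s => ∫ x, u s x ∂(boxMeasure d L) with hm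
  have hd : ∀ s ∈ Ioo 0 t, HasDerivAt m 0 s := by
    intro s hs
    have h1 := h.hasDerivAt_integral_comp (η := id) (β := fun _ => 1)
      (fun _ _ x => hasDerivAt_id _) h.classical.continuousOn_pos continuousOn_const hs.1
    rw [h.integral_comp_mul_deriv hL hD hs.1 (β' := fun _ => 0) (B := fun _ => 0)
      (fun x => hasDerivAt_const _ _) (fun x => by simpa using hasDerivAt_const (u s x) (0 : ℝ))
      contDiff_const contDiff_const continuous_const] at h1
    simpa using h1
  have hc : ContinuousOn m (Icc 0 t) := by
    have := (continuous_integral_box (L := L) (f := fun s x => u (max s 0) x)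
      h.classical.continuous_extend).continuousOn (s := Icc 0 t)
    refine this.congr fun s hs => ?_
    simp only [hm, max_eq_left hs.1]
  have h1 := intervalIntegral.sub_le_integral_of_hasDeriv_right_of_le ht hc
    (fun s hs => (hd s hs).hasDerivWithinAt) (φ := fun _ => 0) integrableOn_zero
    fun _ _ => le_rfl
  have h2 := intervalIntegral.sub_le_integral_of_hasDeriv_right_of_le ht hc.neg
    (fun s hs => (hd s hs).neg.hasDerivWithinAt) (φ := fun _ => 0) integrableOn_zero
    fun _ _ => by simp
  simp only [intervalIntegral.integral_zero, Pi.neg_apply] at h1 h2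
  show m t = m 0
  linarith

end Density

/-! ### Nonnegativity of solutions -/

theorem hasDerivAt_sqrt_sq_add {ε : ℝ} (hε : 0 < ε) (s : ℝ) :
    HasDerivAt (fun s => Real.sqrt (s ^ 2 + ε ^ 2)) (s / Real.sqrt (s ^ 2 + ε ^ 2)) s := by
  have h0 : s ^ 2 + ε ^ 2 ≠ 0 := by positivity
  have h := (((hasDerivAt_id' s).pow 2).add_const (ε ^ 2)).sqrt h0
  refine h.congr_deriv ?_
  simp
  field_simp

theorem contDiff_sqrt_sq_add {ε : ℝ} (hε : 0 < ε) :
    ContDiff ℝ 1 fun s : ℝ => Real.sqrt (s ^ 2 + ε ^ 2) :=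
  ((contDiff_id.pow 2).add contDiff_const).sqrt fun s => by
    have : 0 < s ^ 2 + ε ^ 2 := by positivity
    exact this.ne'

theorem hasDerivAt_div_sqrt_sq_add {ε : ℝ} (hε : 0 < ε) (s : ℝ) :
    HasDerivAt (fun s => s / Real.sqrt (s ^ 2 + ε ^ 2) - 1)
      (ε ^ 2 / Real.sqrt (s ^ 2 + ε ^ 2) ^ 3) s := by
  have hr : 0 < Real.sqrt (s ^ 2 + ε ^ 2) := Real.sqrt_pos.2 (by positivity)
  have hsq : Real.sqrt (s ^ 2 + ε ^ 2) ^ 2 = s ^ 2 + ε ^ 2 := Real.sq_sqrt (by positivity)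
  refine (((hasDerivAt_id' s).div (hasDerivAt_sqrt_sq_add hε s) hr.ne').sub_const 1).congr_deriv ?_
  set r := Real.sqrt (s ^ 2 + ε ^ 2)
  field_simp
  linarith

theorem hasDerivAt_neg_div_sqrt_sq_add {ε : ℝ} (hε : 0 < ε) (s : ℝ) :
    HasDerivAt (fun s => -ε ^ 2 / Real.sqrt (s ^ 2 + ε ^ 2))
      (s * (ε ^ 2 / Real.sqrt (s ^ 2 + ε ^ 2) ^ 3)) s := by
  have hr : 0 < Real.sqrt (s ^ 2 + ε ^ 2) := Real.sqrt_pos.2 (by positivity)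
  refine ((hasDerivAt_const s (-ε ^ 2)).div (hasDerivAt_sqrt_sq_add hε s) hr.ne').congr_deriv ?_
  field_simp
  ring

theorem abs_sqrt_sq_add_sub_le {ε : ℝ} (hε : 0 < ε) (s : ℝ) :
    abs (Real.sqrt (s ^ 2 + ε ^ 2) - |s|) ≤ ε := by
  have h1 : |s| ≤ Real.sqrt (s ^ 2 + ε ^ 2) := Real.abs_le_sqrt (by nlinarith)
  have h2 : Real.sqrt (s ^ 2 + ε ^ 2) ≤ |s| + ε := by
    rw [Real.sqrt_le_left (by positivity)]
    nlinarith [abs_nonneg s, sq_abs s]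
  rw [abs_le]
  constructor <;> linarith

section Nonneg

variable {d : ℕ} {L κ : ℝ} {D : (Fin d → ℝ) → ℝ} {g u : ℝ → (Fin d → ℝ) → ℝ}

/-- The function √(s² + ε²) - s is a smooth convex regularization of |s| - s, twice the negative
part. Convexity gives the diffusion a favourable sign, so only the drift remains. -/
theorem IsDensitySolution.integral_sqrt_sub_le (h : IsDensitySolution L κ D g u) (hL : 0 < L)
    (hD : MemSobolev L ∞ 2 D) {ε : ℝ} (hε : 0 < ε) {a b : ℝ} (ha : 0 < a) (hab : a ≤ b) :
    (∫ x, (Real.sqrt (u b x ^ 2 + ε ^ 2) - u b x) ∂(boxMeasure d L))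
      - ∫ x, (Real.sqrt (u a x ^ 2 + ε ^ 2) - u a x) ∂(boxMeasure d L)
      ≤ ∫ t in a..b, ∫ x, (u t x / Real.sqrt (u t x ^ 2 + ε ^ 2) - 1)
        * (deriv (fun s => u s x) t - ∑ i, partialD i (partialD i (u t)) x) ∂(boxMeasure d L) := by
  have hr : ∀ s : ℝ, Real.sqrt (s ^ 2 + ε ^ 2) ≠ 0 := fun s =>
    (Real.sqrt_pos.2 (by positivity)).ne'
  have hsq : Continuous fun s : ℝ => Real.sqrt (s ^ 2 + ε ^ 2) := by fun_prop
  have hηc : Continuous fun s : ℝ => Real.sqrt (s ^ 2 + ε ^ 2) - s := by fun_prop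
  have hβc : Continuous fun s : ℝ => s / Real.sqrt (s ^ 2 + ε ^ 2) - 1 :=
    (continuous_id.div hsq hr).sub continuous_const
  have hβ'c : Continuous fun s : ℝ => ε ^ 2 / Real.sqrt (s ^ 2 + ε ^ 2) ^ 3 :=
    continuous_const.div (hsq.pow 3) fun s => pow_ne_zero 3 (hr s)
  have hβd : ContDiff ℝ 1 fun s : ℝ => s / Real.sqrt (s ^ 2 + ε ^ 2) - 1 :=
    (contDiff_id.div (contDiff_sqrt_sq_add hε) hr).sub contDiff_const
  have hBd : ContDiff ℝ 1 fun s : ℝ => -ε ^ 2 / Real.sqrt (s ^ 2 + ε ^ 2) :=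
    contDiff_const.div (contDiff_sqrt_sq_add hε) hr
  have hder : ∀ t, 0 < t → HasDerivAt
      (fun s => ∫ x, (Real.sqrt (u s x ^ 2 + ε ^ 2) - u s x) ∂(boxMeasure d L))
      (∫ x, (u t x / Real.sqrt (u t x ^ 2 + ε ^ 2) - 1) * deriv (fun s => u s x) t
        ∂(boxMeasure d L)) t := fun t ht =>
    h.hasDerivAt_integral_comp (η := fun s => Real.sqrt (s ^ 2 + ε ^ 2) - s)
      (β := fun s => s / Real.sqrt (s ^ 2 + ε ^ 2) - 1)
      (fun t _ x => (hasDerivAt_sqrt_sq_add hε _).sub (hasDerivAt_id' _))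
      (hηc.comp_continuousOn h.classical.continuousOn_pos)
      (hβc.comp_continuousOn h.classical.continuousOn_pos) ht
  have hφ : ContinuousOn (fun t => ∫ x, (u t x / Real.sqrt (u t x ^ 2 + ε ^ 2) - 1)
        * (deriv (fun s => u s x) t - ∑ i, partialD i (partialD i (u t)) x) ∂(boxMeasure d L))
      (Ioi 0) :=
    continuousOn_integral_box ((hβc.comp_continuousOn h.classical.continuousOn_pos).mul
      h.continuousOn_drift)
  have hsub : Icc a b ⊆ Ioi 0 := fun t ht => lt_of_lt_of_le ha ht.1
  refine intervalIntegral.sub_le_integral_of_hasDeriv_right_of_le hab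
    (fun t ht => (hder t (hsub ht)).continuousAt.continuousWithinAt)
    (fun t ht => (hder t (hsub (Ioo_subset_Icc_self ht))).hasDerivWithinAt)
    ((hφ.mono hsub).integrableOn_Icc) fun t ht => ?_
  have ht0 : 0 < t := hsub (Ioo_subset_Icc_self ht)
  have hu1 : ContDiff ℝ 1 (u t) := (h.classical.contDiff_space t ht0).of_le (by norm_num)
  rw [h.integral_comp_mul_deriv hL hD ht0
      (β := fun s => s / Real.sqrt (s ^ 2 + ε ^ 2) - 1)
      (β' := fun s => ε ^ 2 / Real.sqrt (s ^ 2 + ε ^ 2) ^ 3)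
      (B := fun s => -ε ^ 2 / Real.sqrt (s ^ 2 + ε ^ 2)) (fun x => hasDerivAt_div_sqrt_sq_add hε (u t x))
    (fun x => hasDerivAt_neg_div_sqrt_sq_add hε (u t x)) (hβd.comp hu1) (hBd.comp hu1)
    (hβ'c.comp hu1.continuous),
    h.integral_comp_mul_drift hL hD ht0
      (β := fun s => s / Real.sqrt (s ^ 2 + ε ^ 2) - 1)
      (β' := fun s => ε ^ 2 / Real.sqrt (s ^ 2 + ε ^ 2) ^ 3)
      (B := fun s => -ε ^ 2 / Real.sqrt (s ^ 2 + ε ^ 2)) (fun x => hasDerivAt_div_sqrt_sq_add hε (u t x))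
    (fun x => hasDerivAt_neg_div_sqrt_sq_add hε (u t x)) (hβd.comp hu1) (hBd.comp hu1)]
  have : 0 ≤ ∫ x, ε ^ 2 / Real.sqrt (u t x ^ 2 + ε ^ 2) ^ 3 * ∑ i, partialD i (u t) x ^ 2
      ∂(boxMeasure d L) :=
    integral_nonneg fun x => mul_nonneg (by positivity)
      (Finset.sum_nonneg fun i _ => sq_nonneg _)
  linarith

/-- After integration by parts the drift is tested against B(s) = -ε²/√(s² + ε²), and |B| ≤ ε, while
div(∇D ⋆ g) is integrable at the fixed time t. -/
theorem IsDensitySolution.tendsto_integral_drift (h : IsDensitySolution L κ D g u) (hL : 0 < L)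
    (hκ : 0 < κ) (hD : MemSobolev L ∞ 2 D) {t : ℝ} (ht : 0 < t) {ε : ℕ → ℝ} (hε : ∀ n, 0 < ε n)
    (hε0 : Tendsto ε atTop (𝓝 0)) :
    Tendsto (fun n => ∫ x, (u t x / Real.sqrt (u t x ^ 2 + ε n ^ 2) - 1)
        * (deriv (fun s => u s x) t - ∑ i, partialD i (partialD i (u t)) x) ∂(boxMeasure d L))
      atTop (𝓝 0) := by
  have hu1 : ContDiff ℝ 1 (u t) := (h.classical.contDiff_space t ht).of_le (by norm_num)
  have hr : ∀ n (s : ℝ), Real.sqrt (s ^ 2 + ε n ^ 2) ≠ 0 := fun n s =>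
    (Real.sqrt_pos.2 (by have := hε n; positivity)).ne'
  have hdiv := continuous_sum_partialD_gradConv (L := L) hL hD (h.integrable t ht)
  set I := ∫ x, |∑ i, partialD i (gradConv L D (g t) i) x| ∂(boxMeasure d L)
  refine squeeze_zero_norm (a := fun n => κ * (ε n * I)) (fun n => ?_) ?_
  · have hBd : ContDiff ℝ 1 fun s : ℝ => -ε n ^ 2 / Real.sqrt (s ^ 2 + ε n ^ 2) :=
      contDiff_const.div (contDiff_sqrt_sq_add (hε n)) (hr n)
    rw [h.integral_comp_mul_drift hL hD ht
      (β := fun s => s / Real.sqrt (s ^ 2 + ε n ^ 2) - 1)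
      (β' := fun s => ε n ^ 2 / Real.sqrt (s ^ 2 + ε n ^ 2) ^ 3)
      (B := fun s => -ε n ^ 2 / Real.sqrt (s ^ 2 + ε n ^ 2)) (fun x => hasDerivAt_div_sqrt_sq_add (hε n) (u t x))
      (fun x => hasDerivAt_neg_div_sqrt_sq_add (hε n) (u t x))
      (((contDiff_id.div (contDiff_sqrt_sq_add (hε n)) (hr n)).sub contDiff_const).comp hu1)
      (hBd.comp hu1), norm_mul, Real.norm_eq_abs κ, abs_of_pos hκ]
    refine mul_le_mul_of_nonneg_left ?_ hκ.le
    rw [← integral_const_mul]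
    refine (norm_integral_le_integral_norm _).trans (integral_mono ?_ ?_ fun x => ?_)
    · exact (integrable_boxMeasure ((hBd.comp hu1).continuous.mul hdiv)).norm
    · exact (integrable_boxMeasure hdiv).abs.const_mul _
    · simp only [norm_mul, Real.norm_eq_abs]
      refine mul_le_mul_of_nonneg_right ?_ (abs_nonneg _)
      have h1 : ε n ≤ Real.sqrt (u t x ^ 2 + ε n ^ 2) :=
        Real.le_sqrt_of_sq_le (by nlinarith [sq_nonneg (u t x)])
      have h2 := hε n
      rw [abs_div, abs_neg, abs_of_nonneg (sq_nonneg _), abs_of_nonneg (Real.sqrt_nonneg _),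
        div_le_iff₀ (lt_of_lt_of_le h2 h1)]
      nlinarith
  · simpa using (hε0.mul_const I).const_mul κ

/-- The regularized inequality passes to the limit ε → 0: the left side converges uniformly, the
drift integral tends to zero. -/
theorem IsDensitySolution.integral_abs_sub_le (h : IsDensitySolution L κ D g u) (hL : 0 < L)
    (hκ : 0 < κ) (hD : MemSobolev L ∞ 2 D) {a b : ℝ} (ha : 0 < a) (hab : a ≤ b) :
    ∫ x, (|u b x| - u b x) ∂(boxMeasure d L) ≤ ∫ x, (|u a x| - u a x) ∂(boxMeasure d L) := by
  set ε : ℕ → ℝ := fun n => 1 / ((n : ℝ) + 1) with hεdef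
  have hε : ∀ n, 0 < ε n := fun n => by positivity
  have hε0 : Tendsto ε atTop (𝓝 0) := tendsto_one_div_add_atTop_nhds_zero_nat
  have hlim : ∀ t, 0 < t → Tendsto
      (fun n => ∫ x, (Real.sqrt (u t x ^ 2 + ε n ^ 2) - u t x) ∂(boxMeasure d L)) atTop
      (𝓝 (∫ x, (|u t x| - u t x) ∂(boxMeasure d L))) := by
    intro t ht
    have hc := h.classical.continuous_slice ht.le
    rw [tendsto_iff_norm_sub_tendsto_zero]
    refine squeeze_zero (fun _ => norm_nonneg _) (g := fun n => L ^ d * ε n) (fun n => ?_) ?_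
    · rw [← integral_sub (integrable_boxMeasure (by fun_prop)) (integrable_boxMeasure (by fun_prop)),
        ← integral_const_boxMeasure d hL]
      refine (norm_integral_le_integral_norm _).trans (integral_mono
        (integrable_boxMeasure (by fun_prop)).norm (integrable_const _) fun x => ?_)
      have := abs_sqrt_sq_add_sub_le (hε n) (u t x)
      rwa [Real.norm_eq_abs, sub_sub_sub_cancel_right]
    · simpa using hε0.const_mul (L ^ d)
  have hsub : Icc a b ⊆ Ioi 0 := fun t ht => lt_of_lt_of_le ha ht.1
  have hK : IsCompact (Icc a b ×ˢ box d L) := isCompact_Icc.prod (isCompact_box d L)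
  obtain ⟨C, hC⟩ := hK.exists_bound_of_continuousOn
    (h.continuousOn_drift.mono (prod_mono hsub (subset_univ _)))
  -- The bound of order ε at fixed t is not known to be uniform in t, as g is uncontrolled in time.
  -- Domination comes instead from |β| ≤ 2 and the continuity of ∂_t u - Δu on the compact set [a,
  -- b] × U, which is why a > 0.
  have hint : Tendsto (fun n => ∫ t in a..b, ∫ x, (u t x / Real.sqrt (u t x ^ 2 + ε n ^ 2) - 1)
        * (deriv (fun s => u s x) t - ∑ i, partialD i (partialD i (u t)) x) ∂(boxMeasure d L))
      atTop (𝓝 (∫ t in a..b, (0 : ℝ))) := by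
    refine intervalIntegral.tendsto_integral_filter_of_dominated_convergence
      (fun _ => L ^ d * (2 * C)) ?_ ?_ intervalIntegrable_const ?_
    · refine Eventually.of_forall fun n => ContinuousOn.aestronglyMeasurable ?_ measurableSet_uIoc
      rw [uIoc_of_le hab]
      refine (continuousOn_integral_box ?_).mono (Ioc_subset_Icc_self.trans hsub)
      refine ContinuousOn.mul ?_ h.continuousOn_drift
      have hsq : Continuous fun s : ℝ => Real.sqrt (s ^ 2 + ε n ^ 2) := by fun_prop
      exact ((continuous_id.div hsq fun s =>
        (Real.sqrt_pos.2 (by have := hε n; positivity)).ne').sub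
          continuous_const).comp_continuousOn h.classical.continuousOn_pos
    · refine Eventually.of_forall fun n => Eventually.of_forall fun t ht => ?_
      rw [uIoc_of_le hab] at ht
      rw [← integral_const_boxMeasure d hL]
      refine norm_integral_le_of_norm_le (integrable_const _) ?_
      filter_upwards [ae_restrict_mem (measurableSet_box d L)] with x hx
      rw [norm_mul]
      refine mul_le_mul ?_ (hC (t, x) ⟨Ioc_subset_Icc_self ht, hx⟩) (norm_nonneg _) zero_le_two
      have h1 : |u t x / Real.sqrt (u t x ^ 2 + ε n ^ 2)| ≤ 1 := by
        rw [abs_div, abs_of_nonneg (Real.sqrt_nonneg _)]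
        exact div_le_one_of_le₀ (Real.abs_le_sqrt (by nlinarith [sq_nonneg (ε n)]))
          (Real.sqrt_nonneg _)
      rw [Real.norm_eq_abs, abs_le]
      rw [abs_le] at h1
      constructor <;> linarith
    · refine Eventually.of_forall fun t ht => ?_
      rw [uIoc_of_le hab] at ht
      exact h.tendsto_integral_drift hL hκ hD (ha.trans ht.1) hε hε0
  have hle := le_of_tendsto_of_tendsto' ((hlim b (ha.trans_le hab)).sub (hlim a ha)) hint
    fun n => h.integral_sqrt_sub_le hL hD (hε n) ha hab
  simp only [intervalIntegral.integral_zero] at hle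
  linarith

theorem IsDensitySolution.nonneg (h : IsDensitySolution L κ D g u) (hL : 0 < L)
    (hκ : 0 < κ) (hD : MemSobolev L ∞ 2 D) (h0 : ∀ᵐ x ∂(boxMeasure d L), 0 ≤ u 0 x)
    {t : ℝ} (ht : 0 ≤ t) (x : Fin d → ℝ) : 0 ≤ u t x := by
  set N : ℝ → ℝ := fun s => ∫ x, (|u (max s 0) x| - u (max s 0) x) ∂(boxMeasure d L) with hN
  have hNc : Continuous N := continuous_integral_box
    (f := fun s x => |u (max s 0) x| - u (max s 0) x)
    (h.classical.continuous_extend.abs.sub h.classical.continuous_extend)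
  have hN0 : N 0 = 0 := by
    simp only [hN, max_self]
    rw [integral_eq_zero_of_ae]
    filter_upwards [h0] with x hx
    simp [abs_of_nonneg hx]
  have hNt : N t = 0 := by
    have hnn : 0 ≤ N t := integral_nonneg fun x => sub_nonneg.2 (le_abs_self _)
    rcases ht.eq_or_lt with rfl | ht'
    · exact hN0
    refine le_antisymm ?_ hnn
    -- Monotonicity holds on (0, ∞) only; continuity at time zero transfers it to the initial datum.
    have hlim : Tendsto N (𝓝[>] 0) (𝓝 (N 0)) := (hNc.tendsto 0).mono_left nhdsWithin_le_nhds
    rw [← hN0]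
    refine ge_of_tendsto hlim ?_
    filter_upwards [Ioo_mem_nhdsGT ht'] with a ha
    have := h.integral_abs_sub_le hL hκ hD ha.1 ha.2.le
    simpa only [hN, max_eq_left ht, max_eq_left ha.1.le] using this
  have hc := h.classical.continuous_slice ht
  simp only [hN, max_eq_left ht] at hNt
  rw [integral_eq_zero_iff_of_nonneg (fun x => sub_nonneg.2 (le_abs_self _))
    (integrable_boxMeasure (hc.abs.sub hc))] at hNt
  have hae := ae_of_ae_box hL (h.classical.periodic t ht) (p := fun y => |y| - y = 0) hNt
  have heq : (fun x => |u t x|) = u t := by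
    refine (Continuous.ae_eq_iff_eq volume hc.abs hc).1 ?_
    filter_upwards [hae] with x hx
    linarith
  rw [← congrFun heq x]
  exact abs_nonneg _

end Nonneg

/-! ### The entropy inequality for a single density -/

/-- With r = √ε and q = √x: log(1 + q²/r²) ≤ 2 log(1 + q/r) ≤ 2q/r, and 2q ≤ 1 + q². This bounds the
error that the shift by ε creates in the drift term, uniformly enough to vanish with ε. -/
theorem mul_log_one_add_div_le {ε x : ℝ} (hε : 0 < ε) (hx : 0 ≤ x) :
    ε * (Real.log (x + ε) - Real.log ε) ≤ Real.sqrt ε * (1 + x) := by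
  set r := Real.sqrt ε
  set q := Real.sqrt x
  have hr : 0 < r := Real.sqrt_pos.2 hε
  have hq : 0 ≤ q := Real.sqrt_nonneg _
  have hr2 : r ^ 2 = ε := Real.sq_sqrt hε.le
  have hq2 : q ^ 2 = x := Real.sq_sqrt hx
  rw [← hr2, ← hq2, ← Real.log_div (by positivity) (by positivity)]
  have h1 : Real.log ((q ^ 2 + r ^ 2) / r ^ 2) ≤ 2 * (q / r) := by
    have h2 : (q ^ 2 + r ^ 2) / r ^ 2 ≤ (1 + q / r) ^ 2 := by
      have : (q ^ 2 + r ^ 2) / r ^ 2 = 1 + (q / r) ^ 2 := by field_simp; ring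
      rw [this]
      have : 0 ≤ q / r := by positivity
      nlinarith
    refine (Real.log_le_log (by positivity) h2).trans ?_
    rw [Real.log_pow]
    have := Real.log_le_sub_one_of_pos (show 0 < 1 + q / r by positivity)
    push_cast
    linarith
  calc r ^ 2 * Real.log ((q ^ 2 + r ^ 2) / r ^ 2) ≤ r ^ 2 * (2 * (q / r)) :=
        mul_le_mul_of_nonneg_left h1 (by positivity)
    _ = r * (2 * q) := by field_simp
    _ ≤ r * (1 + q ^ 2) := mul_le_mul_of_nonneg_left (by nlinarith [sq_nonneg (q - 1)]) hr.le

theorem mul_log_one_add_div_nonneg {ε x : ℝ} (hε : 0 < ε) (hx : 0 ≤ x) :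
    0 ≤ ε * (Real.log (x + ε) - Real.log ε) :=
  mul_nonneg hε.le (sub_nonneg.2 (Real.log_le_log hε (by linarith)))

theorem mul_log_div_rhoInf (d : ℕ) {L : ℝ} (hL : 0 < L) (s : ℝ) :
    s * Real.log (s / rhoInf d L) = s * Real.log s - s * Real.log (rhoInf d L) := by
  rcases eq_or_ne s 0 with rfl | hs
  · simp
  · have : rhoInf d L ≠ 0 := by
      unfold rhoInf
      positivity
    rw [Real.log_div hs this]
    ring

section Entropy

variable {d : ℕ} {L κ : ℝ} {D : (Fin d → ℝ) → ℝ} {g u : ℝ → (Fin d → ℝ) → ℝ}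

/-- `∫ (u + ε) log (u + ε)`, with `u` frozen at `t = 0` for negative times. -/
noncomputable def shiftedEntropy (L : ℝ) (u : ℝ → (Fin d → ℝ) → ℝ) (ε t : ℝ) : ℝ :=
  ∫ x, (u (max t 0) x + ε) * Real.log (u (max t 0) x + ε) ∂(boxMeasure d L)

theorem continuous_shiftedEntropy (hu : IsClassical L u) :
    Continuous fun p : ℝ × ℝ => shiftedEntropy L u p.1 p.2 := by
  refine continuous_integral_box
    (f := fun (p : ℝ × ℝ) x => (u (max p.2 0) x + p.1) * Real.log (u (max p.2 0) x + p.1)) ?_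
  refine Real.continuous_mul_log.comp (f := fun q : (ℝ × ℝ) × (Fin d → ℝ) =>
    u (max q.1.2 0) q.2 + q.1.1) ?_
  exact (hu.continuous_extend.comp (f := fun q : (ℝ × ℝ) × (Fin d → ℝ) => (q.1.2, q.2))
    (by fun_prop)).add (by fun_prop)

theorem IsDensitySolution.hasDerivAt_shiftedEntropy (h : IsDensitySolution L κ D g u)
    (hnn : ∀ t, 0 ≤ t → ∀ x, 0 ≤ u t x) {ε : ℝ} (hε : 0 < ε) {t : ℝ} (ht : 0 < t) :
    HasDerivAt (shiftedEntropy L u ε)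
      (∫ x, (Real.log (u t x + ε) + 1) * deriv (fun s => u s x) t ∂(boxMeasure d L)) t := by
  have hpos : ∀ t, 0 ≤ t → ∀ x, u t x + ε ≠ 0 := fun t ht x => by have := hnn t ht x; positivity
  have h1 := h.hasDerivAt_integral_comp (η := fun s => (s + ε) * Real.log (s + ε))
    (β := fun s => Real.log (s + ε) + 1) (fun t ht x => ?_) ?_ ?_ ht
  · refine h1.congr_of_eventuallyEq ?_
    filter_upwards [lt_mem_nhds ht] with s hs
    simp only [shiftedEntropy, max_eq_left hs.le]
  · exact (Real.hasDerivAt_mul_log (hpos t ht.le x)).comp_add_const (u t x) ε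
  · exact Real.continuous_mul_log.comp_continuousOn
      (h.classical.continuousOn_pos.add continuousOn_const)
  · exact ((h.classical.continuousOn_pos.add continuousOn_const).log
      fun p hp => hpos p.1 (le_of_lt hp.1) p.2).add continuousOn_const

/-- Dissipation identity for (s + ε) log(s + ε), whose companion B(s) = s - ε log(1 + s/ε) differs
from s by at most √ε (1 + s). The Fisher information of u + ε is bounded below by the logarithmic
Sobolev inequality, u + ε having mass 1 + εL^d. -/
theorem IsDensitySolution.deriv_shiftedEntropy_le (h : IsDensitySolution L κ D g u) (hL : 0 < L)
    (hκ : 0 < κ) (hD : MemSobolev L ∞ 2 D) (hnn : ∀ t, 0 ≤ t → ∀ x, 0 ≤ u t x)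
    (hmass : ∀ t, 0 ≤ t → ∫ x, u t x ∂(boxMeasure d L) = 1) {ε : ℝ} (hε : 0 < ε)
    {t : ℝ} (ht : 0 < t) (c : ℝ) :
    ∫ x, (Real.log (u t x + ε) + 1) * deriv (fun s => u s x) t ∂(boxMeasure d L)
      ≤ κ * laplacianNorm L D * ((∫ x, |u t x - rhoInf d L| ∂(boxMeasure d L)
          + Real.sqrt ε * (L ^ d + 1)) * ∫ y, |g t y - c| ∂(boxMeasure d L))
        - 4 * Real.pi ^ 2 / L ^ 2 * (shiftedEntropy L u ε t
          - (1 + ε * L ^ d) * Real.log ((1 + ε * L ^ d) / L ^ d)) := by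
  have hpos : ∀ x, 0 < u t x + ε := fun x => by have := hnn t ht.le x; positivity
  have hu2 := h.classical.contDiff_space t ht
  have hu1 : ContDiff ℝ 1 (u t) := hu2.of_le (by norm_num)
  have huc : Continuous (u t) := hu1.continuous
  have hv : ContDiff ℝ 1 fun x => u t x + ε := hu1.add contDiff_const
  have hlog : ContDiff ℝ 1 fun x => Real.log (u t x + ε) := hv.log fun x => (hpos x).ne'
  have hBd : ContDiff ℝ 1 fun x => u t x - ε * (Real.log (u t x + ε) - Real.log ε) :=
    hu1.sub (contDiff_const.mul (hlog.sub contDiff_const))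
  have hlogd : ∀ x, HasDerivAt (fun s => Real.log (s + ε)) (1 / (u t x + ε)) (u t x) := fun x =>
    ((hasDerivAt_id' (u t x)).add_const ε).log (hpos x).ne'
  rw [h.integral_comp_mul_deriv hL hD ht (β := fun s => Real.log (s + ε) + 1)
    (β' := fun s => 1 / (s + ε)) (B := fun s => s - ε * (Real.log (s + ε) - Real.log ε))
    (fun x => (hlogd x).add_const 1)
    (fun x => by
      refine ((hasDerivAt_id' _).sub (((hlogd x).sub_const _).const_mul ε)).congr_deriv ?_
      have := (hpos x).ne'
      field_simp
      ring)
    (hlog.add contDiff_const) hBd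
    (continuous_const.div hv.continuous fun x => (hpos x).ne')]
  have hdrift := integral_mul_sum_partialD_gradConv_le hL hD (h.integrable t ht) hBd.continuous
    c (rhoInf d L)
  have hW : 0 ≤ ∫ y, |g t y - c| ∂(boxMeasure d L) := integral_nonneg fun _ => abs_nonneg _
  have hB : ∫ x, |u t x - ε * (Real.log (u t x + ε) - Real.log ε) - rhoInf d L| ∂(boxMeasure d L)
      ≤ ∫ x, |u t x - rhoInf d L| ∂(boxMeasure d L) + Real.sqrt ε * (L ^ d + 1) := by
    have hI : Real.sqrt ε * (L ^ d + 1) = ∫ x, Real.sqrt ε * (1 + u t x) ∂(boxMeasure d L) := by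
      rw [integral_const_mul, integral_add (integrable_const _) (integrable_boxMeasure huc),
        hmass t ht.le, integral_const_boxMeasure d hL, mul_one]
    have i1 : Integrable (fun x => |u t x - rhoInf d L|) (boxMeasure d L) :=
      integrable_boxMeasure (by fun_prop)
    have i2 : Integrable (fun x => Real.sqrt ε * (1 + u t x)) (boxMeasure d L) :=
      integrable_boxMeasure (by fun_prop)
    rw [hI, ← integral_add i1 i2]
    refine integral_mono (integrable_boxMeasure (hBd.continuous.sub continuous_const).abs)
      (i1.add i2) fun x => ?_
    have h1 := mul_log_one_add_div_le hε (hnn t ht.le x)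
    have h2 := mul_log_one_add_div_nonneg hε (hnn t ht.le x)
    have h3 := abs_sub (u t x - rhoInf d L) (ε * (Real.log (u t x + ε) - Real.log ε))
    rw [abs_of_nonneg h2] at h3
    calc _ = |u t x - rhoInf d L - ε * (Real.log (u t x + ε) - Real.log ε)| := by
          rw [sub_right_comm]
      _ ≤ _ := h3.trans (add_le_add_right h1 _)
  have hls := log_sobolev_torus hL d hv (fun x j => by
    simp only [h.classical.periodic t ht.le x j]) hpos
  have hvm : ∫ y, (u t y + ε) ∂(boxMeasure d L) = 1 + ε * L ^ d := by
    rw [integral_add (integrable_boxMeasure huc) (integrable_const _), hmass t ht.le,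
      integral_const_boxMeasure d hL, mul_comm]
  have hpd : ∀ i x, partialD i (fun x => u t x + ε) x = partialD i (u t) x := by
    intro i x
    simp only [partialD, fderiv_add_const]
  have hent : ∫ x, (u t x + ε) * Real.log ((u t x + ε) / ((1 + ε * L ^ d) / L ^ d))
      ∂(boxMeasure d L)
      = shiftedEntropy L u ε t - (1 + ε * L ^ d) * Real.log ((1 + ε * L ^ d) / L ^ d) := by
    have hm : (1 + ε * L ^ d) / L ^ d ≠ 0 := by positivity
    simp_rw [fun x => Real.log_div (hpos x).ne' hm, mul_sub]
    have i1 : Integrable (fun x => (u t x + ε) * Real.log (u t x + ε)) (boxMeasure d L) :=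
      integrable_boxMeasure (hv.continuous.mul hlog.continuous)
    have i2 : Integrable (fun x => (u t x + ε) * Real.log ((1 + ε * L ^ d) / L ^ d))
        (boxMeasure d L) := integrable_boxMeasure (hv.continuous.mul continuous_const)
    rw [integral_sub i1 i2, integral_mul_const, hvm,
      shiftedEntropy, max_eq_left ht.le]
  have hfisher : ∫ x, ∑ i, partialD i (fun x => u t x + ε) x ^ 2 / (u t x + ε) ∂(boxMeasure d L)
      = ∫ x, 1 / (u t x + ε) * ∑ i, partialD i (u t) x ^ 2 ∂(boxMeasure d L) := by
    refine integral_congr_ae (Eventually.of_forall fun x => ?_)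
    simp only [hpd, Finset.mul_sum]
    exact Finset.sum_congr rfl fun i _ => by ring
  rw [hvm, hent, hfisher] at hls
  have hlap := laplacianNorm_nonneg L D
  have hfin : κ * ∫ x, (u t x - ε * (Real.log (u t x + ε) - Real.log ε))
        * ∑ i, partialD i (gradConv L D (g t) i) x ∂(boxMeasure d L)
      ≤ κ * laplacianNorm L D * ((∫ x, |u t x - rhoInf d L| ∂(boxMeasure d L)
          + Real.sqrt ε * (L ^ d + 1)) * ∫ y, |g t y - c| ∂(boxMeasure d L)) := by
    rw [mul_assoc]
    refine mul_le_mul_of_nonneg_left ((le_abs_self _).trans (hdrift.trans ?_)) hκ.le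
    exact mul_le_mul_of_nonneg_left (mul_le_mul_of_nonneg_right hB hW) hlap
  linarith

theorem IsDensitySolution.entropy_inequality (h : IsDensitySolution L κ D g u) (hL : 0 < L)
    (hκ : 0 < κ) (hD : MemSobolev L ∞ 2 D) (hnn : ∀ t, 0 ≤ t → ∀ x, 0 ≤ u t x)
    (hmass : ∀ t, 0 ≤ t → ∫ x, u t x ∂(boxMeasure d L) = 1) {a b : ℝ} (ha : 0 ≤ a) (hab : a ≤ b)
    (c : ℝ → ℝ) (hW : IntegrableOn (fun t => ∫ y, |g t y - c t| ∂(boxMeasure d L)) (Icc a b)) :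
    (∫ x, u b x * Real.log (u b x / rhoInf d L) ∂(boxMeasure d L))
      + 4 * Real.pi ^ 2 / L ^ 2 *
        ∫ t in a..b, ∫ x, u t x * Real.log (u t x / rhoInf d L) ∂(boxMeasure d L)
      ≤ (∫ x, u a x * Real.log (u a x / rhoInf d L) ∂(boxMeasure d L))
        + κ * laplacianNorm L D * ∫ t in a..b, (∫ x, |u t x - rhoInf d L| ∂(boxMeasure d L))
          * ∫ y, |g t y - c t| ∂(boxMeasure d L) := by
  have hQ := continuous_shiftedEntropy (L := L) h.classical
  set w : ℝ → ℝ := fun t => ∫ x, |u t x - rhoInf d L| ∂(boxMeasure d L) with hw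
  set W : ℝ → ℝ := fun t => ∫ y, |g t y - c t| ∂(boxMeasure d L) with hWdef
  set lam := 4 * Real.pi ^ 2 / L ^ 2
  set k := κ * laplacianNorm L D
  have hwc : ContinuousOn w (Icc a b) := by
    have : Continuous fun t => ∫ x, |u (max t 0) x - rhoInf d L| ∂(boxMeasure d L) :=
      continuous_integral_box (f := fun t x => |u (max t 0) x - rhoInf d L|)
        (h.classical.continuous_extend.sub continuous_const).abs
    refine this.continuousOn.congr fun t ht => ?_
    simp only [hw, max_eq_left (ha.trans ht.1)]
  have hwW : IntegrableOn (fun t => w t * W t) (Icc a b) := hW.continuousOn_mul hwc isCompact_Icc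
  have hQs : ∀ ε, Continuous (shiftedEntropy L u ε) := fun ε =>
    hQ.comp (by fun_prop : Continuous fun t : ℝ => (ε, t))
  have iIcc : ∀ {f : ℝ → ℝ}, IntegrableOn f (Icc a b) → IntervalIntegrable f volume a b :=
    fun hf => (intervalIntegrable_iff_integrableOn_Icc_of_le hab).2 hf
  -- The contribution of the mean of u + ε; at ε = 0 it equals log ρ_∞.
  set E : ℝ → ℝ := fun ε => (1 + ε * L ^ d) * Real.log ((1 + ε * L ^ d) / L ^ d) with hE
  have hstep : ∀ ε, 0 < ε → shiftedEntropy L u ε b - shiftedEntropy L u ε a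
      ≤ k * ((∫ t in a..b, w t * W t) + Real.sqrt ε * (L ^ d + 1) * ∫ t in a..b, W t)
        - lam * ((∫ t in a..b, shiftedEntropy L u ε t) - (b - a) * E ε) := by
    intro ε hε
    have hφ : IntegrableOn (fun t => k * ((w t + Real.sqrt ε * (L ^ d + 1)) * W t)
        - lam * (shiftedEntropy L u ε t - E ε)) (Icc a b) := by
      refine ((hW.continuousOn_mul (hwc.add continuousOn_const) isCompact_Icc).const_mul k).sub ?_
      exact (((hQs ε).sub continuous_const).const_mul lam).integrableOn_Icc
    have hle := intervalIntegral.sub_le_integral_of_hasDeriv_right_of_le hab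
      (hQs ε).continuousOn (fun t ht => (h.hasDerivAt_shiftedEntropy hnn hε
        (ha.trans_lt ht.1)).hasDerivWithinAt) hφ
      fun t ht => h.deriv_shiftedEntropy_le hL hκ hD hnn hmass hε (ha.trans_lt ht.1) (c t)
    refine hle.trans (le_of_eq ?_)
    have i1 : IntervalIntegrable (fun t => k * ((w t + Real.sqrt ε * (L ^ d + 1)) * W t))
        volume a b :=
      iIcc ((hW.continuousOn_mul (hwc.add continuousOn_const) isCompact_Icc).const_mul k)
    have i2 : IntervalIntegrable (fun t => lam * (shiftedEntropy L u ε t - E ε)) volume a b :=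
      (((hQs ε).sub continuous_const).const_mul lam).intervalIntegrable _ _
    rw [intervalIntegral.integral_sub i1 i2, intervalIntegral.integral_const_mul,
      intervalIntegral.integral_const_mul, intervalIntegral.integral_sub
        ((hQs ε).intervalIntegrable _ _) intervalIntegrable_const,
      intervalIntegral.integral_const, smul_eq_mul]
    simp_rw [add_mul]
    rw [intervalIntegral.integral_add (iIcc hwW) (iIcc (hW.const_mul _)),
      intervalIntegral.integral_const_mul]
  have hQI : Continuous fun ε => ∫ t in a..b, shiftedEntropy L u ε t :=
    intervalIntegral.continuous_parametric_intervalIntegral_of_continuous' hQ a b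
  have hEc : ContinuousAt E 0 := by
    have h0 : (1 + (0 : ℝ) * L ^ d) / L ^ d ≠ 0 := by
      rw [zero_mul, add_zero]
      positivity
    exact ContinuousAt.mul (by fun_prop) (ContinuousAt.log (by fun_prop) h0)
  have hQb : ContinuousAt (fun ε => shiftedEntropy L u ε b) 0 :=
    (hQ.comp (by fun_prop : Continuous fun ε : ℝ => (ε, b))).continuousAt
  have hQa : ContinuousAt (fun ε => shiftedEntropy L u ε a) 0 :=
    (hQ.comp (by fun_prop : Continuous fun ε : ℝ => (ε, a))).continuousAt
  have hrhs : ContinuousAt (fun ε => k * ((∫ t in a..b, w t * W t)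
      + Real.sqrt ε * (L ^ d + 1) * ∫ t in a..b, W t)
        - lam * ((∫ t in a..b, shiftedEntropy L u ε t) - (b - a) * E ε)) 0 := by
    have := hQI.continuousAt (x := 0)
    fun_prop
  -- The limit ε → 0 is harmless once integrated in time: s log s is continuous at 0, so the shifted
  -- entropy is jointly continuous in ε and t up to ε = 0.
  have hlim := le_of_tendsto_of_tendsto ((hQb.sub hQa).tendsto.mono_left nhdsWithin_le_nhds)
    (hrhs.tendsto.mono_left nhdsWithin_le_nhds) (b := 𝓝[>] (0 : ℝ))
    (eventually_mem_nhdsWithin.mono fun ε hε => hstep ε hε)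
  have hrho : Real.log (rhoInf d L) = E 0 := by
    simp [hE, rhoInf]
  have hent : ∀ t, 0 ≤ t → ∫ x, u t x * Real.log (u t x / rhoInf d L) ∂(boxMeasure d L)
      = shiftedEntropy L u 0 t - E 0 := by
    intro t ht
    have hc := h.classical.continuous_slice ht
    simp_rw [mul_log_div_rhoInf d hL]
    have i1 : Integrable (fun x => u t x * Real.log (u t x)) (boxMeasure d L) :=
      integrable_boxMeasure (Real.continuous_mul_log.comp hc)
    have i2 : Integrable (fun x => u t x * Real.log (rhoInf d L)) (boxMeasure d L) :=
      integrable_boxMeasure (hc.mul continuous_const)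
    rw [integral_sub i1 i2, integral_mul_const, hmass t ht, one_mul,
      hrho, shiftedEntropy]
    simp only [max_eq_left ht, add_zero]
  have hentI : ∫ t in a..b, ∫ x, u t x * Real.log (u t x / rhoInf d L) ∂(boxMeasure d L)
      = (∫ t in a..b, shiftedEntropy L u 0 t) - (b - a) * E 0 := by
    rw [intervalIntegral.integral_congr (g := fun t => shiftedEntropy L u 0 t - E 0),
      intervalIntegral.integral_sub ((hQs 0).intervalIntegrable _ _) intervalIntegrable_const,
      intervalIntegral.integral_const, smul_eq_mul]
    intro t ht
    rw [uIcc_of_le hab] at ht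
    exact hent t (ha.trans ht.1)
  rw [hentI, hent b (ha.trans hab), hent a ha]
  simp only [Real.sqrt_zero, zero_mul, add_zero, Pi.sub_apply] at hlim
  simp only [hw, hWdef] at hlim
  linarith

end Entropy

/-! ### Graphops: norm, duality and the combined action -/

/-- Truncation is the nearest-point projection onto [-n, n], which is 1-Lipschitz and fixes c. -/
theorem abs_clip_sub_le {Ω : Type*} {f : Ω → ℝ} {c : ℝ} {n : ℕ} (hn : |c| ≤ n) (ξ : Ω) :
    |clip f n ξ - c| ≤ |f ξ - c| := by
  rw [abs_le] at hn
  unfold clip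
  rcases le_total (f ξ) n with h1 | h1
  · rw [min_eq_left h1]
    rcases le_total (-(n : ℝ)) (f ξ) with h2 | h2
    · rw [max_eq_right h2]
    · rw [max_eq_left h2, abs_of_nonpos (by linarith), abs_of_nonpos (by linarith)]
      linarith
  · rw [min_eq_right h1, max_eq_right (by linarith), abs_of_nonneg (by linarith),
      abs_of_nonneg (by linarith)]
    linarith

section Graphop

variable {Ω : Type*} [MeasurableSpace Ω] {μ : Measure Ω}

theorem inner_nonneg_of_nonneg {f g : Lp ℝ 2 μ} (hf : 0 ≤ f) (hg : 0 ≤ g) :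
    0 ≤ inner ℝ f g := by
  rw [L2.inner_def]
  refine integral_nonneg_of_ae ?_
  filter_upwards [(Lp.coeFn_nonneg f).2 hf, (Lp.coeFn_nonneg g).2 hg] with x h1 h2
  simp only [Pi.zero_apply] at h1 h2 ⊢
  simp only [RCLike.inner_apply, conj_trivial]
  exact mul_nonneg h2 h1

theorem IsGraphop.inner_comm {A : Lp ℝ 2 μ →L[ℝ] Lp ℝ 2 μ} (hA : IsGraphop A) (f g : Lp ℝ 2 μ) :
    inner ℝ (A f) g = inner ℝ f (A g) :=
  ContinuousLinearMap.isSelfAdjoint_iff_isSymmetric.1 hA.selfAdjoint f g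

theorem bddAbove_numericalRange (A : Lp ℝ 2 μ →L[ℝ] Lp ℝ 2 μ) :
    BddAbove {r : ℝ | ∃ f : Lp ℝ 2 μ, ‖f‖ = 1 ∧ r = inner ℝ (A f) f} := by
  refine ⟨‖A‖, ?_⟩
  rintro r ⟨f, hf, rfl⟩
  calc inner ℝ (A f) f ≤ ‖A f‖ * ‖f‖ := real_inner_le_norm _ _
    _ ≤ ‖A‖ * ‖f‖ * ‖f‖ := mul_le_mul_of_nonneg_right (A.le_opNorm f) (norm_nonneg _)
    _ = ‖A‖ := by rw [hf]; ring

theorem inner_le_numericalRadius (A : Lp ℝ 2 μ →L[ℝ] Lp ℝ 2 μ) (f : Lp ℝ 2 μ) :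
    inner ℝ (A f) f ≤ numericalRadius A * ‖f‖ ^ 2 := by
  rcases eq_or_ne f 0 with rfl | hf
  · simp
  have hn : 0 < ‖f‖ := norm_pos_iff.2 hf
  have h := le_csSup (bddAbove_numericalRange A) ⟨‖f‖⁻¹ • f, by
    rw [norm_smul, norm_inv, norm_norm, inv_mul_cancel₀ hn.ne'], rfl⟩
  rw [map_smul, real_inner_smul_left, real_inner_smul_right] at h
  have h2 : ‖f‖⁻¹ * (‖f‖⁻¹ * inner ℝ (A f) f) = inner ℝ (A f) f / ‖f‖ ^ 2 := by
    field_simp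
  rw [h2, div_le_iff₀ (by positivity)] at h
  exact h

/-- Expanding with f = f⁺ - f⁻ gives four nonnegative terms; passing to |f| makes all signs
positive. -/
theorem IsGraphop.abs_inner_le {A : Lp ℝ 2 μ →L[ℝ] Lp ℝ 2 μ} (hA : IsGraphop A)
    (f : Lp ℝ 2 μ) : |inner ℝ (A f) f| ≤ inner ℝ (A |f|) |f| := by
  have hp : (0 : Lp ℝ 2 μ) ≤ f⁺ := posPart_nonneg f
  have hq : (0 : Lp ℝ 2 μ) ≤ f⁻ := negPart_nonneg f
  have h1 : f = f⁺ - f⁻ := (posPart_sub_negPart f).symm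
  have h2 : |f| = f⁺ + f⁻ := (posPart_add_negPart f).symm
  have hpp := inner_nonneg_of_nonneg (hA.nonneg _ hp) hp
  have hpq := inner_nonneg_of_nonneg (hA.nonneg _ hp) hq
  have hqp := inner_nonneg_of_nonneg (hA.nonneg _ hq) hp
  have hqq := inner_nonneg_of_nonneg (hA.nonneg _ hq) hq
  rw [h2]
  conv_lhs => rw [h1]
  simp only [map_sub, map_add, inner_sub_left, inner_sub_right, inner_add_left, inner_add_right]
  rw [abs_le]
  constructor <;> linarith

theorem IsGraphop.abs_inner_le_numericalRadius {A : Lp ℝ 2 μ →L[ℝ] Lp ℝ 2 μ}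
    (hA : IsGraphop A) (f : Lp ℝ 2 μ) :
    |inner ℝ (A f) f| ≤ numericalRadius A * ‖f‖ ^ 2 := by
  have h := inner_le_numericalRadius A |f|
  rw [norm_abs_eq_norm] at h
  exact (hA.abs_inner_le f).trans h

theorem IsGraphop.numericalRadius_nonneg {A : Lp ℝ 2 μ →L[ℝ] Lp ℝ 2 μ}
    (hA : IsGraphop A) : 0 ≤ numericalRadius A := by
  by_cases h : ∃ f : Lp ℝ 2 μ, ‖f‖ = 1
  · obtain ⟨f, hf⟩ := h
    refine ((abs_nonneg _).trans (hA.abs_inner_le f)).trans ?_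
    exact le_csSup (bddAbove_numericalRange A) ⟨|f|, by rw [norm_abs_eq_norm, hf], rfl⟩
  · refine Real.sSup_nonneg ?_
    rintro r ⟨f, hf, -⟩
    exact absurd ⟨f, hf⟩ h

/-- Polarization for a self-adjoint operator, together with the parallelogram law. The numerical
radius has no absolute value, but positivity makes it control |(Af, f)| as well. -/
theorem IsGraphop.norm_le_numericalRadius {A : Lp ℝ 2 μ →L[ℝ] Lp ℝ 2 μ}
    (hA : IsGraphop A) : ‖A‖ ≤ numericalRadius A := by
  refine A.opNorm_le_bound hA.numericalRadius_nonneg fun f => ?_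
  set n := numericalRadius A
  have key : ∀ g : Lp ℝ 2 μ, inner ℝ (A f) g ≤ n * (‖f‖ ^ 2 + ‖g‖ ^ 2) / 2 := by
    intro g
    have h1 := (abs_le.1 (hA.abs_inner_le_numericalRadius (f + g))).2
    have h2 := (abs_le.1 (hA.abs_inner_le_numericalRadius (f - g))).1
    have h3 := parallelogram_law_with_norm ℝ f g
    have h4 : inner ℝ (A g) f = inner ℝ (A f) g := by
      rw [hA.inner_comm g f, real_inner_comm]
    simp only [map_sub, map_add, inner_sub_left, inner_sub_right, inner_add_left,
      inner_add_right, h4] at h1 h2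
    have h5 : n * ‖f + g‖ ^ 2 + n * ‖f - g‖ ^ 2 = 2 * (n * (‖f‖ ^ 2 + ‖g‖ ^ 2)) := by
      rw [← mul_add, h3]
      ring
    linarith
  rcases eq_or_ne (A f) 0 with h0 | h0
  · rw [h0, norm_zero]
    exact mul_nonneg hA.numericalRadius_nonneg (norm_nonneg _)
  have hf : f ≠ 0 := fun h => h0 (by rw [h, map_zero])
  have hr : 0 < ‖A f‖ := norm_pos_iff.2 h0
  have hs : 0 < ‖f‖ := norm_pos_iff.2 hf
  -- This multiple of A f has the norm of f, so both squares on the right coincide.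
  have h := key ((‖f‖ / ‖A f‖) • A f)
  rw [real_inner_smul_right, real_inner_self_eq_norm_sq, norm_smul, Real.norm_eq_abs,
    abs_of_pos (div_pos hs hr), div_mul_cancel₀ _ hr.ne'] at h
  have h1 : ‖f‖ / ‖A f‖ * ‖A f‖ ^ 2 = ‖f‖ * ‖A f‖ := by field_simp
  rw [h1] at h
  have h2 : ‖f‖ * ‖A f‖ ≤ ‖f‖ * (n * ‖f‖) := by
    calc _ ≤ _ := h
      _ = _ := by ring
  exact le_of_mul_le_mul_left h2 hs

theorem IsGraphop.abs_apply_le {A : Lp ℝ 2 μ →L[ℝ] Lp ℝ 2 μ} (hA : IsGraphop A)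
    (h : Lp ℝ 2 μ) : |A h| ≤ A |h| := by
  rw [abs_le', ← map_neg]
  constructor
  · rw [← sub_nonneg, ← map_sub]
    exact hA.nonneg _ (sub_nonneg.2 (le_abs_self h))
  · rw [← sub_nonneg, ← map_sub]
    exact hA.nonneg _ (sub_nonneg.2 (neg_le_abs h))

theorem lintegral_ofReal_mul_enorm_eq {φ h : Lp ℝ 2 μ} (hφ : 0 ≤ φ) :
    ∫⁻ ξ, ENNReal.ofReal (φ ξ) * ‖h ξ‖ₑ ∂μ = ENNReal.ofReal (inner ℝ φ |h|) := by
  rw [L2.inner_def, ofReal_integral_eq_lintegral_ofReal (L2.integrable_inner φ |h|)]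
  · refine lintegral_congr_ae ?_
    filter_upwards [(Lp.coeFn_nonneg φ).2 hφ, Lp.coeFn_abs h] with ξ h1 h2
    simp only [Pi.zero_apply] at h1
    simp only [RCLike.inner_apply, conj_trivial, h2]
    rw [ENNReal.ofReal_mul (abs_nonneg _), ← Real.enorm_eq_ofReal_abs, mul_comm]
  · filter_upwards [(Lp.coeFn_nonneg φ).2 hφ, Lp.coeFn_abs h] with ξ h1 h2
    simp only [Pi.zero_apply] at h1 ⊢
    simp only [RCLike.inner_apply, conj_trivial, h2]
    exact mul_nonneg (abs_nonneg _) h1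

/-- |Ah| ≤ A|h| by positivity; then A moves to φ by self-adjointness. -/
theorem IsGraphop.lintegral_mul_enorm_apply_le {A : Lp ℝ 2 μ →L[ℝ] Lp ℝ 2 μ} (hA : IsGraphop A)
    {φ : Lp ℝ 2 μ} (hφ : 0 ≤ φ) (h : Lp ℝ 2 μ) :
    ∫⁻ ξ, ENNReal.ofReal (φ ξ) * ‖A h ξ‖ₑ ∂μ ≤ ∫⁻ ξ, ENNReal.ofReal (A φ ξ) * ‖h ξ‖ₑ ∂μ := by
  rw [lintegral_ofReal_mul_enorm_eq hφ, lintegral_ofReal_mul_enorm_eq (hA.nonneg φ hφ),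
    hA.inner_comm]
  refine ENNReal.ofReal_le_ofReal ?_
  rw [← sub_nonneg, ← inner_sub_right]
  exact inner_nonneg_of_nonneg hφ (sub_nonneg.2 (hA.abs_apply_le h))

/-- The previous bound applies to the truncations minus c, whose images converge almost everywhere;
Fatou's lemma passes to the limit. In this dual form f need not be square integrable, and the right
side may be infinite. -/
theorem IsGraphop.lintegral_mul_enorm_sub_le [IsFiniteMeasure μ]
    {A : Lp ℝ 2 μ →L[ℝ] Lp ℝ 2 μ} (hA : IsGraphop A)
    {φ : Lp ℝ 2 μ} (hφ : 0 ≤ φ) {f g : Ω → ℝ} (hfg : ActsAs A f g) (c : ℝ) :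
    ∫⁻ ξ, ENNReal.ofReal (φ ξ) * ‖g ξ - c * A (Lp.const 2 μ 1) ξ‖ₑ ∂μ
      ≤ ∫⁻ ξ, ENNReal.ofReal (A φ ξ) * ‖f ξ - c‖ₑ ∂μ := by
  set one : Lp ℝ 2 μ := Lp.const 2 μ 1
  set h : ℕ → Lp ℝ 2 μ := fun n => clipLp μ f n - c • one with hh
  have hclip : ∀ n, (clipLp μ f n : Ω → ℝ) =ᵐ[μ] clip f n := by
    intro n
    rw [clipLp, dif_pos (memLp_clip hfg.1 n)]
    exact MemLp.coeFn_toLp _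
  have hAh : ∀ n, (A (h n) : Ω → ℝ) =ᵐ[μ] fun ξ => A (clipLp μ f n) ξ - c * A one ξ := by
    intro n
    simp only [hh, map_sub, map_smul]
    filter_upwards [Lp.coeFn_sub (A (clipLp μ f n)) (c • A one), Lp.coeFn_smul c (A one)]
      with ξ h1 h2
    rw [h1, Pi.sub_apply, h2]
    rfl
  have hhn : ∀ n, (h n : Ω → ℝ) =ᵐ[μ] fun ξ => clip f n ξ - c := by
    intro n
    filter_upwards [Lp.coeFn_sub (clipLp μ f n) (c • one), Lp.coeFn_smul c one, hclip n,
      Lp.coeFn_const 2 μ (1 : ℝ)] with ξ h1 h2 h3 h4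
    simp only [hh]
    rw [h1, Pi.sub_apply, h2, h3, Pi.smul_apply, h4]
    simp
  have hlim : ∀ᵐ ξ ∂μ, Tendsto (fun n => ENNReal.ofReal (φ ξ) * ‖A (h n) ξ‖ₑ) atTop
      (𝓝 (ENNReal.ofReal (φ ξ) * ‖g ξ - c * A one ξ‖ₑ)) := by
    filter_upwards [hfg.2, ae_all_iff.2 hAh] with ξ h1 h2
    simp_rw [h2]
    exact ENNReal.Tendsto.const_mul ((h1.sub_const _).enorm) (Or.inr ENNReal.ofReal_ne_top)
  calc ∫⁻ ξ, ENNReal.ofReal (φ ξ) * ‖g ξ - c * A one ξ‖ₑ ∂μ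
      = ∫⁻ ξ, liminf (fun n => ENNReal.ofReal (φ ξ) * ‖A (h n) ξ‖ₑ) atTop ∂μ := by
        refine lintegral_congr_ae ?_
        filter_upwards [hlim] with ξ hξ
        exact hξ.liminf_eq.symm
    _ ≤ liminf (fun n => ∫⁻ ξ, ENNReal.ofReal (φ ξ) * ‖A (h n) ξ‖ₑ ∂μ) atTop :=
        lintegral_liminf_le' fun n => ((Lp.aestronglyMeasurable φ).aemeasurable.ennreal_ofReal).mul
          (Lp.aestronglyMeasurable (A (h n))).enorm
    _ ≤ ∫⁻ ξ, ENNReal.ofReal (A φ ξ) * ‖f ξ - c‖ₑ ∂μ := by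
        refine liminf_le_of_le ?_ fun b hb => ?_
        · isBoundedDefault
        -- A truncation level beyond |c| makes |clip f n - c| ≤ |f - c| available.
        · obtain ⟨n, hn1, hn2⟩ := (hb.and (eventually_ge_atTop ⌈|c|⌉₊)).exists
          refine hn1.trans ((hA.lintegral_mul_enorm_apply_le hφ (h n)).trans
            (lintegral_mono_ae ?_))
          filter_upwards [hhn n] with ξ hξ
          rw [hξ]
          gcongr
          rw [Real.enorm_eq_ofReal_abs, Real.enorm_eq_ofReal_abs]
          exact ENNReal.ofReal_le_ofReal (abs_clip_sub_le (Nat.ceil_le.1 hn2) ξ)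

theorem lintegral_mul_le_sqrt_mul_sqrt {f g : Ω → ℝ≥0∞} (hf : AEMeasurable f μ)
    (hg : AEMeasurable g μ) :
    ∫⁻ ξ, f ξ * g ξ ∂μ
      ≤ (∫⁻ ξ, f ξ ^ 2 ∂μ) ^ (1 / 2 : ℝ) * (∫⁻ ξ, g ξ ^ 2 ∂μ) ^ (1 / 2 : ℝ) := by
  have h := ENNReal.lintegral_mul_le_Lp_mul_Lq μ Real.HolderConjugate.two_two hf hg
  simpa only [ENNReal.rpow_two, Pi.mul_apply] using h

theorem sqrt_lintegral_ofReal_sq_le (φ : Lp ℝ 2 μ) :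
    (∫⁻ ξ, ENNReal.ofReal (φ ξ) ^ 2 ∂μ) ^ (1 / 2 : ℝ) ≤ ‖φ‖ₑ := by
  rw [Lp.enorm_def, eLpNorm_eq_lintegral_rpow_enorm_toReal two_ne_zero ENNReal.ofNat_ne_top]
  simp only [ENNReal.toReal_ofNat, ENNReal.rpow_two]
  refine ENNReal.rpow_le_rpow (lintegral_mono fun ξ => ?_) (by norm_num)
  gcongr
  exact Real.ofReal_le_enorm _

theorem rpow_half_sq (x : ℝ≥0∞) : (x ^ (1 / 2 : ℝ)) ^ 2 = x := by
  rw [← ENNReal.rpow_two, ← ENNReal.rpow_mul]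
  norm_num

theorem le_sq_mul_of_le_sqrt {I J c : ℝ≥0∞} (hI : I ≠ ⊤)
    (h : I ≤ c * I ^ (1 / 2 : ℝ) * J ^ (1 / 2 : ℝ)) : I ≤ c ^ 2 * J := by
  rcases eq_or_ne I 0 with rfl | hI0
  · exact zero_le
  set x := I ^ (1 / 2 : ℝ) with hx
  have hx2 : x ^ 2 = I := rpow_half_sq I
  have hx0 : x ≠ 0 := fun h0 => hI0 (by rw [← hx2, h0]; simp)
  have hxt : x ≠ ⊤ := fun h0 => hI (by rw [← hx2, h0]; simp)
  rw [← hx2, sq, mul_comm c x, mul_assoc] at h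
  rw [ENNReal.mul_le_mul_iff_right hx0 hxt] at h
  calc I = x ^ 2 := hx2.symm
    _ ≤ (c * J ^ (1 / 2 : ℝ)) ^ 2 := by gcongr
    _ = c ^ 2 * J := by rw [mul_pow, rpow_half_sq]

/-- Duality: testing with φ = min(U, N) and Cauchy–Schwarz give I ≤ ‖A‖ I^{1/2} ‖w‖₂ for the
truncated square integral I. Truncation makes I finite, so I^{1/2} cancels; then N → ∞ by monotone
convergence. -/
theorem IsGraphop.lintegral_sq_le_of_forall [IsFiniteMeasure μ] {A : Lp ℝ 2 μ →L[ℝ] Lp ℝ 2 μ}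
    {U w : Ω → ℝ≥0∞} (hU : Measurable U) (hw : Measurable w)
    (h : ∀ φ : Lp ℝ 2 μ, 0 ≤ φ →
      ∫⁻ ξ, ENNReal.ofReal (φ ξ) * U ξ ∂μ ≤ ∫⁻ ξ, ENNReal.ofReal (A φ ξ) * w ξ ∂μ) :
    ∫⁻ ξ, U ξ ^ 2 ∂μ ≤ ‖A‖ₑ ^ 2 * ∫⁻ ξ, w ξ ^ 2 ∂μ := by
  have htrunc : ∀ N : ℕ, ∫⁻ ξ, (min (U ξ) N) ^ 2 ∂μ ≤ ‖A‖ₑ ^ 2 * ∫⁻ ξ, w ξ ^ 2 ∂μ := by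
    intro N
    have hfin : ∀ ξ, min (U ξ) (N : ℝ≥0∞) ≠ ⊤ := fun ξ =>
      ne_top_of_le_ne_top (ENNReal.natCast_ne_top N) (min_le_right _ _)
    have hm : Measurable fun ξ => min (U ξ) (N : ℝ≥0∞) := hU.min measurable_const
    have hmem : MemLp (fun ξ => (min (U ξ) (N : ℝ≥0∞)).toReal) 2 μ := by
      refine MemLp.of_bound hm.ennreal_toReal.aestronglyMeasurable N
        (Eventually.of_forall fun ξ => ?_)
      rw [Real.norm_eq_abs, abs_of_nonneg ENNReal.toReal_nonneg]
      exact ENNReal.toReal_mono (ENNReal.natCast_ne_top N) (min_le_right _ _)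
    set φ : Lp ℝ 2 μ := hmem.toLp _ with hφdef
    have hφ : (φ : Ω → ℝ) =ᵐ[μ] fun ξ => (min (U ξ) (N : ℝ≥0∞)).toReal := hmem.coeFn_toLp
    have hφ' : ∀ᵐ ξ ∂μ, ENNReal.ofReal (φ ξ) = min (U ξ) N := by
      filter_upwards [hφ] with ξ hξ
      rw [hξ, ENNReal.ofReal_toReal (hfin ξ)]
    have hφ0 : 0 ≤ φ := by
      rw [← Lp.coeFn_nonneg]
      filter_upwards [hφ] with ξ hξ
      rw [hξ]
      exact ENNReal.toReal_nonneg
    set I := ∫⁻ ξ, (min (U ξ) (N : ℝ≥0∞)) ^ 2 ∂μ with hI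
    have hIt : I ≠ ⊤ := by
      refine ne_top_of_le_ne_top (b := ∫⁻ _, (N : ℝ≥0∞) ^ 2 ∂μ) ?_
        (lintegral_mono fun ξ => by gcongr; exact min_le_right _ _)
      rw [lintegral_const]
      exact ENNReal.mul_ne_top (by simp) (measure_ne_top μ _)
    have hnorm : ‖φ‖ₑ = I ^ (1 / 2 : ℝ) := by
      rw [Lp.enorm_def, eLpNorm_congr_ae hφ,
        eLpNorm_eq_lintegral_rpow_enorm_toReal two_ne_zero ENNReal.ofNat_ne_top]
      simp only [ENNReal.toReal_ofNat, ENNReal.rpow_two]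
      congr 1
      refine lintegral_congr fun ξ => ?_
      rw [Real.enorm_eq_ofReal ENNReal.toReal_nonneg, ENNReal.ofReal_toReal (hfin ξ)]
    refine le_sq_mul_of_le_sqrt hIt ?_
    calc I ≤ ∫⁻ ξ, ENNReal.ofReal (φ ξ) * U ξ ∂μ := by
          refine lintegral_mono_ae ?_
          filter_upwards [hφ'] with ξ hξ
          rw [hξ, sq]
          gcongr
          exact min_le_left _ _
      _ ≤ ∫⁻ ξ, ENNReal.ofReal (A φ ξ) * w ξ ∂μ := h φ hφ0
      _ ≤ ‖A φ‖ₑ * (∫⁻ ξ, w ξ ^ 2 ∂μ) ^ (1 / 2 : ℝ) := by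
          refine (lintegral_mul_le_sqrt_mul_sqrt
            (Lp.aestronglyMeasurable (A φ)).aemeasurable.ennreal_ofReal hw.aemeasurable).trans ?_
          gcongr
          exact sqrt_lintegral_ofReal_sq_le (A φ)
      _ ≤ ‖A‖ₑ * I ^ (1 / 2 : ℝ) * (∫⁻ ξ, w ξ ^ 2 ∂μ) ^ (1 / 2 : ℝ) := by
          rw [← hnorm]
          gcongr
          exact A.le_opENorm φ
  have hsup : ∀ ξ, U ξ ^ 2 = ⨆ N : ℕ, (min (U ξ) (N : ℝ≥0∞)) ^ 2 := by
    intro ξ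
    refine le_antisymm ?_ (iSup_le fun N => by gcongr; exact min_le_left _ _)
    refine le_of_tendsto' (x := atTop) (f := fun N : ℕ => (min (U ξ) (N : ℝ≥0∞)) ^ 2) ?_
      fun N => le_iSup (fun N : ℕ => (min (U ξ) (N : ℝ≥0∞)) ^ 2) N
    have h1 : Tendsto (fun N : ℕ => min (U ξ) (N : ℝ≥0∞)) atTop (𝓝 (min (U ξ) ⊤)) :=
      tendsto_const_nhds.min ENNReal.tendsto_nat_nhds_top
    rw [min_top_right] at h1
    exact ((ENNReal.continuous_pow 2).tendsto _).comp h1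
  simp_rw [hsup]
  rw [lintegral_iSup (fun N => (hU.min measurable_const).pow_const 2)]
  · exact iSup_le htrunc
  · intro N M hNM ξ
    simp only
    gcongr

end Graphop

section Combined

variable {Ω₁ Ω₂ : Type*} [MeasurableSpace Ω₁] [MeasurableSpace Ω₂]
  {μ₁ : Measure Ω₁} {μ₂ : Measure Ω₂} [IsFiniteMeasure μ₁] [IsFiniteMeasure μ₂]

/-- A acts on L²(Ω; L¹(U)) with norm at most ‖A‖: the dual inequality holds for almost every x, and
Tonelli's theorem integrates it over U before the test function is chosen. -/
theorem IsGraphop.lintegral_mul_lintegral_box_le {Ω : Type*} [MeasurableSpace Ω] {μ : Measure Ω}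
    [IsFiniteMeasure μ] {A : Lp ℝ 2 μ →L[ℝ] Lp ℝ 2 μ} (hA : IsGraphop A) {d : ℕ} {L : ℝ}
    {F H : (Fin d → ℝ) → Ω → ℝ} (hF : Measurable (Function.uncurry F))
    (hH : Measurable (Function.uncurry H))
    (hact : ∀ᵐ x ∂(boxMeasure d L), ActsAs A (F x) (H x)) (c : ℝ) :
    ∫⁻ ξ, (∫⁻ x, ‖H x ξ - c * A (Lp.const 2 μ 1) ξ‖ₑ ∂(boxMeasure d L)) ^ 2 ∂μ
      ≤ ‖A‖ₑ ^ 2 * ∫⁻ ξ, (∫⁻ x, ‖F x ξ - c‖ₑ ∂(boxMeasure d L)) ^ 2 ∂μ := by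
  have ha : Measurable (A (Lp.const 2 μ 1) : Ω → ℝ) := (Lp.stronglyMeasurable _).measurable
  have hU : Measurable fun p : (Fin d → ℝ) × Ω =>
      ‖H p.1 p.2 - c * A (Lp.const 2 μ 1) p.2‖ₑ :=
    (hH.sub (measurable_const.mul (ha.comp measurable_snd))).enorm
  have hw : Measurable fun p : (Fin d → ℝ) × Ω => ‖F p.1 p.2 - c‖ₑ :=
    (hF.sub measurable_const).enorm
  refine IsGraphop.lintegral_sq_le_of_forall hU.lintegral_prod_left' hw.lintegral_prod_left' ?_
  intro φ hφ
  have hswap : ∀ (ψ : Lp ℝ 2 μ) {f : (Fin d → ℝ) × Ω → ℝ≥0∞}, Measurable f →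
      ∫⁻ ξ, ENNReal.ofReal (ψ ξ) * ∫⁻ x, f (x, ξ) ∂(boxMeasure d L) ∂μ
        = ∫⁻ x, ∫⁻ ξ, ENNReal.ofReal (ψ ξ) * f (x, ξ) ∂μ ∂(boxMeasure d L) := by
    intro ψ f hf
    have hψ : Measurable fun ξ => ENNReal.ofReal (ψ ξ) :=
      (Lp.stronglyMeasurable ψ).measurable.ennreal_ofReal
    rw [lintegral_lintegral_swap ((hψ.comp measurable_snd).mul hf).aemeasurable]
    refine lintegral_congr fun ξ => ?_
    rw [lintegral_const_mul]
    exact hf.comp (measurable_id.prodMk measurable_const)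
  rw [hswap φ hU, hswap (A φ) hw]
  refine lintegral_mono_ae ?_
  filter_upwards [hact] with x hx
  exact hA.lintegral_mul_enorm_sub_le hφ hx c

/-- One operator at a time, on slices. For fixed ξ₁ the operator A₂ turns the constant c into
c·A₂1(ξ₂); for fixed ξ₂ this is again a constant for A₁. -/
theorem CombinedActsAs.lintegral_sq_le {d : ℕ} {L : ℝ} {A₁ : Lp ℝ 2 μ₁ →L[ℝ] Lp ℝ 2 μ₁}
    {A₂ : Lp ℝ 2 μ₂ →L[ℝ] Lp ℝ 2 μ₂} (hA₁ : IsGraphop A₁) (hA₂ : IsGraphop A₂)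
    {F G : (Fin d → ℝ) → Ω₁ × Ω₂ → ℝ} (hF : Measurable (Function.uncurry F))
    (h : CombinedActsAs L A₁ A₂ F G) (c : ℝ) :
    ∫⁻ ξ, (∫⁻ x, ‖G x ξ - c * A₂ (Lp.const 2 μ₂ 1) ξ.2 * A₁ (Lp.const 2 μ₁ 1) ξ.1‖ₑ
        ∂(boxMeasure d L)) ^ 2 ∂(μ₁.prod μ₂)
      ≤ ‖A₁‖ₑ ^ 2 * (‖A₂‖ₑ ^ 2 *
        ∫⁻ ξ, (∫⁻ x, ‖F x ξ - c‖ₑ ∂(boxMeasure d L)) ^ 2 ∂(μ₁.prod μ₂)) := by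
  obtain ⟨H, hH, hG, h2, h1⟩ := h
  set a₁ : Ω₁ → ℝ := ⇑(A₁ (Lp.const 2 μ₁ 1))
  set a₂ : Ω₂ → ℝ := ⇑(A₂ (Lp.const 2 μ₂ 1))
  have ha₁ : Measurable a₁ := (Lp.stronglyMeasurable _).measurable
  have ha₂ : Measurable a₂ := (Lp.stronglyMeasurable _).measurable
  have mF : Measurable fun ξ => (∫⁻ x, ‖F x ξ - c‖ₑ ∂(boxMeasure d L)) ^ 2 :=
    ((hF.sub measurable_const).enorm.lintegral_prod_left').pow_const 2
  have mH : Measurable fun ξ : Ω₁ × Ω₂ =>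
      (∫⁻ x, ‖H x ξ - c * a₂ ξ.2‖ₑ ∂(boxMeasure d L)) ^ 2 :=
    ((hH.sub (measurable_const.mul (ha₂.comp
      (measurable_snd.comp measurable_snd)))).enorm.lintegral_prod_left').pow_const 2
  have mG : Measurable fun ξ : Ω₁ × Ω₂ =>
      (∫⁻ x, ‖G x ξ - c * a₂ ξ.2 * a₁ ξ.1‖ₑ ∂(boxMeasure d L)) ^ 2 :=
    ((hG.sub ((measurable_const.mul (ha₂.comp (measurable_snd.comp measurable_snd))).mul
      (ha₁.comp (measurable_fst.comp measurable_snd)))).enorm.lintegral_prod_left').pow_const 2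
  have h2' : ∀ᵐ ξ₁ ∂μ₁, ∀ᵐ x ∂(boxMeasure d L),
      ActsAs A₂ (fun ξ₂ => F x (ξ₁, ξ₂)) (fun ξ₂ => H x (ξ₁, ξ₂)) :=
    Measure.ae_ae_of_ae_prod (p := fun q : Ω₁ × (Fin d → ℝ) =>
      ActsAs A₂ (fun ξ₂ => F q.2 (q.1, ξ₂)) (fun ξ₂ => H q.2 (q.1, ξ₂)))
      (Measure.measurePreserving_swap.quasiMeasurePreserving.ae h2)
  have h1' : ∀ᵐ ξ₂ ∂μ₂, ∀ᵐ x ∂(boxMeasure d L),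
      ActsAs A₁ (fun ξ₁ => H x (ξ₁, ξ₂)) (fun ξ₁ => G x (ξ₁, ξ₂)) :=
    Measure.ae_ae_of_ae_prod (p := fun q : Ω₂ × (Fin d → ℝ) =>
      ActsAs A₁ (fun ξ₁ => H q.2 (ξ₁, q.1)) (fun ξ₁ => G q.2 (ξ₁, q.1)))
      (Measure.measurePreserving_swap.quasiMeasurePreserving.ae h1)
  have step2 : ∫⁻ ξ : Ω₁ × Ω₂, (∫⁻ x, ‖H x ξ - c * a₂ ξ.2‖ₑ ∂(boxMeasure d L)) ^ 2 ∂(μ₁.prod μ₂)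
      ≤ ‖A₂‖ₑ ^ 2 * ∫⁻ ξ, (∫⁻ x, ‖F x ξ - c‖ₑ ∂(boxMeasure d L)) ^ 2 ∂(μ₁.prod μ₂) := by
    rw [lintegral_prod _ mH.aemeasurable, lintegral_prod _ mF.aemeasurable,
      ← lintegral_const_mul _ mF.lintegral_prod_right']
    refine lintegral_mono_ae ?_
    filter_upwards [h2'] with ξ₁ hξ
    exact hA₂.lintegral_mul_lintegral_box_le (F := fun x ξ₂ => F x (ξ₁, ξ₂))
      (H := fun x ξ₂ => H x (ξ₁, ξ₂))
      (hF.comp (f := fun q : (Fin d → ℝ) × Ω₂ => (q.1, ξ₁, q.2)) (by fun_prop))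
      (hH.comp (f := fun q : (Fin d → ℝ) × Ω₂ => (q.1, ξ₁, q.2)) (by fun_prop)) hξ c
  refine le_trans ?_ (mul_le_mul_right step2 _)
  rw [lintegral_prod_symm _ mG.aemeasurable, lintegral_prod_symm _ mH.aemeasurable,
    ← lintegral_const_mul _ mH.lintegral_prod_left']
  refine lintegral_mono_ae ?_
  filter_upwards [h1'] with ξ₂ hξ
  exact hA₁.lintegral_mul_lintegral_box_le (F := fun x ξ₁ => H x (ξ₁, ξ₂))
    (H := fun x ξ₁ => G x (ξ₁, ξ₂))
    (hH.comp (f := fun q : (Fin d → ℝ) × Ω₁ => (q.1, q.2, ξ₂)) (by fun_prop))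
    (hG.comp (f := fun q : (Fin d → ℝ) × Ω₁ => (q.1, q.2, ξ₂)) (by fun_prop)) hξ (c * a₂ ξ₂)

end Combined

/-! ### Pinsker's inequality on the torus -/

/-- The difference f of the two sides has derivative 4g with g increasing and g(1) = 0, so f
decreases before 1, increases after 1, and f(1) = 0. -/
theorem three_mul_sub_one_sq_le {t : ℝ} (ht : 0 ≤ t) :
    3 * (t - 1) ^ 2 ≤ (2 * t + 4) * (t * Real.log t - t + 1) := by
  set g : ℝ → ℝ := fun s => (s + 1) * Real.log s - 2 * (s - 1) with hg
  set f : ℝ → ℝ := fun s => (2 * s + 4) * (s * Real.log s - s + 1) - 3 * (s - 1) ^ 2 with hf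
  have hgd : ∀ s, 0 < s → HasDerivAt g (Real.log s + s⁻¹ - 1) s := by
    intro s hs
    have h := (((hasDerivAt_id s).add_const 1).mul (Real.hasDerivAt_log hs.ne')).sub
      (((hasDerivAt_id s).sub_const 1).const_mul 2)
    refine h.congr_deriv ?_
    simp only [id]
    field_simp
    ring
  have hfd : ∀ s, 0 < s → HasDerivAt f (4 * g s) s := by
    intro s hs
    have h1 := ((hasDerivAt_id s).const_mul 2).add_const 4
    have h2 := (((hasDerivAt_id s).mul (Real.hasDerivAt_log hs.ne')).sub
      (hasDerivAt_id s)).add_const 1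
    have h3 := (((hasDerivAt_id s).sub_const 1).pow 2).const_mul 3
    have h := (h1.mul h2).sub h3
    refine h.congr_deriv ?_
    simp only [id, hg, Pi.mul_apply, Pi.sub_apply]
    field_simp
    ring
  have hgm : MonotoneOn g (Ioi 0) := by
    refine monotoneOn_of_deriv_nonneg (convex_Ioi 0)
      (fun s hs => (hgd s hs).continuousAt.continuousWithinAt) ?_ ?_
    · rw [interior_Ioi]
      exact fun s hs => (hgd s hs).differentiableAt.differentiableWithinAt
    · rw [interior_Ioi]
      intro s hs
      rw [(hgd s hs).deriv]
      linarith [Real.one_sub_inv_le_log_of_pos (mem_Ioi.1 hs)]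
  have hg1 : g 1 = 0 := by simp [hg]
  have hf1 : f 1 = 0 := by simp [hf]
  suffices h : 0 ≤ f t by simpa [hf, sub_nonneg] using h
  rcases ht.eq_or_lt with rfl | ht0
  · simp only [hf]
    norm_num
  rcases le_total t 1 with h1 | h1
  · have hanti : AntitoneOn f (Icc t 1) := by
      refine antitoneOn_of_deriv_nonpos (convex_Icc t 1)
        (fun s hs => (hfd s (ht0.trans_le hs.1)).continuousAt.continuousWithinAt) ?_ ?_
      · rw [interior_Icc]
        exact fun s hs => (hfd s (ht0.trans hs.1)).differentiableAt.differentiableWithinAt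
      · rw [interior_Icc]
        intro s hs
        rw [(hfd s (ht0.trans hs.1)).deriv]
        have := hgm (mem_Ioi.2 (ht0.trans hs.1)) (mem_Ioi.2 one_pos) hs.2.le
        linarith
    rw [← hf1]
    exact hanti ⟨le_rfl, h1⟩ ⟨h1, le_rfl⟩ h1
  · have hmono : MonotoneOn f (Icc 1 t) := by
      refine monotoneOn_of_deriv_nonneg (convex_Icc 1 t)
        (fun s hs => (hfd s (one_pos.trans_le hs.1)).continuousAt.continuousWithinAt) ?_ ?_
      · rw [interior_Icc]
        exact fun s hs => (hfd s (one_pos.trans hs.1)).differentiableAt.differentiableWithinAt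
      · rw [interior_Icc]
        intro s hs
        rw [(hfd s (one_pos.trans hs.1)).deriv]
        have := hgm (mem_Ioi.2 one_pos) (mem_Ioi.2 (one_pos.trans hs.1)) hs.1.le
        linarith
    rw [← hf1]
    exact hmono ⟨le_rfl, h1⟩ ⟨h1, le_rfl⟩ h1

theorem sub_one_le_mul_log {t : ℝ} (ht : 0 ≤ t) : t - 1 ≤ t * Real.log t := by
  have h := three_mul_sub_one_sq_le ht
  have h1 : 0 ≤ (2 * t + 4) * (t * Real.log t - t + 1) := le_trans (by positivity) h
  have := nonneg_of_mul_nonneg_right h1 (by linarith)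
  linarith

section Pinsker

variable {d : ℕ} {L : ℝ} {u : (Fin d → ℝ) → ℝ}

theorem rhoInf_pos (d : ℕ) (hL : 0 < L) : 0 < rhoInf d L := by
  unfold rhoInf; positivity

theorem sub_rhoInf_le_mul_log (d : ℕ) (hL : 0 < L) {s : ℝ} (hs : 0 ≤ s) :
    s - rhoInf d L ≤ s * Real.log (s / rhoInf d L) := by
  have hr := rhoInf_pos d hL
  have h := mul_le_mul_of_nonneg_left (sub_one_le_mul_log (div_nonneg hs hr.le)) hr.le
  rw [mul_sub, ← mul_assoc, mul_div_cancel₀ _ hr.ne', mul_one] at h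
  exact h

theorem integral_rhoInf (d : ℕ) (hL : 0 < L) : ∫ _, rhoInf d L ∂(boxMeasure d L) = 1 := by
  rw [integral_const_boxMeasure d hL, rhoInf, mul_one_div_cancel (pow_pos hL d).ne']

theorem continuous_mul_log_div_rhoInf (d : ℕ) (hL : 0 < L) :
    Continuous fun s => s * Real.log (s / rhoInf d L) := by
  simp_rw [mul_log_div_rhoInf d hL]
  exact Real.continuous_mul_log.sub (by fun_prop)

theorem integral_abs_sub_rhoInf_le_two (hL : 0 < L) (hu : Continuous u) (hnn : ∀ x, 0 ≤ u x)
    (hmass : ∫ x, u x ∂(boxMeasure d L) = 1) :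
    ∫ x, |u x - rhoInf d L| ∂(boxMeasure d L) ≤ 2 := by
  have hr := rhoInf_pos d hL
  calc ∫ x, |u x - rhoInf d L| ∂(boxMeasure d L)
      ≤ ∫ x, (u x + rhoInf d L) ∂(boxMeasure d L) := by
        refine integral_mono (integrable_boxMeasure (by fun_prop))
          (integrable_boxMeasure (by fun_prop)) fun x => ?_
        have := hnn x
        exact abs_le.2 ⟨by linarith, by linarith⟩
    _ = 2 := by
        rw [integral_add (integrable_boxMeasure hu) (integrable_const _), hmass,
          integral_rhoInf d hL]
        norm_num

/-- Pinsker's inequality. The pointwise bound at t = u/r, with r = ρ_∞, factors |u - r| as at most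
√p √q, where p = (2u + 4r)/3 has integral 2 and q integrates to the entropy; then Cauchy–Schwarz. -/
theorem sq_integral_abs_sub_rhoInf_le (hL : 0 < L) (hu : Continuous u) (hnn : ∀ x, 0 ≤ u x)
    (hmass : ∫ x, u x ∂(boxMeasure d L) = 1) :
    (∫ x, |u x - rhoInf d L| ∂(boxMeasure d L)) ^ 2
      ≤ 2 * ∫ x, u x * Real.log (u x / rhoInf d L) ∂(boxMeasure d L) := by
  have hr := rhoInf_pos d hL
  have hr1 := integral_rhoInf d hL
  set r := rhoInf d L
  have hlog : Continuous fun x => u x * Real.log (u x / r) :=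
    (continuous_mul_log_div_rhoInf d hL).comp hu
  set p : (Fin d → ℝ) → ℝ := fun x => (2 * u x + 4 * r) / 3 with hp
  set q : (Fin d → ℝ) → ℝ := fun x => u x * Real.log (u x / r) - u x + r with hq
  have hpc : Continuous p := by fun_prop
  have hqc : Continuous q := (hlog.sub hu).add continuous_const
  have hp0 : ∀ x, 0 ≤ p x := fun x => by have := hnn x; simp only [hp]; positivity
  have hq0 : ∀ x, 0 ≤ q x := fun x => by
    have := sub_rhoInf_le_mul_log d hL (hnn x)
    simp only [hq]
    linarith
  have hpt : ∀ x, |u x - r| ≤ Real.sqrt (p x) * Real.sqrt (q x) := by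
    intro x
    rw [← Real.sqrt_mul (hp0 x)]
    refine Real.abs_le_sqrt ?_
    have h := three_mul_sub_one_sq_le (div_nonneg (hnn x) hr.le)
    have h1 : (u x - r) ^ 2 = r ^ 2 / 3 * (3 * (u x / r - 1) ^ 2) := by field_simp
    have h2 : p x * q x
        = r ^ 2 / 3 * ((2 * (u x / r) + 4) * (u x / r * Real.log (u x / r) - u x / r + 1)) := by
      simp only [hp, hq]
      field_simp
    rw [h1, h2]
    exact mul_le_mul_of_nonneg_left h (by positivity)
  have hpi : ∫ x, Real.sqrt (p x) ^ 2 ∂(boxMeasure d L) = 2 := by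
    simp_rw [Real.sq_sqrt (hp0 _), hp]
    rw [integral_div, integral_add (integrable_boxMeasure (by fun_prop)) (integrable_const _),
      integral_const_mul, integral_const_mul, hmass, hr1]
    norm_num
  have hqi : ∫ x, Real.sqrt (q x) ^ 2 ∂(boxMeasure d L)
      = ∫ x, u x * Real.log (u x / r) ∂(boxMeasure d L) := by
    simp_rw [Real.sq_sqrt (hq0 _), hq]
    have hsub : Continuous fun x => u x * Real.log (u x / r) - u x := hlog.sub hu
    rw [integral_add (integrable_boxMeasure hsub) (integrable_const _),
      integral_sub (integrable_boxMeasure hlog) (integrable_boxMeasure hu), hmass, hr1]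
    ring
  calc (∫ x, |u x - r| ∂(boxMeasure d L)) ^ 2
      ≤ (∫ x, Real.sqrt (p x) * Real.sqrt (q x) ∂(boxMeasure d L)) ^ 2 := by
        refine pow_le_pow_left₀ (integral_nonneg fun _ => abs_nonneg _) ?_ 2
        exact integral_mono (integrable_boxMeasure (by fun_prop))
          (integrable_boxMeasure (by fun_prop)) hpt
    _ ≤ _ := sq_integral_mul_le (integrable_boxMeasure (by fun_prop))
        (integrable_boxMeasure (by fun_prop)) (integrable_boxMeasure (by fun_prop))
    _ = _ := by rw [hpi, hqi]

end Pinsker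

/-! ### From an integral inequality to exponential decay -/

/-- Implicit Euler: n + 1 equal steps give (1 + αt/(n+1))^(n+1) e(t) ≤ e(0), and n → ∞. Neither
continuity nor differentiability of e is needed. -/
theorem le_exp_mul_of_forall_one_add_mul_le {e : ℝ → ℝ} {α : ℝ} (hα : 0 ≤ α)
    (h : ∀ a b, 0 ≤ a → a ≤ b → (1 + α * (b - a)) * e b ≤ e a) {t : ℝ} (ht : 0 ≤ t) :
    e t ≤ Real.exp (-α * t) * e 0 := by
  have hpow : ∀ n : ℕ, (1 + α * t / (n + 1 : ℕ)) ^ (n + 1) * e t ≤ e 0 := by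
    intro n
    set δ := t / (n + 1 : ℕ) with hδ
    have hδ0 : 0 ≤ δ := by positivity
    have hk : ∀ k : ℕ, (1 + α * δ) ^ k * e (k * δ) ≤ e 0 := by
      intro k
      induction k with
      | zero => simp
      | succ k ih =>
        refine le_trans ?_ ih
        rw [pow_succ, mul_assoc]
        refine mul_le_mul_of_nonneg_left ?_ (by positivity)
        have := h (k * δ) ((k + 1 : ℕ) * δ) (by positivity)
          (mul_le_mul_of_nonneg_right (by push_cast; linarith) hδ0)
        rwa [← sub_mul, Nat.cast_succ, add_sub_cancel_left, one_mul, ← Nat.cast_succ] at this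
    have h1 := hk (n + 1)
    rw [hδ, mul_div_cancel₀ _ (by positivity : ((n + 1 : ℕ) : ℝ) ≠ 0), ← mul_div_assoc] at h1
    exact h1
  have hlim := ((Real.tendsto_one_add_div_pow_exp (α * t)).comp
    (tendsto_add_atTop_nat 1)).mul_const (e t)
  have := le_of_tendsto' hlim hpow
  rw [neg_mul, Real.exp_neg, ← div_eq_inv_mul, le_div_iff₀ (Real.exp_pos _), mul_comm]
  exact this

section Averaged

variable {Ω : Type*} [MeasurableSpace Ω] {P : Measure Ω}
  {h w W : ℝ → Ω → ℝ≥0∞} {lam k N α : ℝ≥0∞}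

theorem lintegral_mul_le_of_lintegral_sq_le {f g : Ω → ℝ≥0∞} (hf : Measurable f)
    (hg : Measurable g) (hfg : ∫⁻ ξ, g ξ ^ 2 ∂P ≤ N ^ 2 * ∫⁻ ξ, f ξ ^ 2 ∂P) :
    ∫⁻ ξ, f ξ * g ξ ∂P ≤ N * ∫⁻ ξ, f ξ ^ 2 ∂P := by
  refine (lintegral_mul_le_sqrt_mul_sqrt hf.aemeasurable hg.aemeasurable).trans ?_
  set I := ∫⁻ ξ, f ξ ^ 2 ∂P
  calc I ^ (1 / 2 : ℝ) * (∫⁻ ξ, g ξ ^ 2 ∂P) ^ (1 / 2 : ℝ)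
      ≤ I ^ (1 / 2 : ℝ) * (N ^ 2 * I) ^ (1 / 2 : ℝ) := by gcongr
    _ = N * (I ^ (1 / 2 : ℝ)) ^ 2 := by
        rw [ENNReal.mul_rpow_of_nonneg _ _ (by norm_num), ← ENNReal.rpow_two, ← ENNReal.rpow_mul]
        norm_num
        ring
    _ = N * I := by rw [rpow_half_sq]

/-- A family of nonnegative quantities `h(t, ξ)` that satisfy an integral inequality in `t` with a
coupling term `w W` controlled in mean square by `w`, and `w² ≤ 2 h`, decays on average. -/
theorem lintegral_toReal_le_exp_mul [IsProbabilityMeasure P] (mh : Measurable (Function.uncurry h))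
    (mw : Measurable (Function.uncurry w)) (mW : Measurable (Function.uncurry W))
    (hk : k ≠ ⊤) (hN : N ≠ ⊤) (hα : α ≠ ⊤) (hlam : α + k * (2 * N) = lam)
    (hw2 : ∀ᵐ ξ ∂P, ∀ t, 0 ≤ t → w t ξ ≤ 2)
    (hwh : ∀ᵐ ξ ∂P, ∀ t, 0 ≤ t → w t ξ ^ 2 ≤ 2 * h t ξ)
    (hWw : ∀ t, 0 < t → ∫⁻ ξ, W t ξ ^ 2 ∂P ≤ N ^ 2 * ∫⁻ ξ, w t ξ ^ 2 ∂P)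
    (hineq : ∀ᵐ ξ ∂P, ∀ a b, 0 ≤ a → a ≤ b → ∫⁻ t in Ioc a b, W t ξ ≠ ⊤ →
      h b ξ + lam * ∫⁻ t in Ioc a b, h t ξ ≤ h a ξ + k * ∫⁻ t in Ioc a b, w t ξ * W t ξ)
    (h0 : ∫⁻ ξ, h 0 ξ ∂P ≠ ⊤) {t : ℝ} (ht : 0 ≤ t) :
    ∫⁻ ξ, h t ξ ∂P ≠ ⊤ ∧
      (∫⁻ ξ, h t ξ ∂P).toReal ≤ Real.exp (-α.toReal * t) * (∫⁻ ξ, h 0 ξ ∂P).toReal := by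
  set E : ℝ → ℝ≥0∞ := fun t => ∫⁻ ξ, h t ξ ∂P with hE
  have mht : ∀ t, Measurable (h t) := fun t => mh.comp measurable_prodMk_left
  have mwt : ∀ t, Measurable (w t) := fun t => mw.comp measurable_prodMk_left
  have mWt : ∀ t, Measurable (W t) := fun t => mW.comp measurable_prodMk_left
  have hcoupling : ∀ t, 0 < t → ∫⁻ ξ, w t ξ * W t ξ ∂P ≤ 2 * N * E t := by
    intro t ht
    refine (lintegral_mul_le_of_lintegral_sq_le (mwt t) (mWt t) (hWw t ht)).trans ?_
    rw [mul_comm 2 N, mul_assoc]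
    gcongr
    rw [hE, ← lintegral_const_mul _ (mht t)]
    refine lintegral_mono_ae ?_
    filter_upwards [hwh] with ξ hξ using hξ t ht.le
  have hsq : ∀ t, 0 ≤ t → ∫⁻ ξ, w t ξ ^ 2 ∂P ≤ 4 := by
    intro t ht
    calc ∫⁻ ξ, w t ξ ^ 2 ∂P ≤ ∫⁻ _, 4 ∂P := by
          refine lintegral_mono_ae ?_
          filter_upwards [hw2] with ξ hξ
          calc w t ξ ^ 2 ≤ 2 ^ 2 := by gcongr; exact hξ t ht
            _ = 4 := by norm_num
      _ = 4 := by simp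
  have hWsq : ∀ t, 0 < t → ∫⁻ ξ, W t ξ ∂P ≤ 1 + N ^ 2 * 4 := by
    intro t ht
    calc ∫⁻ ξ, W t ξ ∂P ≤ ∫⁻ ξ, (1 + W t ξ ^ 2) ∂P := by
          refine lintegral_mono fun ξ => ?_
          rcases le_total (W t ξ) 1 with h1 | h1
          · exact h1.trans le_self_add
          · exact (le_self_pow h1 two_ne_zero).trans le_add_self
      _ = 1 + ∫⁻ ξ, W t ξ ^ 2 ∂P := by
          rw [lintegral_add_left measurable_const]
          simp
      _ ≤ 1 + N ^ 2 * 4 := by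
          gcongr
          exact (hWw t ht).trans (by gcongr; exact hsq t ht.le)
  have hC : 1 + N ^ 2 * 4 ≠ ⊤ := by finiteness
  have hIoc : ∀ {a b : ℝ} {f g : ℝ → ℝ≥0∞}, 0 ≤ a → (∀ t, 0 < t → f t ≤ g t) →
      ∫⁻ t in Ioc a b, f t ≤ ∫⁻ t in Ioc a b, g t := fun ha hfg =>
    setLIntegral_mono' measurableSet_Ioc fun t ht => hfg t (ha.trans_lt ht.1)
  -- The intervals (0, n] with n natural give a single null set valid for all a and b.
  have hWfin : ∀ᵐ ξ ∂P, ∀ a b : ℝ, 0 ≤ a → ∫⁻ t in Ioc a b, W t ξ ≠ ⊤ := by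
    have hn : ∀ n : ℕ, ∀ᵐ ξ ∂P, ∫⁻ t in Ioc (0 : ℝ) n, W t ξ < ⊤ := by
      intro n
      refine ae_lt_top (mW.comp measurable_swap).lintegral_prod_right' ?_
      rw [lintegral_lintegral_swap (f := fun ξ t => W t ξ) (mW.comp measurable_swap).aemeasurable]
      refine ne_top_of_le_ne_top (b := ∫⁻ _ in Ioc (0 : ℝ) n, (1 + N ^ 2 * 4)) ?_
        (hIoc le_rfl hWsq)
      rw [lintegral_const]
      exact ENNReal.mul_ne_top hC (by simp)
    filter_upwards [ae_all_iff.2 hn] with ξ hξ a b ha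
    refine ne_top_of_le_ne_top (hξ ⌈b⌉₊).ne (lintegral_mono_set ?_)
    exact Ioc_subset_Ioc ha (Nat.le_ceil b)
  have hint : ∀ a b, 0 ≤ a → a ≤ b →
      E b + lam * ∫⁻ t in Ioc a b, E t
        ≤ E a + k * ∫⁻ t in Ioc a b, ∫⁻ ξ, w t ξ * W t ξ ∂P := by
    intro a b ha hab
    have mI : Measurable fun ξ => ∫⁻ t in Ioc a b, h t ξ :=
      (mh.comp measurable_swap).lintegral_prod_right' (ν := volume.restrict (Ioc a b))
    have mJ : Measurable fun ξ => ∫⁻ t in Ioc a b, w t ξ * W t ξ :=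
      ((mw.mul mW).comp measurable_swap).lintegral_prod_right' (ν := volume.restrict (Ioc a b))
    have e1 : ∫⁻ t in Ioc a b, E t = ∫⁻ ξ, (∫⁻ t in Ioc a b, h t ξ) ∂P :=
      lintegral_lintegral_swap mh.aemeasurable
    have e2 : ∫⁻ t in Ioc a b, ∫⁻ ξ, w t ξ * W t ξ ∂P
        = ∫⁻ ξ, (∫⁻ t in Ioc a b, w t ξ * W t ξ) ∂P :=
      lintegral_lintegral_swap (mw.mul mW).aemeasurable
    rw [e1, e2, ← lintegral_const_mul _ mI, ← lintegral_const_mul _ mJ,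
      ← lintegral_add_left (mht b), ← lintegral_add_left (mht a)]
    refine lintegral_mono_ae ?_
    filter_upwards [hineq, hWfin] with ξ h1 h2 using h1 a b ha hab (h2 a b ha)
  -- A crude bound using w ≤ 2 instead of w² ≤ 2h. Its purpose is finiteness of E, without which the
  -- coupling could not be cancelled.
  have hEb : ∀ b, 0 ≤ b → E b ≤ E 0 + k * ∫⁻ _ in Ioc (0 : ℝ) b, 2 * (1 + N ^ 2 * 4) := by
    intro b hb
    refine le_self_add.trans ((hint 0 b le_rfl hb).trans ?_)
    gcongr E 0 + k * ?_
    refine hIoc le_rfl fun t ht => ?_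
    calc ∫⁻ ξ, w t ξ * W t ξ ∂P ≤ ∫⁻ ξ, 2 * W t ξ ∂P := by
          refine lintegral_mono_ae ?_
          filter_upwards [hw2] with ξ hξ
          gcongr
          exact hξ t ht.le
      _ ≤ 2 * (1 + N ^ 2 * 4) := by
          rw [lintegral_const_mul _ (mWt t)]
          gcongr
          exact hWsq t ht
  have hEfin' : ∀ b, 0 ≤ b → E 0 + k * ∫⁻ _ in Ioc (0 : ℝ) b, 2 * (1 + N ^ 2 * 4) ≠ ⊤ := by
    intro b hb
    rw [lintegral_const]
    refine ENNReal.add_ne_top.2 ⟨h0, ENNReal.mul_ne_top hk (ENNReal.mul_ne_top ?_ (by simp))⟩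
    exact ENNReal.mul_ne_top (by simp) hC
  have hEfin : ∀ b, 0 ≤ b → E b ≠ ⊤ := fun b hb => ne_top_of_le_ne_top (hEfin' b hb) (hEb b hb)
  have hmain : ∀ a b, 0 ≤ a → a ≤ b → E b + α * ∫⁻ t in Ioc a b, E t ≤ E a := by
    intro a b ha hab
    have hJ : ∫⁻ t in Ioc a b, E t ≠ ⊤ := by
      refine ne_top_of_le_ne_top (b := ∫⁻ _ in Ioc a b,
        (E 0 + k * ∫⁻ _ in Ioc (0 : ℝ) b, 2 * (1 + N ^ 2 * 4))) ?_ ?_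
      · rw [lintegral_const]
        exact ENNReal.mul_ne_top (hEfin' b (ha.trans hab)) (by simp)
      · refine setLIntegral_mono' measurableSet_Ioc fun t ht => ?_
        refine (hEb t (ha.trans ht.1.le)).trans ?_
        gcongr
        exact ht.2
    have h1 := hint a b ha hab
    have h2 : ∫⁻ t in Ioc a b, ∫⁻ ξ, w t ξ * W t ξ ∂P ≤ 2 * N * ∫⁻ t in Ioc a b, E t := by
      have mE : Measurable E := mh.lintegral_prod_right'
      rw [← lintegral_const_mul _ mE]
      exact hIoc ha hcoupling
    set J := ∫⁻ t in Ioc a b, E t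
    -- The coupling is matched exactly by the share k·2N of lam, and cancels because J is finite.
    have h3 : (E b + α * J) + k * (2 * N) * J ≤ E a + k * (2 * N) * J := by
      calc (E b + α * J) + k * (2 * N) * J = E b + lam * J := by rw [← hlam]; ring
        _ ≤ _ := h1
        _ ≤ E a + k * (2 * N * J) := by gcongr
        _ = _ := by ring
    exact (ENNReal.add_le_add_iff_right (by finiteness)).1 h3
  refine ⟨hEfin t ht, ?_⟩
  refine le_exp_mul_of_forall_one_add_mul_le (e := fun t => (E t).toReal)
    ENNReal.toReal_nonneg (fun a b ha hab => ?_) ht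
  -- E is nonincreasing, so its integral over (a, b] is at least (b - a) E(b), which is the Euler
  -- step.
  have hanti : ∀ s ∈ Ioc a b, E b ≤ E s := fun s hs =>
    le_self_add.trans (hmain s b (ha.trans hs.1.le) hs.2)
  have h1 : E b + α * (E b * ENNReal.ofReal (b - a)) ≤ E a := by
    refine le_trans ?_ (hmain a b ha hab)
    gcongr
    calc E b * ENNReal.ofReal (b - a) = ∫⁻ _ in Ioc a b, E b := by simp
      _ ≤ _ := setLIntegral_mono' measurableSet_Ioc hanti
  have hb := hEfin b (ha.trans hab)
  have h2 := ENNReal.toReal_mono (hEfin a ha) h1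
  rw [ENNReal.toReal_add hb (by finiteness), ENNReal.toReal_mul, ENNReal.toReal_mul,
    ENNReal.toReal_ofReal (sub_nonneg.2 hab)] at h2
  calc (1 + α.toReal * (b - a)) * (E b).toReal
      = (E b).toReal + α.toReal * ((E b).toReal * (b - a)) := by ring
    _ ≤ _ := h2

end Averaged

/-! ### Entropy dissipation for almost every network variable -/

section Single

variable {d : ℕ} {L κ : ℝ} {D : (Fin d → ℝ) → ℝ} {g u : ℝ → (Fin d → ℝ) → ℝ}

/-- The relative entropy `∫_U u log (u / ρ_∞) dx` of a single density. -/
noncomputable def boxEntropy {d : ℕ} (L : ℝ) (u : (Fin d → ℝ) → ℝ) : ℝ :=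
  ∫ x, u x * Real.log (u x / rhoInf d L) ∂(boxMeasure d L)

theorem boxEntropy_nonneg (hL : 0 < L) {u : (Fin d → ℝ) → ℝ} (hu : Continuous u)
    (hnn : ∀ x, 0 ≤ u x) (hmass : ∫ x, u x ∂(boxMeasure d L) = 1) : 0 ≤ boxEntropy L u := by
  have h := sq_integral_abs_sub_rhoInf_le hL hu hnn hmass
  have := sq_nonneg (∫ x, |u x - rhoInf d L| ∂(boxMeasure d L))
  unfold boxEntropy
  linarith

theorem lintegral_enorm_eq_ofReal {f : (Fin d → ℝ) → ℝ} (hf : Integrable f (boxMeasure d L)) :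
    ∫⁻ x, ‖f x‖ₑ ∂(boxMeasure d L) = ENNReal.ofReal (∫ x, |f x| ∂(boxMeasure d L)) := by
  rw [← ofReal_integral_norm_eq_lintegral_enorm hf]
  rfl

theorem lintegral_enorm_sub_rhoInf_le_two (hL : 0 < L) {u : (Fin d → ℝ) → ℝ} (hu : Continuous u)
    (hnn : ∀ x, 0 ≤ u x) (hmass : ∫ x, u x ∂(boxMeasure d L) = 1) :
    ∫⁻ x, ‖u x - rhoInf d L‖ₑ ∂(boxMeasure d L) ≤ 2 := by
  rw [lintegral_enorm_eq_ofReal (integrable_boxMeasure (by fun_prop))]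
  exact ENNReal.ofReal_le_of_le_toReal (by
    simpa using integral_abs_sub_rhoInf_le_two hL hu hnn hmass)

theorem sq_lintegral_enorm_sub_rhoInf_le (hL : 0 < L) {u : (Fin d → ℝ) → ℝ} (hu : Continuous u)
    (hnn : ∀ x, 0 ≤ u x) (hmass : ∫ x, u x ∂(boxMeasure d L) = 1) :
    (∫⁻ x, ‖u x - rhoInf d L‖ₑ ∂(boxMeasure d L)) ^ 2 ≤ 2 * ENNReal.ofReal (boxEntropy L u) := by
  rw [lintegral_enorm_eq_ofReal (integrable_boxMeasure (by fun_prop)),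
    ← ENNReal.ofReal_pow (integral_nonneg fun _ => abs_nonneg _)]
  calc _ ≤ ENNReal.ofReal (2 * boxEntropy L u) :=
        ENNReal.ofReal_le_ofReal (sq_integral_abs_sub_rhoInf_le hL hu hnn hmass)
    _ = _ := by rw [ENNReal.ofReal_mul two_pos.le, ENNReal.ofReal_ofNat]

/-- Since s log(s/ρ_∞) ≥ s - ρ_∞ ≥ -ρ_∞, the absolute value exceeds the integrand by at most 2ρ_∞,
whose integral is 2. A finite averaged entropy therefore gives absolute integrability over U × Ω. -/
theorem lintegral_enorm_mul_log_le (hL : 0 < L) {u : (Fin d → ℝ) → ℝ} (hu : Continuous u)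
    (hnn : ∀ x, 0 ≤ u x) :
    ∫⁻ x, ‖u x * Real.log (u x / rhoInf d L)‖ₑ ∂(boxMeasure d L)
      ≤ ENNReal.ofReal (boxEntropy L u) + 2 := by
  have hr := rhoInf_pos d hL
  have hlog : Continuous fun x => u x * Real.log (u x / rhoInf d L) :=
    (continuous_mul_log_div_rhoInf d hL).comp hu
  rw [lintegral_enorm_eq_ofReal (integrable_boxMeasure hlog)]
  calc _ ≤ ENNReal.ofReal (∫ x, (u x * Real.log (u x / rhoInf d L) + 2 * rhoInf d L)
          ∂(boxMeasure d L)) := by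
        refine ENNReal.ofReal_le_ofReal (integral_mono (integrable_boxMeasure hlog.abs)
          (integrable_boxMeasure (hlog.add continuous_const)) fun x => ?_)
        have h1 := sub_rhoInf_le_mul_log d hL (hnn x)
        have h2 := hnn x
        exact abs_le.2 ⟨by linarith, by linarith⟩
    _ = ENNReal.ofReal (boxEntropy L u + 2) := by
        rw [integral_add (integrable_boxMeasure hlog) (integrable_const _), integral_const_mul,
          integral_rhoInf d hL, mul_one]
        rfl
    _ ≤ _ := by
        refine ENNReal.ofReal_add_le.trans ?_
        rw [ENNReal.ofReal_ofNat]

theorem IsDensitySolution.lintegral_entropy_inequality (h : IsDensitySolution L κ D g u)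
    (hL : 0 < L) (hκ : 0 < κ) (hD : MemSobolev L ∞ 2 D) (hnn : ∀ t, 0 ≤ t → ∀ x, 0 ≤ u t x)
    (hmass : ∀ t, 0 ≤ t → ∫ x, u t x ∂(boxMeasure d L) = 1)
    (hg : Measurable (Function.uncurry g)) {a b : ℝ} (ha : 0 ≤ a) (hab : a ≤ b) (c : ℝ)
    (hW : ∫⁻ t in Ioc a b, ∫⁻ y, ‖g t y - c‖ₑ ∂(boxMeasure d L) ≠ ⊤) :
    ENNReal.ofReal (boxEntropy L (u b))
        + ENNReal.ofReal (4 * Real.pi ^ 2 / L ^ 2)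
          * ∫⁻ t in Ioc a b, ENNReal.ofReal (boxEntropy L (u t))
      ≤ ENNReal.ofReal (boxEntropy L (u a)) + ENNReal.ofReal (κ * laplacianNorm L D)
          * ∫⁻ t in Ioc a b, (∫⁻ x, ‖u t x - rhoInf d L‖ₑ ∂(boxMeasure d L))
            * ∫⁻ y, ‖g t y - c‖ₑ ∂(boxMeasure d L) := by
  have hcont : ∀ t, 0 ≤ t → Continuous (u t) := fun t ht => h.classical.continuous_slice ht
  have hent : ∀ t, 0 ≤ t → 0 ≤ boxEntropy L (u t) := fun t ht =>
    boxEntropy_nonneg hL (hcont t ht) (hnn t ht) (hmass t ht)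
  have mW : Measurable fun t => ∫⁻ y, ‖g t y - c‖ₑ ∂(boxMeasure d L) :=
    (hg.sub measurable_const).enorm.lintegral_prod_right'
  have hWreal : ∀ t, ∫ y, |g t y - c| ∂(boxMeasure d L)
      = (∫⁻ y, ‖g t y - c‖ₑ ∂(boxMeasure d L)).toReal := fun t =>
    integral_norm_eq_lintegral_enorm
      ((hg.comp measurable_prodMk_left).sub measurable_const).aestronglyMeasurable
  have hWint : IntegrableOn (fun t => ∫ y, |g t y - c| ∂(boxMeasure d L)) (Icc a b) := by
    rw [integrableOn_Icc_iff_integrableOn_Ioc]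
    simp_rw [hWreal]
    exact integrable_toReal_of_lintegral_ne_top mW.aemeasurable hW
  have key := h.entropy_inequality hL hκ hD hnn hmass ha hab (fun _ => c) hWint
  have hentc : Continuous fun t => boxEntropy L (u (max t 0)) := by
    refine continuous_integral_box (f := fun t x => u (max t 0) x *
      Real.log (u (max t 0) x / rhoInf d L)) ?_
    exact (continuous_mul_log_div_rhoInf d hL).comp h.classical.continuous_extend
  have hwc : Continuous fun t => ∫ x, |u (max t 0) x - rhoInf d L| ∂(boxMeasure d L) :=
    continuous_integral_box (f := fun t x => |u (max t 0) x - rhoInf d L|)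
      (h.classical.continuous_extend.sub continuous_const).abs
  have hpos : ∀ t ∈ Ioc a b, 0 < t := fun t ht => ha.trans_lt ht.1
  have hentint : IntegrableOn (fun t => boxEntropy L (u t)) (Ioc a b) := by
    refine (hentc.integrableOn_Ioc).congr_fun (fun t ht => ?_) measurableSet_Ioc
    simp only [max_eq_left (hpos t ht).le]
  have hwW : IntegrableOn (fun t => (∫ x, |u t x - rhoInf d L| ∂(boxMeasure d L))
      * ∫ y, |g t y - c| ∂(boxMeasure d L)) (Ioc a b) := by
    refine IntegrableOn.mono_set ?_ Ioc_subset_Icc_self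
    refine hWint.continuousOn_mul (hwc.continuousOn.congr fun t ht => ?_) isCompact_Icc
    simp only [max_eq_left (ha.trans ht.1)]
  have e1 : ∫⁻ t in Ioc a b, ENNReal.ofReal (boxEntropy L (u t))
      = ENNReal.ofReal (∫ t in a..b, boxEntropy L (u t)) := by
    rw [intervalIntegral.integral_of_le hab, ofReal_integral_eq_lintegral_ofReal hentint]
    exact (ae_restrict_iff' measurableSet_Ioc).2
      (Eventually.of_forall fun t ht => hent t (hpos t ht).le)
  have e2 : ∫⁻ t in Ioc a b, (∫⁻ x, ‖u t x - rhoInf d L‖ₑ ∂(boxMeasure d L))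
        * ∫⁻ y, ‖g t y - c‖ₑ ∂(boxMeasure d L)
      = ENNReal.ofReal (∫ t in a..b, (∫ x, |u t x - rhoInf d L| ∂(boxMeasure d L))
        * ∫ y, |g t y - c| ∂(boxMeasure d L)) := by
    rw [intervalIntegral.integral_of_le hab, ofReal_integral_eq_lintegral_ofReal hwW
      (Eventually.of_forall fun t => mul_nonneg (integral_nonneg fun _ => abs_nonneg _)
        (integral_nonneg fun _ => abs_nonneg _))]
    refine setLIntegral_congr_fun measurableSet_Ioc fun t ht => ?_
    have i1 : Integrable (fun x => u t x - rhoInf d L) (boxMeasure d L) :=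
      integrable_boxMeasure ((hcont t (hpos t ht).le).sub continuous_const)
    have i2 : Integrable (fun y => g t y - c) (boxMeasure d L) :=
      (h.integrable t (hpos t ht)).sub (integrable_const c)
    rw [lintegral_enorm_eq_ofReal i1, lintegral_enorm_eq_ofReal i2,
      ENNReal.ofReal_mul (integral_nonneg fun _ => abs_nonneg _)]
  have hI : 0 ≤ ∫ t in a..b, boxEntropy L (u t) :=
    intervalIntegral.integral_nonneg hab fun t ht => hent t (ha.trans ht.1)
  have hk : 0 ≤ κ * laplacianNorm L D := mul_nonneg hκ.le (laplacianNorm_nonneg L D)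
  have hJ : 0 ≤ ∫ t in a..b, (∫ x, |u t x - rhoInf d L| ∂(boxMeasure d L))
      * ∫ y, |g t y - c| ∂(boxMeasure d L) :=
    intervalIntegral.integral_nonneg hab fun t _ => mul_nonneg
      (integral_nonneg fun _ => abs_nonneg _) (integral_nonneg fun _ => abs_nonneg _)
  rw [e1, e2, ← ENNReal.ofReal_mul (by positivity), ← ENNReal.ofReal_mul hk,
    ← ENNReal.ofReal_add (hent b (ha.trans hab)) (by positivity),
    ← ENNReal.ofReal_add (hent a ha) (mul_nonneg hk hJ)]
  exact ENNReal.ofReal_le_ofReal key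

end Single

/-! ### Solutions on the network -/

section Network

variable {Ω₁ Ω₂ : Type*} [MeasurableSpace Ω₁] [MeasurableSpace Ω₂]
  {μ₁ : Measure Ω₁} {μ₂ : Measure Ω₂} [IsProbabilityMeasure μ₁] [IsProbabilityMeasure μ₂]
  {d : ℕ} {L κ : ℝ} {D : (Fin d → ℝ) → ℝ}
  {A₁ : Lp ℝ 2 μ₁ →L[ℝ] Lp ℝ 2 μ₁} {A₂ : Lp ℝ 2 μ₂ →L[ℝ] Lp ℝ 2 μ₂}

theorem CombinedActsAs.lintegral_sq_le_numericalRadius (hA₁ : IsGraphop A₁) (hA₂ : IsGraphop A₂)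
    {F G : (Fin d → ℝ) → Ω₁ × Ω₂ → ℝ} (hF : Measurable (Function.uncurry F))
    (h : CombinedActsAs L A₁ A₂ F G) (c : ℝ) :
    ∫⁻ ξ, (∫⁻ x, ‖G x ξ - c * A₂ (Lp.const 2 μ₂ 1) ξ.2 * A₁ (Lp.const 2 μ₁ 1) ξ.1‖ₑ
        ∂(boxMeasure d L)) ^ 2 ∂(μ₁.prod μ₂)
      ≤ ENNReal.ofReal (numericalRadius A₁ * numericalRadius A₂) ^ 2 *
        ∫⁻ ξ, (∫⁻ x, ‖F x ξ - c‖ₑ ∂(boxMeasure d L)) ^ 2 ∂(μ₁.prod μ₂) := by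
  refine (h.lintegral_sq_le hA₁ hA₂ hF c).trans ?_
  rw [ENNReal.ofReal_mul hA₁.numericalRadius_nonneg, mul_pow, mul_assoc]
  gcongr
  · rw [← ofReal_norm]
    exact ENNReal.ofReal_le_ofReal hA₁.norm_le_numericalRadius
  · rw [← ofReal_norm]
    exact ENNReal.ofReal_le_ofReal hA₂.norm_le_numericalRadius

theorem decayRate_pos (hL : 0 < L) {n : ℝ}
    (h : κ * (L ^ 2 * laplacianNorm L D * n) < 2 * Real.pi ^ 2) : 0 < decayRate L κ D n := by
  have h1 : decayRate L κ D n
      = 2 / L ^ 2 * (2 * Real.pi ^ 2 - κ * (L ^ 2 * laplacianNorm L D * n)) := by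
    unfold decayRate
    field_simp
    ring
  rw [h1]
  exact mul_pos (by positivity) (sub_pos.2 h)

theorem relEntropy_eq_toReal {Ω : Type*} [MeasurableSpace Ω] {P : Measure Ω}
    {F : (Fin d → ℝ) → Ω → ℝ} (mF : Measurable (Function.uncurry F))
    (hnn : ∀ᵐ ξ ∂P, 0 ≤ boxEntropy L (fun x => F x ξ)) :
    relEntropy L P F = (∫⁻ ξ, ENNReal.ofReal (boxEntropy L fun x => F x ξ) ∂P).toReal := by
  refine integral_eq_lintegral_of_nonneg_ae hnn (StronglyMeasurable.aestronglyMeasurable ?_)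
  exact StronglyMeasurable.integral_prod_left
    (f := fun x ξ => F x ξ * Real.log (F x ξ / rhoInf d L))
    (mF.mul (Real.measurable_log.comp (mF.div_const _))).stronglyMeasurable

theorem finiteEntropy_of_lintegral_ne_top {Ω : Type*} [MeasurableSpace Ω] {P : Measure Ω}
    [IsFiniteMeasure P] (hL : 0 < L) {F : (Fin d → ℝ) → Ω → ℝ}
    (mF : Measurable (Function.uncurry F)) (hcont : ∀ᵐ ξ ∂P, Continuous fun x => F x ξ)
    (hnn : ∀ᵐ ξ ∂P, ∀ x, 0 ≤ F x ξ)
    (h : ∫⁻ ξ, ENNReal.ofReal (boxEntropy L fun x => F x ξ) ∂P ≠ ⊤) : FiniteEntropy L P F := by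
  have m : Measurable fun p : (Fin d → ℝ) × Ω =>
      F p.1 p.2 * Real.log (F p.1 p.2 / rhoInf d L) :=
    mF.mul (Real.measurable_log.comp (mF.div_const _))
  refine ⟨m.aestronglyMeasurable, ?_⟩
  rw [HasFiniteIntegral, lintegral_prod_symm _ m.enorm.aemeasurable]
  calc _ ≤ ∫⁻ ξ, (ENNReal.ofReal (boxEntropy L fun x => F x ξ) + 2) ∂P := by
        refine lintegral_mono_ae ?_
        filter_upwards [hcont, hnn] with ξ h1 h2 using lintegral_enorm_mul_log_le hL h1 h2
    _ < ⊤ := by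
        rw [lintegral_add_right _ measurable_const, lintegral_const]
        have := measure_ne_top P univ
        exact ENNReal.add_lt_top.2 ⟨h.lt_top, by finiteness⟩

end Network

end GraphopMV

/-! ### Exponential decay of the averaged entropy -/

open GraphopMV

theorem lemma4p1 {Ω₁ Ω₂ : Type*} [MeasurableSpace Ω₁] [MeasurableSpace Ω₂]
    (μ₁ : Measure Ω₁) (μ₂ : Measure Ω₂) [IsProbabilityMeasure μ₁] [IsProbabilityMeasure μ₂]
    (d : ℕ) (L κ : ℝ) (hL : 0 < L) (hκ : 0 < κ)
    (D : (Fin d → ℝ) → ℝ) (hD : MemSobolev L ∞ 2 D)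
    (A₁ : Lp ℝ 2 μ₁ →L[ℝ] Lp ℝ 2 μ₁) (A₂ : Lp ℝ 2 μ₂ →L[ℝ] Lp ℝ 2 μ₂)
    (hA₁ : IsGraphop A₁) (hA₂ : IsGraphop A₂)
    (ρ₀ : (Fin d → ℝ) → Ω₁ × Ω₂ → ℝ)
    (hρ₀ : IsAdmissible L (μ₁.prod μ₂) ρ₀)
    (hH₀ : FiniteEntropy L (μ₁.prod μ₂) ρ₀)
    (hκ_small : κ * (L ^ 2 * laplacianNorm L D * (numericalRadius A₁ * numericalRadius A₂))
      < 2 * Real.pi ^ 2)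
    (ρ : ℝ → (Fin d → ℝ) → Ω₁ × Ω₂ → ℝ)
    (hρ : IsSolution L κ D A₁ A₂ ρ₀ ρ) :
    0 < decayRate L κ D (numericalRadius A₁ * numericalRadius A₂) ∧
    ∀ t : ℝ, 0 ≤ t →
      FiniteEntropy L (μ₁.prod μ₂) (ρ t) ∧
      relEntropy L (μ₁.prod μ₂) (ρ t)
        ≤ Real.exp (-decayRate L κ D (numericalRadius A₁ * numericalRadius A₂) * t)
          * relEntropy L (μ₁.prod μ₂) ρ₀ := by
  have hα := decayRate_pos hL hκ_small
  refine ⟨hα, fun t ht => ?_⟩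
  obtain ⟨mρ, hcl, hinit, g, mg, hact, hgint, heq⟩ := hρ
  set P := μ₁.prod μ₂
  set n := numericalRadius A₁ * numericalRadius A₂ with hn
  have hn0 : 0 ≤ n := mul_nonneg hA₁.numericalRadius_nonneg hA₂.numericalRadius_nonneg
  -- Sign and mass are known only for ρ₀, which agrees with ρ(0) almost everywhere in x; the
  -- equation propagates both to all later times.
  have hgood : ∀ᵐ ξ ∂P, IsDensitySolution L κ D (fun t x => g t x ξ) (fun t x => ρ t x ξ)
      ∧ (∀ t, 0 ≤ t → Continuous fun x => ρ t x ξ) ∧ (∀ t, 0 ≤ t → ∀ x, 0 ≤ ρ t x ξ)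
      ∧ ∀ t, 0 ≤ t → ∫ x, ρ t x ξ ∂(boxMeasure d L) = 1 := by
    filter_upwards [hcl, hinit, hgint, heq, hρ₀.density] with ξ h1 h2 h3 h4 h5
    have hsol : IsDensitySolution L κ D (fun t x => g t x ξ) (fun t x => ρ t x ξ) :=
      ⟨h1, h3, h4⟩
    refine ⟨hsol, fun t ht => h1.continuous_slice ht,
      fun t ht x => hsol.nonneg hL hκ hD ?_ ht x, fun t ht => ?_⟩
    · filter_upwards [h2, h5.1] with x e1 e2
      rw [e1]
      exact e2
    · rw [hsol.integral_eq hL hD ht, integral_congr_ae h2]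
      exact h5.2.2
  have hent : ∀ᵐ ξ ∂P, ∀ t, 0 ≤ t → 0 ≤ boxEntropy L fun x => ρ t x ξ := by
    filter_upwards [hgood] with ξ hξ t ht
    exact boxEntropy_nonneg hL (hξ.2.1 t ht) (hξ.2.2.1 t ht) (hξ.2.2.2 t ht)
  have mρt : ∀ t, Measurable (Function.uncurry (ρ t)) := fun t =>
    mρ.comp (measurable_prodMk_left (x := t))
  have hinit' : ∀ᵐ ξ ∂P, boxEntropy L (fun x => ρ 0 x ξ) = boxEntropy L fun x => ρ₀ x ξ := by
    filter_upwards [hinit] with ξ hξ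
    refine integral_congr_ae ?_
    filter_upwards [hξ] with x hx
    rw [hx]
  have hrel0 : relEntropy L P (ρ 0) = relEntropy L P ρ₀ := integral_congr_ae hinit'
  have hE0 : ∫⁻ ξ, ENNReal.ofReal (boxEntropy L fun x => ρ 0 x ξ) ∂P ≠ ⊤ := by
    have hint : Integrable (fun ξ => boxEntropy L fun x => ρ 0 x ξ) P :=
      (Integrable.integral_prod_right hH₀).congr (hinit'.mono fun ξ hξ => hξ.symm)
    exact ((lintegral_ofReal_le_lintegral_enorm _).trans_lt hint.2).ne
  have mswap : Measurable fun q : (ℝ × Ω₁ × Ω₂) × (Fin d → ℝ) => (q.1.1, q.2, q.1.2) := by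
    fun_prop
  have mρ' := mρ.comp mswap
  have mg' := mg.comp mswap
  have ma₁ : Measurable (A₁ (Lp.const 2 μ₁ 1) : Ω₁ → ℝ) := (Lp.stronglyMeasurable _).measurable
  have ma₂ : Measurable (A₂ (Lp.const 2 μ₂ 1) : Ω₂ → ℝ) := (Lp.stronglyMeasurable _).measurable
  -- The budget: the logarithmic Sobolev constant equals the decay rate plus the coupling constant,
  -- the factor 2 being Pinsker's.
  have hlam : ENNReal.ofReal (decayRate L κ D n)
      + ENNReal.ofReal (κ * laplacianNorm L D) * (2 * ENNReal.ofReal n)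
      = ENNReal.ofReal (4 * Real.pi ^ 2 / L ^ 2) := by
    have hk : 0 ≤ κ * laplacianNorm L D := mul_nonneg hκ.le (laplacianNorm_nonneg L D)
    rw [← ENNReal.ofReal_ofNat 2, ← ENNReal.ofReal_mul two_pos.le, ← ENNReal.ofReal_mul hk,
      ← ENNReal.ofReal_add hα.le (by positivity)]
    congr 1
    unfold decayRate
    ring
  obtain ⟨hfin, hdecay⟩ := lintegral_toReal_le_exp_mul (P := P)
    (h := fun t ξ => ENNReal.ofReal (boxEntropy L fun x => ρ t x ξ))
    (w := fun t ξ => ∫⁻ x, ‖ρ t x ξ - rhoInf d L‖ₑ ∂(boxMeasure d L))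
    -- The subtracted term is A₁A₂ρ_∞; it depends on ξ but not on x or t, so it is an admissible
    -- recentring constant for each ξ.
    (W := fun t ξ => ∫⁻ x, ‖g t x ξ - rhoInf d L * A₂ (Lp.const 2 μ₂ 1) ξ.2
      * A₁ (Lp.const 2 μ₁ 1) ξ.1‖ₑ ∂(boxMeasure d L))
    (StronglyMeasurable.integral_prod_right (ν := boxMeasure d L)
      (f := fun (q : ℝ × Ω₁ × Ω₂) x => ρ q.1 x q.2 * Real.log (ρ q.1 x q.2 / rhoInf d L))
      (mρ'.mul (Real.measurable_log.comp (mρ'.div_const _))).stronglyMeasurable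
      ).measurable.ennreal_ofReal
    ((mρ'.sub measurable_const).enorm.lintegral_prod_right')
    (Measurable.lintegral_prod_right' (ν := boxMeasure d L)
      (f := fun q : (ℝ × Ω₁ × Ω₂) × (Fin d → ℝ) => ‖g q.1.1 q.2 q.1.2 -
        rhoInf d L * A₂ (Lp.const 2 μ₂ 1) q.1.2.2 * A₁ (Lp.const 2 μ₁ 1) q.1.2.1‖ₑ)
      (mg'.sub ((measurable_const.mul (ma₂.comp (by fun_prop))).mul
        (ma₁.comp (by fun_prop)))).enorm)
    ENNReal.ofReal_ne_top ENNReal.ofReal_ne_top ENNReal.ofReal_ne_top hlam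
    (by
      filter_upwards [hgood] with ξ hξ t ht
      exact lintegral_enorm_sub_rhoInf_le_two hL (hξ.2.1 t ht) (hξ.2.2.1 t ht) (hξ.2.2.2 t ht))
    (by
      filter_upwards [hgood] with ξ hξ t ht
      exact sq_lintegral_enorm_sub_rhoInf_le hL (hξ.2.1 t ht) (hξ.2.2.1 t ht) (hξ.2.2.2 t ht))
    (fun t ht => (hact t ht).lintegral_sq_le_numericalRadius hA₁ hA₂ (mρt t) _)
    (by
      filter_upwards [hgood] with ξ hξ a b ha hab hW
      exact hξ.1.lintegral_entropy_inequality hL hκ hD hξ.2.2.1 hξ.2.2.2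
        (mg.comp (f := fun q : ℝ × (Fin d → ℝ) => (q.1, q.2, ξ)) (by fun_prop)) ha hab _ hW)
    hE0 ht
  refine ⟨finiteEntropy_of_lintegral_ne_top hL (mρt t) (hgood.mono fun ξ hξ => hξ.2.1 t ht)
    (hgood.mono fun ξ hξ => hξ.2.2.1 t ht) hfin, ?_⟩
  rw [ENNReal.toReal_ofReal hα.le,
    ← relEntropy_eq_toReal (mρt t) (hent.mono fun ξ hξ => hξ t ht),
    ← relEntropy_eq_toReal (mρt 0) (hent.mono fun ξ hξ => hξ 0 le_rfl), hrel0] at hdecay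
  exact hdecay
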